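/- **Conventions.** A search problem is a relation $R\subseteq\{0,1\}^*\times\{0,1\}^*$; $(x,y)\in R$ means that $y$ is a solution of the instance $x$. $R$ is in TFNP if $(x,y)\in R$ is decidable by a Turing machine in time polynomial in $|x|+|y|$, there is a polynomial $p$ with $|y|\le p(|x|)$ whenever $(x,y)\in R$, and every $x$ has a solution. $R$ *many-one reduces* to $S$ if there are polynomial-time computable functions $f,g$ such that $(f(x),y)\in S$ implies $(x,g(x,y))\in R$. In the two problems below, the circuits are Boolean circuits encoded as bit strings, and a string which is not an instance of the stated form has the single solution $0$. **End-of-Line.** Given $n$ and Boolean circuits $S,P:\{0,1\}^n\to\{0,1\}^n$ with $P(0^n)=0^n\neq S(0^n)$, find $x\in\{0,1\}^n$ such that $P(S(x))\neq x$, or $S(P(x))\neq x$ and $x\ne 0^n$. The class PPAD is the set of all TFNP problems that many-one reduce to End-of-Line. **Bipartite-mod-$k$** ($k\ge 2$). Given $n$ and a Boolean circuit $C:\{0,1\}\times\{0,1\}^n\to(\{0,1\}\times\{0,1\}^n)^k$, write $C(u)$ for the set of those listed vertices whose first bit differs from the first bit of $u$. The condition on the instance is $1\le|C(00^n)|\le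 k-1$. Find - $u\in\{0,1\}\times\{0,1\}^n$ with $u\neq 00^n$ and $|C(u)|\notin\{0,k\}$, or - $x,y\in\{0,1\}^n$ such that exactly one of $1y\in C(0x)$ and $0x\in C(1y)$ holds. The class PPA-$k$ is the set of all TFNP problems that many-one reduce to Bipartite-mod-$k$. **Corollary.** For every integer $k\ge2$, $\mathrm{PPAD}\subseteq\text{PPA-}k$. -/

import Mathlib

namespace SearchClasses

/-! ### Polynomial time, search problems, TFNP and reductions -/

/-- A search problem: a binary relation on bit strings, `R x y` meaning that `y` is a solution of
the instance `x`. -/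
abbrev SearchProblem := List Bool → List Bool → Prop

/-- A pair of bit strings as one string over `{0, 1, #}`, namely `x # y`. -/
def encodePair (p : List Bool × List Bool) : List (Option Bool) :=
  p.1.map some ++ none :: p.2.map some

/-- Functions on bit strings that a Turing machine computes in polynomial time. -/
def PolyTime (f : List Bool → List Bool) : Prop :=
  Nonempty (Turing.TM2ComputableInPolyTime (id : List Bool → List Bool)
    (id : List Bool → List Bool) f)

/-- Functions of two bit strings computed in time polynomial in the total length of the
arguments. -/
def PolyTime₂ (g : List Bool → List Bool → List Bool) : Prop :=
  Nonempty (Turing.TM2ComputableInPolyTime encodePair (id : List Bool → List Bool)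
    (fun p => g p.1 p.2))

/-- Relations on bit strings decided in time polynomial in the total length of the arguments. -/
def PolyTimeDecidable (R : SearchProblem) : Prop :=
  ∃ d : List Bool → List Bool → Bool, (∀ x y, d x y = true ↔ R x y) ∧
    Nonempty (Turing.TM2ComputableInPolyTime encodePair (fun b : Bool => [b])
      (fun p => d p.1 p.2))

/-- The class FNP. -/
def FNP : Set SearchProblem :=
  {R | PolyTimeDecidable R ∧
    ∃ p : Polynomial ℕ, ∀ x y, R x y → y.length ≤ p.eval x.length}

/-- The class TFNP: the total problems in FNP. -/
def TFNP : Set SearchProblem :=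
  {R | R ∈ FNP ∧ ∀ x, ∃ y, R x y}

/-- Polynomial-time many-one reductions between search problems. -/
def Reduces (R S : SearchProblem) : Prop :=
  ∃ (f : List Bool → List Bool) (g : List Bool → List Bool → List Bool),
    PolyTime f ∧ PolyTime₂ g ∧ ∀ x y, S (f x) y → R x (g x y)

/-! ### Boolean circuits -/

/-- The gates of a Boolean circuit. The numbers `i`, `j` name the input wires of the gate; wires
are counted backwards from the gate, wire `0` being the one produced last before it. -/
inductive Gate
  | const (b : Bool)
  | not (i : ℕ)
  | and (i j : ℕ)
  | or (i j : ℕ)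

namespace Gate

/-- The value of a gate, given the values of the existing wires (the latest first). -/
def eval (w : List Bool) : Gate → Bool
  | const b => b
  | not i => !(w.getD i false)
  | and i j => w.getD i false && w.getD j false
  | or i j => w.getD i false || w.getD j false

/-- The gate refers only to the `s` existing wires. -/
def InRange (s : ℕ) : Gate → Prop
  | const _ => True
  | not i => i < s
  | and i j => i < s ∧ j < s
  | or i j => i < s ∧ j < s

end Gate

/-- A Boolean circuit: a directed acyclic network of gates, listed in topological order. -/
abbrev Circuit := List Gate

namespace Circuit

/-- The values of all wires, the latest first, when the circuit is run on the wires `w`. -/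
def run : Circuit → List Bool → List Bool
  | [], w => w
  | g :: c, w => run c (g.eval w :: w)

/-- Every gate refers only to existing wires, if there are `s` wires at the start. -/
def WellFormed : Circuit → ℕ → Prop
  | [], _ => True
  | g :: c, s => g.InRange s ∧ WellFormed c (s + 1)

/-- `c` is a circuit with `n` inputs and `m` outputs. -/
def HasType (c : Circuit) (n m : ℕ) : Prop :=
  c.WellFormed n ∧ m ≤ n + c.length

/-- The output of a circuit with `m` outputs on the input `x`: the values of the last `m` wires,
the latest first (the bits of `x` are the wires that exist at the start, the first bit being
wire `0`). -/
def output (c : Circuit) (m : ℕ) (x : List Bool) : List Bool :=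
  (c.run x).take m

end Circuit

/-! ### Encoding of circuits by bit strings -/

/-- A number `n` in unary: `1ⁿ0`. -/
def encodeNat (n : ℕ) : List Bool := List.replicate n true ++ [false]

/-- A gate as a bit string. -/
def Gate.encode : Gate → List Bool
  | const b => [false, false, b]
  | not i => false :: true :: encodeNat i
  | and i j => true :: false :: (encodeNat i ++ encodeNat j)
  | or i j => true :: true :: (encodeNat i ++ encodeNat j)

/-- A circuit as a bit string: each gate is preceded by `1`, and the list is closed by `0`. -/
def Circuit.encode : Circuit → List Bool
  | [] => [false]
  | g :: c => true :: (g.encode ++ Circuit.encode c)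

theorem encodeNat_append_inj {m n : ℕ} {r s : List Bool}
    (h : encodeNat m ++ r = encodeNat n ++ s) : m = n ∧ r = s := by
  induction m generalizing n with
  | zero =>
    cases n with
    | zero => simpa [encodeNat] using h
    | succ n => simp [encodeNat, List.replicate_succ] at h
  | succ m ih =>
    cases n with
    | zero => simp [encodeNat, List.replicate_succ] at h
    | succ n =>
      have h2 : encodeNat m ++ r = encodeNat n ++ s := by
        simpa [encodeNat, List.replicate_succ] using h
      have := ih h2
      exact ⟨by rw [this.1], this.2⟩

theorem Gate.encode_append_inj {a b : Gate} {r s : List Bool}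
    (h : a.encode ++ r = b.encode ++ s) : a = b ∧ r = s := by
  cases a <;> cases b <;> simp only [Gate.encode, List.cons_append, List.append_assoc,
    List.cons.injEq, List.nil_append, reduceCtorEq, false_and, and_false, true_and] at h
  case const.const => simpa using h
  case not.not =>
    obtain ⟨h1, h2⟩ := encodeNat_append_inj h
    exact ⟨by rw [h1], h2⟩
  case and.and =>
    obtain ⟨h1, h2⟩ := encodeNat_append_inj h
    obtain ⟨h3, h4⟩ := encodeNat_append_inj h2
    exact ⟨by rw [h1, h3], h4⟩
  case or.or =>
    obtain ⟨h1, h2⟩ := encodeNat_append_inj h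
    obtain ⟨h3, h4⟩ := encodeNat_append_inj h2
    exact ⟨by rw [h1, h3], h4⟩

theorem Circuit.encode_append_inj {a b : Circuit} {r s : List Bool}
    (h : a.encode ++ r = b.encode ++ s) : a = b ∧ r = s := by
  induction a generalizing b with
  | nil =>
    cases b with
    | nil => simpa [Circuit.encode] using h
    | cons g b => simp [Circuit.encode] at h
  | cons g a ih =>
    cases b with
    | nil => simp [Circuit.encode] at h
    | cons g2 b =>
      simp only [Circuit.encode, List.cons_append, List.append_assoc, List.cons.injEq,
        true_and] at h
      obtain ⟨h1, h2⟩ := Gate.encode_append_inj h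
      obtain ⟨h3, h4⟩ := ih h2
      exact ⟨by rw [h1, h3], h4⟩

/-! ### Search problems with a restricted set of instances -/

/-- The search problem with instances `i : ι`, encoded by `enc` and restricted to the valid ones,
and with solutions `sol i`. A string that encodes no valid instance has the single
solution `0`. -/
def problemOf {ι : Type} (enc : ι → List Bool) (valid : ι → Prop)
    (sol : ι → List Bool → Prop) : SearchProblem := fun x y =>
  (∃ i, valid i ∧ x = enc i ∧ sol i y) ∨ ((¬ ∃ i, valid i ∧ x = enc i) ∧ y = [false])

/-- The string `0ⁿ`. -/
def zeros (n : ℕ) : List Bool := List.replicate n false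

/-! ### End-of-Line and PPAD -/

/-- An instance of End-of-Line: circuits `S` (successor) and `P` (predecessor) on `{0,1}ⁿ`. -/
structure LineInstance where
  n : ℕ
  S : Circuit
  P : Circuit

namespace LineInstance

def encode (I : LineInstance) : List Bool :=
  encodeNat I.n ++ (I.S.encode ++ I.P.encode)

theorem encode_injective : Function.Injective encode := by
  rintro ⟨n, S, P⟩ ⟨n2, S2, P2⟩ h
  obtain ⟨h1, h2⟩ := encodeNat_append_inj h
  obtain ⟨h3, h4⟩ := Circuit.encode_append_inj h2
  obtain ⟨h5, -⟩ := Circuit.encode_append_inj (r := []) (s := []) (by simpa using h4)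
  simp_all

/-- The successor of `x`. -/
def succ (I : LineInstance) (x : List Bool) : List Bool := I.S.output I.n x

/-- The predecessor of `x`. -/
def pred (I : LineInstance) (x : List Bool) : List Bool := I.P.output I.n x

/-- `0ⁿ` is a source: `P(0ⁿ) = 0ⁿ ≠ S(0ⁿ)`. -/
def Valid (I : LineInstance) : Prop :=
  I.S.HasType I.n I.n ∧ I.P.HasType I.n I.n ∧
    I.pred (zeros I.n) = zeros I.n ∧ I.succ (zeros I.n) ≠ zeros I.n

/-- The solutions: the end of a line, or the start of a line other than `0ⁿ`. -/
def Solution (I : LineInstance) (x : List Bool) : Prop :=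
  x.length = I.n ∧
    (I.pred (I.succ x) ≠ x ∨ (I.succ (I.pred x) ≠ x ∧ x ≠ zeros I.n))

end LineInstance

/-- The problem End-of-Line. -/
def EndOfLine : SearchProblem :=
  problemOf LineInstance.encode LineInstance.Valid LineInstance.Solution

/-- The class PPAD: the TFNP problems that many-one reduce to End-of-Line. -/
def PPAD : Set SearchProblem := {R | R ∈ TFNP ∧ Reduces R EndOfLine}

/-! ### Bipartite-mod-k and PPA-k -/

/-- An instance of Bipartite-mod-`k`: a circuit from `{0,1} × {0,1}ⁿ` to
`({0,1} × {0,1}ⁿ)ᵏ`. -/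
structure BipartiteInstance where
  n : ℕ
  C : Circuit

namespace BipartiteInstance

def encode (I : BipartiteInstance) : List Bool :=
  encodeNat I.n ++ I.C.encode

theorem encode_injective : Function.Injective encode := by
  rintro ⟨n, C⟩ ⟨n2, C2⟩ h
  obtain ⟨h1, h2⟩ := encodeNat_append_inj h
  obtain ⟨h3, -⟩ := Circuit.encode_append_inj (r := []) (s := []) (by simpa using h2)
  simp_all

/-- The `i`-th of the strings of length `n + 1` that `C` outputs at the vertex `u`. -/
def entry (k : ℕ) (I : BipartiteInstance) (u : List Bool) (i : ℕ) : List Bool :=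
  ((I.C.output (k * (I.n + 1)) u).drop (i * (I.n + 1))).take (I.n + 1)

/-- The set `C(u)` of potential neighbours of the vertex `u`: the listed vertices on the other
side of the bipartition. Listed vertices on the same side (as copies of `u`) are ignored, so that
a list can stand for fewer than `k` neighbours. -/
def nbrs (k : ℕ) (I : BipartiteInstance) (u : List Bool) : Finset (List Bool) :=
  ((Finset.range k).image (I.entry k u)).filter (fun v => v.head? ≠ u.head?)

/-- The distinguished vertex `00ⁿ` has between `1` and `k - 1` neighbours. -/
def Valid (k : ℕ) (I : BipartiteInstance) : Prop :=
  I.C.HasType (I.n + 1) (k * (I.n + 1)) ∧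
    1 ≤ (I.nbrs k (zeros (I.n + 1))).card ∧ (I.nbrs k (zeros (I.n + 1))).card < k

/-- The solutions: a vertex `u ≠ 00ⁿ` whose degree is not `0` or `k` (written `0u`), or an
inconsistent pair `0x`, `1y`, one of which lists the other but not conversely (written `1xy`). -/
def Solution (k : ℕ) (I : BipartiteInstance) (s : List Bool) : Prop :=
  (∃ u : List Bool, s = false :: u ∧ u.length = I.n + 1 ∧ u ≠ zeros (I.n + 1) ∧
    (I.nbrs k u).card ≠ 0 ∧ (I.nbrs k u).card ≠ k) ∨
  (∃ x y : List Bool, s = true :: (x ++ y) ∧ x.length = I.n ∧ y.length = I.n ∧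
    ((true :: y ∈ I.nbrs k (false :: x) ∧ false :: x ∉ I.nbrs k (true :: y)) ∨
     (false :: x ∈ I.nbrs k (true :: y) ∧ true :: y ∉ I.nbrs k (false :: x))))

end BipartiteInstance

/-- The problem Bipartite-mod-`k`. -/
def BipartiteMod (k : ℕ) : SearchProblem :=
  problemOf BipartiteInstance.encode (BipartiteInstance.Valid k) (BipartiteInstance.Solution k)

/-- The class PPA-`k`: the TFNP problems that many-one reduce to Bipartite-mod-`k`. -/
def PPAk (k : ℕ) : Set SearchProblem := {R | R ∈ TFNP ∧ Reduces R (BipartiteMod k)}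

end SearchClasses

namespace SearchClasses

open Turing Function

/-! ### Structured programs for stack machines -/

/-! Write `k = t + 1` and let `S`, `P` be an instance of End-of-Line on `n` bits. The vertices of
the bipartite graph are the triples `(b, e, x)` of a bit `b`, a word `e` of length `t` and a word
`x` of length `n`. Changing `b` together with one bit of `e` joins each vertex to `t` others. One
further edge changes `b` and keeps `e`. If `e ≠ 0`, it leads to `(!b, e, x)`. If `e = 0`, it leads
from `(1, 0, x)` to `(0, 0, S x)` when `P (S x) = x`, and from `(0, 0, y)` to `(1, 0, P y)` when `S
(P y) = y`; these conditions agree on the two ends of an edge.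

So every vertex has degree `t` or `t + 1`, and the degree is `t` exactly at the vertices with `e =
0` for which `x` is the end of a line (`b = 1`) or the start of one (`b = 0`). The vertex `(0, 0,
0)` is the start that is given, and its degree `t` is at least `1` because `k ≥ 2`. Adjacency is
symmetric, so an inconsistent pair never occurs, and any other vertex of wrong degree yields a
solution of End-of-Line on dropping `b` and `e` (`solution_of_toBipartite`).

A string without a valid instance has the solution `0` and nothing else, so the reduction must send
such strings to such strings. Hence the new instance has to be valid if and only if the old one is
(`valid_toBipartite`). This explains an extra clause in `full` and two circuits in `toBipartite`
whose values are ignored.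

It remains to see that the reduction takes polynomial time. Structured programs for stack machines
show that polynomial-time functions contain the finite transducers and are closed under composition,
pairing and folds with polynomially bounded values. Numbers are coded in unary, so transducers parse
the instances. The new circuit is given by a fixed program whose operations act on whole blocks of
wires; each operation expands to gates that depend only on the sizes of the blocks and on the two
given circuits (`PT.compileAll`). -/

/-- A view of a component of type `τ` in a larger state `σ`. -/
structure Lens (σ τ : Type) where
  get : σ → τ
  set : τ → σ → σ
  get_set : ∀ a v, get (set a v) = a
  set_get : ∀ v, set (get v) v = v
  set_set : ∀ a b v, set a (set b v) = set a v

attribute [simp] Lens.get_set Lens.set_get Lens.set_set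

/-- The contents of a family of stacks. -/
abbrev Stacks {K : Type} (Γ : K → Type) := ∀ k, List (Γ k)

/-- Structured programs over the stacks `Γ` and the internal state `σ`. -/
inductive Cmd {K : Type} (Γ : K → Type) (σ : Type) : Type 1
  | skip : Cmd Γ σ
  | push (k : K) (f : σ → Γ k) : Cmd Γ σ
  | pop (k : K) (f : σ → Option (Γ k) → σ) : Cmd Γ σ
  | load (f : σ → σ) : Cmd Γ σ
  | seq (a b : Cmd Γ σ) : Cmd Γ σ
  | ite (p : σ → Bool) (a b : Cmd Γ σ) : Cmd Γ σ
  | loop (pre : Cmd Γ σ) (p : σ → Bool) (body : Cmd Γ σ) : Cmd Γ σ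
  | mach {Λ : Type} (fin : Fintype Λ) (main : Λ) (m : Λ → TM2.Stmt Γ Λ σ) : Cmd Γ σ

namespace Cmd

variable {K : Type} {Γ : K → Type} {σ : Type}

/-- The labels that a program needs. -/
def Labels : Cmd Γ σ → Type
  | skip | push _ _ | pop _ _ | load _ => Empty
  | seq a b => a.Labels ⊕ b.Labels
  | ite _ a b => a.Labels ⊕ b.Labels
  | loop a _ b => Option (a.Labels ⊕ b.Labels)
  | @mach _ _ _ Λ _ _ _ => Λ

/-- The labels of a program form a finite type. -/
@[reducible] def labelsFintype : (c : Cmd Γ σ) → Fintype c.Labels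
  | skip | push _ _ | pop _ _ | load _ => inferInstanceAs (Fintype Empty)
  | seq a b => @instFintypeSum _ _ a.labelsFintype b.labelsFintype
  | ite _ a b => @instFintypeSum _ _ a.labelsFintype b.labelsFintype
  | loop a _ b =>
    @instFintypeOption _ (@instFintypeSum _ _ a.labelsFintype b.labelsFintype)
  | mach fin _ _ => fin

end Cmd

/-- Rename the labels of a statement and replace `halt` by `q`. -/
def stmtBind {K : Type} {Γ : K → Type} {σ Λ L : Type} (inj : Λ → L) (q : TM2.Stmt Γ L σ) :
    TM2.Stmt Γ Λ σ → TM2.Stmt Γ L σ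
  | .push k f s => .push k f (stmtBind inj q s)
  | .peek k f s => .peek k f (stmtBind inj q s)
  | .pop k f s => .pop k f (stmtBind inj q s)
  | .load f s => .load f (stmtBind inj q s)
  | .branch p s t => .branch p (stmtBind inj q s) (stmtBind inj q t)
  | .goto l => .goto fun v => inj (l v)
  | .halt => q

namespace Cmd

variable {K : Type} {Γ : K → Type} {σ : Type}

/-- The statement that starts a program and continues with `q`. -/
def entry {L : Type} : (c : Cmd Γ σ) → (c.Labels → L) → TM2.Stmt Γ L σ → TM2.Stmt Γ L σ
  | skip, _, q => q
  | push k f, _, q => .push k f q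
  | pop k f, _, q => .pop k f q
  | load f, _, q => .load f q
  | seq a b, inj, q => a.entry (fun l => inj (.inl l)) (b.entry (fun l => inj (.inr l)) q)
  | ite p a b, inj, q =>
    .branch p (a.entry (fun l => inj (.inl l)) q) (b.entry (fun l => inj (.inr l)) q)
  | loop _ _ _, inj, _ => .goto fun _ => inj none
  | mach _ main _, inj, _ => .goto fun _ => inj main

/-- The statements at the labels of a program that continues with `q`. -/
def code {L : Type} : (c : Cmd Γ σ) → (c.Labels → L) → TM2.Stmt Γ L σ → c.Labels →
    TM2.Stmt Γ L σ
  | seq a b, inj, q, .inl l =>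
    a.code (fun l => inj (.inl l)) (b.entry (fun l => inj (.inr l)) q) l
  | seq _ b, inj, q, .inr l => b.code (fun l => inj (.inr l)) q l
  | ite _ a _, inj, q, .inl l => a.code (fun l => inj (.inl l)) q l
  | ite _ _ b, inj, q, .inr l => b.code (fun l => inj (.inr l)) q l
  | loop a p b, inj, q, none =>
    a.entry (fun l => inj (some (.inl l)))
      (.branch p (b.entry (fun l => inj (some (.inr l))) (.goto fun _ => inj none)) q)
  | loop a p b, inj, q, some (.inl l) =>
    a.code (fun l => inj (some (.inl l)))
      (.branch p (b.entry (fun l => inj (some (.inr l))) (.goto fun _ => inj none)) q) l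
  | loop _ _ b, inj, _, some (.inr l) =>
    b.code (fun l => inj (some (.inr l))) (.goto fun _ => inj none) l
  | mach _ _ m, inj, q, l => stmtBind inj q (m l)

end Cmd

/-! ### Execution -/

section Exec

variable {K : Type} [DecidableEq K] {Γ : K → Type} {σ : Type}

/-- `M` goes from `c` to `d` in at most `t` steps. -/
def ReachesIn {Λ : Type} (M : Λ → TM2.Stmt Γ Λ σ) (t : ℕ) (c d : TM2.Cfg Γ Λ σ) : Prop :=
  ∃ t' ≤ t, (flip bind (TM2.step M))^[t'] (some c) = some d

theorem ReachesIn.refl {Λ : Type} {M : Λ → TM2.Stmt Γ Λ σ} (t : ℕ) (c : TM2.Cfg Γ Λ σ) :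
    ReachesIn M t c c := ⟨0, Nat.zero_le _, rfl⟩

theorem ReachesIn.trans {Λ : Type} {M : Λ → TM2.Stmt Γ Λ σ} {t₁ t₂ : ℕ} {a b c : TM2.Cfg Γ Λ σ}
    (h₁ : ReachesIn M t₁ a b) (h₂ : ReachesIn M t₂ b c) : ReachesIn M (t₁ + t₂) a c := by
  obtain ⟨s₁, l₁, e₁⟩ := h₁
  obtain ⟨s₂, l₂, e₂⟩ := h₂
  exact ⟨s₂ + s₁, by omega, by rw [Function.iterate_add_apply, e₁, e₂]⟩

theorem ReachesIn.step {Λ : Type} {M : Λ → TM2.Stmt Γ Λ σ} {l : Λ} {v : σ} {S : Stacks Γ} :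
    ReachesIn M 1 ⟨some l, v, S⟩ (TM2.stepAux (M l) v S) := ⟨1, le_rfl, rfl⟩

theorem ReachesIn.mono {Λ : Type} {M : Λ → TM2.Stmt Γ Λ σ} {t₁ t₂ : ℕ} {a b : TM2.Cfg Γ Λ σ}
    (h : ReachesIn M t₁ a b) (ht : t₁ ≤ t₂) : ReachesIn M t₂ a b := by
  obtain ⟨s, l, e⟩ := h
  exact ⟨s, l.trans ht, e⟩

/-- `Exec c v S v' S' t`: the program `c` leads from the state `v` and the stacks `S` to the state
`v'` and the stacks `S'` in at most `t` steps. -/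
inductive Exec : Cmd Γ σ → σ → Stacks Γ → σ → Stacks Γ → ℕ → Prop
  | skip {v S} : Exec .skip v S v S 0
  | push {k f v S} : Exec (.push k f) v S v (update S k (f v :: S k)) 0
  | pop {k f v S} : Exec (.pop k f) v S (f v (S k).head?) (update S k (S k).tail) 0
  | load {f v S} : Exec (.load f) v S (f v) S 0
  | seq {a b v S v' S' v'' S'' t t'} : Exec a v S v' S' t → Exec b v' S' v'' S'' t' →
      Exec (.seq a b) v S v'' S'' (t + t')
  | iteTrue {p a b v S v' S' t} : p v = true → Exec a v S v' S' t → Exec (.ite p a b) v S v' S' t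
  | iteFalse {p a b v S v' S' t} : p v = false → Exec b v S v' S' t →
      Exec (.ite p a b) v S v' S' t
  | loopDone {a p b v S v' S' t} : Exec a v S v' S' t → p v' = false →
      Exec (.loop a p b) v S v' S' (t + 1)
  | loopStep {a p b v S v' S' v'' S'' w U t t' t''} : Exec a v S v' S' t → p v' = true →
      Exec b v' S' v'' S'' t' → Exec (.loop a p b) v'' S'' w U t'' →
      Exec (.loop a p b) v S w U (t + 1 + t' + t'')
  | mach {Λ : Type} {fin : Fintype Λ} {main : Λ} {m : Λ → TM2.Stmt Γ Λ σ} {v S v' S' t} :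
      ReachesIn m t ⟨some main, v, S⟩ ⟨none, v', S'⟩ →
      Exec (.mach fin main m) v S v' S' t
  | weaken {c v S v' S' t t'} : Exec c v S v' S' t → t ≤ t' → Exec c v S v' S' t'

theorem stepAux_stmtBind {Λ L : Type} (inj : Λ → L) (q : TM2.Stmt Γ L σ) (s : TM2.Stmt Γ Λ σ)
    (v : σ) (S : Stacks Γ) :
    TM2.stepAux (stmtBind inj q s) v S =
      match TM2.stepAux s v S with
      | ⟨some l, v', S'⟩ => ⟨some (inj l), v', S'⟩
      | ⟨none, v', S'⟩ => TM2.stepAux q v' S' := by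
  induction s generalizing v S with
  | push k f s ih => exact ih _ _
  | peek k f s ih => exact ih _ _
  | pop k f s ih => exact ih _ _
  | load f s ih => exact ih _ _
  | branch p s t ihs iht =>
    simp only [stmtBind, TM2.stepAux]
    cases p v
    · exact iht _ _
    · exact ihs _ _
  | goto l => rfl
  | halt => rfl

theorem iterate_flip_bind_none {α : Type*} (f : α → Option α) (t : ℕ) :
    (flip bind f)^[t] none = none := by
  induction t with
  | zero => rfl
  | succ t ih => exact ih

/-- The two machines run in lockstep. The step in which `m` halts is the step that already executes
`q`, so no time is lost at the seam. -/
theorem reachesIn_stmtBind {Λ L : Type} {m : Λ → TM2.Stmt Γ Λ σ} {M : L → TM2.Stmt Γ L σ}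
    {inj : Λ → L} {q : TM2.Stmt Γ L σ} (hM : ∀ l, M (inj l) = stmtBind inj q (m l)) {t : ℕ}
    {l : Λ} {v : σ} {S : Stacks Γ} {v' : σ} {S' : Stacks Γ}
    (h : ReachesIn m t ⟨some l, v, S⟩ ⟨none, v', S'⟩) :
    ReachesIn M t ⟨some (inj l), v, S⟩ (TM2.stepAux q v' S') := by
  obtain ⟨s, hs, e⟩ := h
  induction s generalizing t l v S with
  | zero => simp at e
  | succ s ih =>
    obtain ⟨t, rfl⟩ : ∃ r, t = 1 + r := ⟨t - 1, by omega⟩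
    refine ReachesIn.trans ReachesIn.step ?_
    rw [hM, stepAux_stmtBind]
    rw [Function.iterate_succ_apply] at e
    change (flip bind (TM2.step m))^[s] (some (TM2.stepAux (m l) v S)) = _ at e
    generalize TM2.stepAux (m l) v S = c at e ⊢
    obtain ⟨l', w, U⟩ := c
    cases l' with
    | some l' => exact ih (by omega) e
    | none =>
      cases s with
      | zero =>
        simp only [iterate_zero, id, Option.some.injEq, TM2.Cfg.mk.injEq, true_and] at e
        obtain ⟨rfl, rfl⟩ := e
        exact ReachesIn.refl _ _
      | succ s =>
        rw [Function.iterate_succ_apply] at e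
        change (flip bind (TM2.step m))^[s] none = _ at e
        rw [iterate_flip_bind_none] at e
        cases e

/-- Correctness of the compilation. One machine step executes a whole statement up to its next jump,
so straight-line code is free; only loop heads and embedded machines are charged in `Exec`. -/
theorem Exec.reachesIn {c : Cmd Γ σ} {v : σ} {S : Stacks Γ} {v' : σ} {S' : Stacks Γ} {t : ℕ}
    (h : Exec c v S v' S' t) {L : Type} {M : L → TM2.Stmt Γ L σ} {inj : c.Labels → L}
    {q : TM2.Stmt Γ L σ} (hM : ∀ l, M (inj l) = c.code inj q l) :
    ReachesIn M t (TM2.stepAux (c.entry inj q) v S) (TM2.stepAux q v' S') := by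
  induction h generalizing q with
  | skip => exact ReachesIn.refl _ _
  | push => exact ReachesIn.refl _ _
  | pop => exact ReachesIn.refl _ _
  | load => exact ReachesIn.refl _ _
  | seq _ _ ih₁ ih₂ =>
    exact (ih₁ fun l => hM (.inl l)).trans (ih₂ fun l => hM (.inr l))
  | iteTrue hp _ ih =>
    simp only [Cmd.entry, TM2.stepAux, hp, cond_true]
    exact ih fun l => hM (.inl l)
  | iteFalse hp _ ih =>
    simp only [Cmd.entry, TM2.stepAux, hp, cond_false]
    exact ih fun l => hM (.inr l)
  | @loopDone a p b v S v' S' t _ hp ih =>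
    rw [add_comm]
    refine ReachesIn.trans ReachesIn.step ?_
    rw [hM none]
    have := @ih _ (.branch p (b.entry (fun l => inj (some (.inr l))) (.goto fun _ => inj none)) q)
      fun l => hM (some (.inl l))
    rwa [TM2.stepAux, hp, cond_false] at this
  | @loopStep a p b v S v' S' v'' S'' w U t t' t'' _ hp _ _ ih₁ ih₂ ih₃ =>
    have h₁ := @ih₁ _ (.branch p (b.entry (fun l => inj (some (.inr l)))
      (.goto fun _ => inj none)) q) fun l => hM (some (.inl l))
    rw [TM2.stepAux, hp, cond_true] at h₁
    have h₂ := @ih₂ _ (.goto fun _ => inj none) fun l => hM (some (.inr l))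
    have h₃ := ih₃ hM
    refine ReachesIn.trans (ReachesIn.trans ?_ h₂) h₃
    rw [add_comm t 1]
    refine ReachesIn.trans ReachesIn.step ?_
    rw [hM none]
    exact h₁
  | mach h => exact reachesIn_stmtBind hM h
  | weaken _ ht ih => exact (ih hM).mono ht

/-- The machine that executes a program, with input stack `k₀` and output stack `k₁`. -/
def Cmd.toFinTM2 [Fintype K] [Fintype σ] (c : Cmd Γ σ) (k₀ k₁ : K) [Fintype (Γ k₀)] (v₀ : σ) :
    FinTM2 :=
  letI := c.labelsFintype
  { K := K
    k₀ := k₀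
    k₁ := k₁
    Γ := Γ
    Λ := Option c.Labels
    main := none
    σ := σ
    initialState := v₀
    m := fun
      | none => c.entry some .halt
      | some l => c.code some .halt l }

theorem initList_stk (tm : FinTM2) (w : List (tm.Γ tm.k₀)) :
    (initList tm w).stk = update (fun _ => []) tm.k₀ w := by
  ext1 k
  by_cases h : k = tm.k₀
  · subst h; simp [initList]
  · simp [initList, h]

theorem haltList_stk (tm : FinTM2) (w : List (tm.Γ tm.k₁)) :
    (haltList tm w).stk = update (fun _ => []) tm.k₁ w := by
  ext1 k
  by_cases h : k = tm.k₁
  · subst h; simp [haltList]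
  · simp [haltList, h]

theorem initList_eq (tm : FinTM2) (w : List (tm.Γ tm.k₀)) :
    initList tm w = ⟨some tm.main, tm.initialState, update (fun _ => []) tm.k₀ w⟩ := by
  rw [← initList_stk]; rfl

theorem haltList_eq (tm : FinTM2) (w : List (tm.Γ tm.k₁)) :
    haltList tm w = ⟨none, tm.initialState, update (fun _ => []) tm.k₁ w⟩ := by
  rw [← haltList_stk]; rfl

theorem Exec.outputs [Fintype K] [Fintype σ] {c : Cmd Γ σ} {k₀ k₁ : K} [Fintype (Γ k₀)] {v₀ : σ}
    {x : List (Γ k₀)} {y : List (Γ k₁)} {t : ℕ}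
    (h : Exec c v₀ (update (fun _ => []) k₀ x) v₀ (update (fun _ => []) k₁ y) t) :
    Nonempty (TM2OutputsInTime (c.toFinTM2 k₀ k₁ v₀) x (some y) (t + 1)) := by
  have h₁ : ReachesIn (c.toFinTM2 k₀ k₁ v₀).m (1 + t)
      ⟨some none, v₀, update (fun _ => []) k₀ x⟩ ⟨none, v₀, update (fun _ => []) k₁ y⟩ :=
    ReachesIn.trans ReachesIn.step
      (h.reachesIn (M := (c.toFinTM2 k₀ k₁ v₀).m) (inj := some) (q := .halt) fun l => rfl)
  obtain ⟨s, hs, e⟩ := h₁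
  exact ⟨⟨⟨s, (congrArg (fun z => (flip bind (c.toFinTM2 k₀ k₁ v₀).step)^[s] (some z))
    (initList_eq (c.toFinTM2 k₀ k₁ v₀) x)).trans
      (e.trans (congrArg some (haltList_eq (c.toFinTM2 k₀ k₁ v₀) y).symm))⟩, by
        rw [add_comm]; exact hs⟩⟩

theorem TM2OutputsInTime.reachesIn {tm : FinTM2} {x : List (tm.Γ tm.k₀)} {y : List (tm.Γ tm.k₁)}
    {t : ℕ} (h : TM2OutputsInTime tm x (some y) t) :
    ReachesIn tm.m t ⟨some tm.main, tm.initialState, update (fun _ => []) tm.k₀ x⟩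
      ⟨none, tm.initialState, update (fun _ => []) tm.k₁ y⟩ := by
  rw [← initList_eq, ← haltList_eq]
  exact ⟨h.steps, h.steps_le_m, h.evals_in_steps⟩

end Exec

end SearchClasses

namespace SearchClasses

open Turing Function

/-! ### Lenses and basic programs -/

namespace Lens

/-- The first component of a pair. -/
def fst (σ τ : Type) : Lens (σ × τ) σ where
  get v := v.1
  set a v := (a, v.2)
  get_set _ _ := rfl
  set_get _ := rfl
  set_set _ _ _ := rfl

/-- The second component of a pair. -/
def snd (σ τ : Type) : Lens (σ × τ) τ where
  get v := v.2
  set a v := (v.1, a)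
  get_set _ _ := rfl
  set_get _ := rfl
  set_set _ _ _ := rfl

/-- Composition of lenses. -/
def comp {σ τ ρ : Type} (l : Lens σ τ) (m : Lens τ ρ) : Lens σ ρ where
  get v := m.get (l.get v)
  set a v := l.set (m.set a (l.get v)) v
  get_set _ _ := by simp
  set_get _ := by simp
  set_set _ _ _ := by simp

end Lens

section Programs

variable {K : Type} [DecidableEq K] {Γ : K → Type} {σ : Type}

/-- Pop the stack `a` until it is empty, running `body` after each pop with the popped symbol in
the buffer `buf`. -/
def Cmd.forPop (a : K) {X : Type} (rd : Γ a → X) (buf : Lens σ (Option X)) (body : Cmd Γ σ) :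
    Cmd Γ σ :=
  .loop (.pop a fun v s => buf.set (s.map rd) v) (fun v => (buf.get v).isSome) body

/-- The loop is described by an abstract state `c : C`, realised in the control by `V` and on the
stacks by `St`; one round turns `c` into `F c x`. The invariant `J` relates `c` to the symbols that
are still unread. -/
theorem Exec.forPop {C : Type*} {a : K} {X : Type} {rd : Γ a → X} {buf : Lens σ (Option X)}
    {body : Cmd Γ σ} (V : C → σ) (St : C → Stacks Γ) (F : C → Γ a → C)
    (J : List (Γ a) → C → Prop) (T : ℕ) (hV : ∀ c, buf.get (V c) = none)
    (hb : ∀ x l c, J (x :: l) c → J l (F c x) ∧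
      Exec body (buf.set (some (rd x)) (V c)) (update (St c) a l)
        (V (F c x)) (update (St (F c x)) a l) T) (l : List (Γ a)) (c : C) (hJ : J l c) :
    Exec (.forPop a rd buf body) (V c) (update (St c) a l) (V (l.foldl F c))
      (update (St (l.foldl F c)) a []) (l.length * (T + 1) + 1) := by
  induction l generalizing c with
  | nil =>
    have h := Exec.pop (k := a) (f := fun v s => buf.set (s.map rd) v) (v := V c)
      (S := update (St c) a [])
    have h0 : buf.set none (V c) = V c := by rw [← hV c, buf.set_get]
    simp only [update_self, List.head?_nil, Option.map_none, List.tail_nil, update_idem, h0] at h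
    exact (Exec.loopDone h (by simp [hV])).weaken (by simp)
  | cons x l ih =>
    have h := Exec.pop (k := a) (f := fun v s => buf.set (s.map rd) v) (v := V c)
      (S := update (St c) a (x :: l))
    simp only [update_self, List.head?_cons, Option.map_some, List.tail_cons, update_idem] at h
    obtain ⟨h1, h2⟩ := hb x l c hJ
    refine (Exec.loopStep h (by simp) h2 (ih _ h1)).weaken (le_of_eq ?_)
    simp only [List.length_cons]; ring

/-- Pop all symbols from the stack `a` and push them, translated, on the stack `b`. -/
def Cmd.move (a b : K) {X : Type} (rd : Γ a → X) (wr : Option X → Γ b) (buf : Lens σ (Option X)) :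
    Cmd Γ σ :=
  .forPop a rd buf (.seq (.push b fun v => wr (buf.get v)) (.load (buf.set none)))

/-- A word arrives reversed, which is why words are usually moved twice. -/
theorem Exec.move {a b : K} (hab : a ≠ b) {X : Type} {rd : Γ a → X} {wr : Option X → Γ b}
    {buf : Lens σ (Option X)} {v : σ} (hv : buf.get v = none) {S S' : Stacks Γ} (ha : S' a = [])
    (hb : S' b = ((S a).map fun x => wr (some (rd x))).reverse ++ S b)
    (hS : ∀ k, k ≠ a → k ≠ b → S' k = S k) {t : ℕ} (ht : (S a).length + 1 ≤ t) :
    Exec (.move a b rd wr buf) v S v S' t := by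
  have h0 : ∀ x, buf.set none (buf.set x v) = v := by
    intro x; rw [buf.set_set, ← hv, buf.set_get]
  have key := Exec.forPop (C := List (Γ b)) (a := a) (rd := rd) (buf := buf)
    (body := .seq (.push b fun v => wr (buf.get v)) (.load (buf.set none)))
    (fun _ => v) (fun c => update S b c) (fun c x => wr (some (rd x)) :: c)
    (fun _ _ => True) 0 (fun _ => hv) (by
      intro x l c _
      refine ⟨trivial, ?_⟩
      have := Exec.seq (Exec.push (k := b) (f := fun v => wr (buf.get v))
        (v := buf.set (some (rd x)) v) (S := update (update S b c) a l))
        (Exec.load (f := buf.set none))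
      rw [h0, buf.get_set, update_of_ne hab.symm, update_self, update_comm hab, update_idem] at this
      exact this) (S a) (S b) trivial
  have hf : ∀ (l : List (Γ a)) (c : List (Γ b)), l.foldl (fun c x => wr (some (rd x)) :: c) c =
      (l.map fun x => wr (some (rd x))).reverse ++ c := by
    intro l
    induction l with
    | nil => intro c; rfl
    | cons x l ih => intro c; simp [ih]
  simp only [hf, update_eq_self] at key
  have hS' : S' = update (update S b (((S a).map fun x => wr (some (rd x))).reverse ++ S b)) a [] := by
    ext1 k
    by_cases h1 : k = a
    · subst h1; simp [ha]
    · by_cases h2 : k = b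
      · subst h2; simp [hb, h1]
      · simp [h1, h2, hS k h1 h2]
  rw [hS']
  exact key.weaken (by omega)

/-- Push the word `w v`, of length at most `n`, letter by letter. -/
def Cmd.pushWord (k : K) (d : Γ k) : ℕ → (σ → List (Γ k)) → Cmd Γ σ
  | 0, _ => .skip
  | n + 1, w => .ite (fun v => (w v).isEmpty) .skip
      (.seq (.push k fun v => (w v).headD d) (.pushWord k d n fun v => (w v).tail))

/-- The word depends on the current state but the program text cannot, so the text is unrolled to
the maximal length `n` and leaves early on shorter words. -/
theorem Exec.pushWord {k : K} {d : Γ k} {n : ℕ} {w : σ → List (Γ k)} {v : σ} {S : Stacks Γ}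
    (h : (w v).length ≤ n) :
    Exec (.pushWord k d n w) v S v (update S k ((w v).reverse ++ S k)) 0 := by
  induction n generalizing w S with
  | zero =>
    have : w v = [] := List.length_eq_zero_iff.1 (by omega)
    simpa [this, Cmd.pushWord] using Exec.skip
  | succ n ih =>
    rcases hw : w v with _ | ⟨x, l⟩
    · refine Exec.iteTrue (by simp [hw]) ?_
      simpa using Exec.skip
    · refine Exec.iteFalse (by simp [hw]) ?_
      have h1 := Exec.push (k := k) (f := fun v => (w v).headD d) (v := v) (S := S)
      have h2 := ih (w := fun v => (w v).tail) (S := update S k ((w v).headD d :: S k))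
        (by simp only [List.length_tail]; omega)
      have h3 := Exec.seq h1 h2
      simpa [hw] using h3

/-! ### Calling a machine from a program -/

/-- A statement of a machine as a statement of a machine with more stacks and a larger state. -/
def stmtLift {K₁ : Type} {Γ₁ : K₁ → Type} {σ₁ Λ : Type} (e : K₁ → K) (φ : ∀ k, Γ₁ k ≃ Γ (e k))
    (L : Lens σ σ₁) : TM2.Stmt Γ₁ Λ σ₁ → TM2.Stmt Γ Λ σ
  | .push k f q => .push (e k) (fun v => φ k (f (L.get v))) (stmtLift e φ L q)
  | .peek k f q => .peek (e k) (fun v s => L.set (f (L.get v) (s.map (φ k).symm)) v)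
      (stmtLift e φ L q)
  | .pop k f q => .pop (e k) (fun v s => L.set (f (L.get v) (s.map (φ k).symm)) v)
      (stmtLift e φ L q)
  | .load f q => .load (fun v => L.set (f (L.get v)) v) (stmtLift e φ L q)
  | .branch p q₁ q₂ => .branch (fun v => p (L.get v)) (stmtLift e φ L q₁) (stmtLift e φ L q₂)
  | .goto l => .goto fun v => l (L.get v)
  | .halt => .halt

section Lift

variable {K₁ : Type} [DecidableEq K₁] {Γ₁ : K₁ → Type} {σ₁ Λ : Type}

/-- The configuration `d` contains the configuration `c` of an embedded machine; the rest of `d` is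
as in `v₀`, `S₀`. -/
structure Embeds (e : K₁ → K) (φ : ∀ k, Γ₁ k ≃ Γ (e k)) (L : Lens σ σ₁) (v₀ : σ) (S₀ : Stacks Γ)
    (c : TM2.Cfg Γ₁ Λ σ₁) (d : TM2.Cfg Γ Λ σ) : Prop where
  label : d.l = c.l
  state : d.var = L.set c.var v₀
  stack : ∀ k, d.stk (e k) = (c.stk k).map (φ k)
  frame : ∀ k, (∀ k₁, e k₁ ≠ k) → d.stk k = S₀ k

variable {e : K₁ → K} (he : Injective e) {φ : ∀ k, Γ₁ k ≃ Γ (e k)} {L : Lens σ σ₁} {v₀ : σ}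
  {S₀ : Stacks Γ}

include he in
theorem Embeds.stepAux (q : TM2.Stmt Γ₁ Λ σ₁) {v₁ : σ₁} {S₁ : Stacks Γ₁} {v : σ} {S : Stacks Γ}
    (hv : v = L.set v₁ v₀) (hs : ∀ k, S (e k) = (S₁ k).map (φ k))
    (hf : ∀ k, (∀ k₁, e k₁ ≠ k) → S k = S₀ k) :
    Embeds e φ L v₀ S₀ (TM2.stepAux q v₁ S₁) (TM2.stepAux (stmtLift e φ L q) v S) := by
  subst hv
  induction q generalizing v₁ S₁ S with
  | push k f q ih =>
    simp only [stmtLift, TM2.stepAux, L.get_set]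
    refine ih (fun k' => ?_) fun k' h => ?_
    · by_cases h : k' = k
      · subst h; simp [hs]
      · rw [update_of_ne h, update_of_ne (fun h' => h (he h')), hs]
    · rw [update_of_ne (h k).symm, hf k' h]
  | peek k f q ih =>
    simp only [stmtLift, TM2.stepAux, L.get_set]
    have := ih (v₁ := f v₁ (S₁ k).head?) hs hf
    simpa [hs, Option.map_map, Function.comp_def] using this
  | pop k f q ih =>
    simp only [stmtLift, TM2.stepAux, L.get_set]
    have := @ih (f v₁ (S₁ k).head?) (update S₁ k (S₁ k).tail) (update S (e k) (S (e k)).tail)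
      (fun k' => by
        by_cases h : k' = k
        · subst h; simp [hs]
        · rw [update_of_ne h, update_of_ne (fun h' => h (he h')), hs])
      (fun k' h => by rw [update_of_ne (h k).symm, hf k' h])
    simpa [hs, Option.map_map, Function.comp_def] using this
  | load f q ih =>
    simp only [stmtLift, TM2.stepAux, L.get_set, L.set_set]
    exact ih hs hf
  | branch p q₁ q₂ ih₁ ih₂ =>
    simp only [stmtLift, TM2.stepAux, L.get_set]
    cases p v₁
    · exact ih₂ hs hf
    · exact ih₁ hs hf
  | goto l => exact ⟨by simp [stmtLift], rfl, hs, hf⟩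
  | halt => exact ⟨rfl, rfl, hs, hf⟩

include he in
theorem Embeds.iterate {m : Λ → TM2.Stmt Γ₁ Λ σ₁} (t : ℕ) {c c' : TM2.Cfg Γ₁ Λ σ₁}
    {d : TM2.Cfg Γ Λ σ} (h : Embeds e φ L v₀ S₀ c d)
    (hc : (flip bind (TM2.step m))^[t] (some c) = some c') :
    ∃ d', (flip bind (TM2.step fun l => stmtLift e φ L (m l)))^[t] (some d) = some d' ∧
      Embeds e φ L v₀ S₀ c' d' := by
  induction t generalizing c d with
  | zero =>
    simp only [iterate_zero, id, Option.some.injEq] at hc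
    subst hc
    exact ⟨d, rfl, h⟩
  | succ t ih =>
    obtain ⟨l, v, S⟩ := c
    obtain ⟨l', v', S'⟩ := d
    obtain ⟨rfl, h2, h3, h4⟩ := h
    cases l' with
    | none =>
      rw [iterate_succ_apply] at hc
      change (flip bind (TM2.step m))^[t] none = _ at hc
      rw [iterate_flip_bind_none] at hc
      cases hc
    | some l =>
      rw [iterate_succ_apply] at hc ⊢
      exact ih (Embeds.stepAux he (m l) h2 h3 h4) hc

end Lift

/-- Run the machine `M` on some of the stacks. -/
def Cmd.call (M : FinTM2) (e : M.K → K) (φ : ∀ k, M.Γ k ≃ Γ (e k)) (L : Lens σ M.σ) : Cmd Γ σ :=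
  .mach M.ΛFin M.main fun l => stmtLift e φ L (M.m l)

/-- The machine finds its stacks empty except for the input and leaves them empty except for the
output, with its control back in the initial state. It can therefore be called again inside a loop.
-/
theorem Exec.call {M : FinTM2} {e : M.K → K} (he : Injective e) {φ : ∀ k, M.Γ k ≃ Γ (e k)}
    {L : Lens σ M.σ} {x : List (M.Γ M.k₀)} {y : List (M.Γ M.k₁)} {t : ℕ}
    (h : TM2OutputsInTime M x (some y) t) {v : σ} {S S' : Stacks Γ} (hv : L.get v = M.initialState)
    (hS : ∀ k, S (e k) = (update (fun _ => []) M.k₀ x k : List (M.Γ k)).map (φ k))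
    (hS' : ∀ k, S' (e k) = (update (fun _ => []) M.k₁ y k : List (M.Γ k)).map (φ k))
    (hf : ∀ k, (∀ k₁, e k₁ ≠ k) → S' k = S k) : Exec (.call M e φ L) v S v S' t := by
  have hv' : v = L.set M.initialState v := by rw [← hv, L.set_get]
  obtain ⟨s, hs, hr⟩ := TM2OutputsInTime.reachesIn h
  obtain ⟨⟨l, w, U⟩, h1, h2, h3, h4, h5⟩ := Embeds.iterate he (φ := φ) (L := L) (v₀ := v) (S₀ := S) s
    (d := ⟨some M.main, v, S⟩) ⟨rfl, hv', hS, fun _ _ => rfl⟩ hr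
  have hU : U = S' := by
    ext1 k
    by_cases hk : ∃ k₁, e k₁ = k
    · obtain ⟨k₁, rfl⟩ := hk
      rw [hS' k₁]; exact h4 k₁
    · push Not at hk
      rw [hf k hk]; exact h5 k hk
  simp only at h2 h3
  rw [← hv'] at h3
  subst hU h3 h2
  exact Exec.mach ⟨s, hs, h1⟩

end Programs

/-! ### Polynomial bounds -/

/-- The function `t` is bounded by a polynomial. -/
def PolyBdd (t : ℕ → ℕ) : Prop := ∃ p : Polynomial ℕ, ∀ n, t n ≤ p.eval n

theorem polynomial_eval_mono (p : Polynomial ℕ) : Monotone fun n => p.eval n := by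
  intro m n h
  simp only [Polynomial.eval_eq_sum_range]
  gcongr

namespace PolyBdd

theorem eval (p : Polynomial ℕ) : PolyBdd fun n => p.eval n := ⟨p, fun _ => le_rfl⟩

theorem const (c : ℕ) : PolyBdd fun _ => c := ⟨.C c, by simp⟩

theorem id : PolyBdd fun n => n := ⟨.X, by simp⟩

theorem add {s t : ℕ → ℕ} (hs : PolyBdd s) (ht : PolyBdd t) : PolyBdd fun n => s n + t n := by
  obtain ⟨p, hp⟩ := hs
  obtain ⟨q, hq⟩ := ht
  exact ⟨p + q, fun n => by simpa using add_le_add (hp n) (hq n)⟩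

theorem mul {s t : ℕ → ℕ} (hs : PolyBdd s) (ht : PolyBdd t) : PolyBdd fun n => s n * t n := by
  obtain ⟨p, hp⟩ := hs
  obtain ⟨q, hq⟩ := ht
  exact ⟨p * q, fun n => by simpa using Nat.mul_le_mul (hp n) (hq n)⟩

theorem eval_comp (p : Polynomial ℕ) {t : ℕ → ℕ} (ht : PolyBdd t) :
    PolyBdd fun n => p.eval (t n) := by
  obtain ⟨q, hq⟩ := ht
  exact ⟨p.comp q, fun n => by
    rw [Polynomial.eval_comp]; exact polynomial_eval_mono p (hq n)⟩

end PolyBdd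

/-! ### The length of outputs -/

/-- An upper bound for the number of symbols that a statement pushes. -/
def pushCount {K : Type} {Γ : K → Type} {Λ σ : Type} : TM2.Stmt Γ Λ σ → ℕ
  | .push _ _ q => pushCount q + 1
  | .peek _ _ q | .pop _ _ q | .load _ q => pushCount q
  | .branch _ q₁ q₂ => pushCount q₁ + pushCount q₂
  | .goto _ | .halt => 0

theorem length_stepAux_le {K : Type} [DecidableEq K] {Γ : K → Type} {Λ σ : Type}
    (q : TM2.Stmt Γ Λ σ) (v : σ) (S : Stacks Γ) (k : K) :
    ((TM2.stepAux q v S).stk k).length ≤ (S k).length + pushCount q := by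
  induction q generalizing v S with
  | push k' f q ih =>
    refine (ih _ _).trans ?_
    by_cases h : k = k'
    · subst h; simp [pushCount]; omega
    · simp [h, pushCount]
  | peek k' f q ih => exact ih _ _
  | pop k' f q ih =>
    refine (ih _ _).trans ?_
    by_cases h : k = k'
    · subst h; simp [pushCount]
    · simp [h, pushCount]
  | load f q ih => exact ih _ _
  | branch p q₁ q₂ ih₁ ih₂ =>
    simp only [TM2.stepAux, pushCount]
    cases p v
    · exact (ih₂ _ _).trans (by omega)
    · exact (ih₁ _ _).trans (by omega)
  | goto l => simp
  | halt => simp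

theorem length_iterate_le {K : Type} [DecidableEq K] {Γ : K → Type} {Λ σ : Type} [Fintype Λ]
    (m : Λ → TM2.Stmt Γ Λ σ) (k : K) (t : ℕ) {c c' : TM2.Cfg Γ Λ σ}
    (h : (flip bind (TM2.step m))^[t] (some c) = some c') :
    (c'.stk k).length ≤ (c.stk k).length + t * ∑ l, pushCount (m l) := by
  induction t generalizing c with
  | zero =>
    simp only [iterate_zero, id, Option.some.injEq] at h
    subst h; simp
  | succ t ih =>
    obtain ⟨l, v, S⟩ := c
    rw [iterate_succ_apply] at h
    cases l with
    | none =>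
      change (flip bind (TM2.step m))^[t] none = _ at h
      rw [iterate_flip_bind_none] at h
      cases h
    | some l =>
      have h1 := ih h
      have h2 := length_stepAux_le (m l) v S k
      have h3 : pushCount (m l) ≤ ∑ l, pushCount (m l) :=
        Finset.single_le_sum (f := fun l => pushCount (m l)) (fun _ _ => Nat.zero_le _)
          (Finset.mem_univ l)
      rw [add_mul, one_mul]
      simp only at h1 ⊢
      omega

/-- The function `f` is computable in polynomial time with respect to the given encodings. -/
def PolyComputable {α β A B : Type} (ea : α → List A) (eb : β → List B) (f : α → β) : Prop :=
  Nonempty (TM2ComputableInPolyTime ea eb f)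

variable {α β γ A B C : Type} {ea : α → List A} {eb : β → List B} {ec : γ → List C}

/-- Each step pushes boundedly many symbols, so the output is no longer than the input plus a
constant times the running time. Composition needs this to bound the input of the second machine. -/
theorem PolyComputable.length_le {f : α → β} (h : PolyComputable ea eb f) :
    ∃ q : Polynomial ℕ, ∀ a, (eb (f a)).length ≤ q.eval (ea a).length := by
  obtain ⟨⟨⟨M, i, o⟩, time, outs⟩⟩ := h
  have := M.ΛFin
  refine ⟨.X + time * .C (∑ l, pushCount (M.m l)), fun a => ?_⟩
  obtain ⟨s, hs, hr⟩ := TM2OutputsInTime.reachesIn (outs a)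
  have h1 := length_iterate_le M.m M.k₁ s hr
  have h2 : ((update (fun _ => []) M.k₀ ((ea a).map i.invFun) M.k₁ : List (M.Γ M.k₁))).length ≤
      (ea a).length := by
    -- The output stack may be the input stack, and then it is not empty at the start.
    by_cases h : M.k₁ = M.k₀
    · have : ∀ k, k = M.k₀ → (update (fun _ => []) M.k₀ ((ea a).map i.invFun) k :
          List (M.Γ k)).length ≤ (ea a).length := by
        rintro _ rfl; simp
      exact this _ h
    · simp [h]
  simp only [update_self, List.length_map] at h1
  simp only [Polynomial.eval_add, Polynomial.eval_X, Polynomial.eval_mul, Polynomial.eval_C]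
  have h3 := Nat.mul_le_mul_right (∑ l, pushCount (M.m l)) hs
  omega

theorem PolyComputable.of_exec {K : Type} [DecidableEq K] [Fintype K] {Γ : K → Type} {σ : Type}
    [Fintype σ] {f : α → β} {c : Cmd Γ σ} {k₀ k₁ : K} [Fintype (Γ k₀)] {v₀ : σ} (i : Γ k₀ ≃ A)
    (o : Γ k₁ ≃ B) {T : ℕ → ℕ} (hT : PolyBdd T)
    (h : ∀ a, Exec c v₀ (update (fun _ => []) k₀ ((ea a).map i.symm)) v₀
      (update (fun _ => []) k₁ ((eb (f a)).map o.symm)) (T (ea a).length)) :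
    PolyComputable ea eb f := by
  obtain ⟨p, hp⟩ := hT
  exact ⟨⟨⟨c.toFinTM2 k₀ k₁ v₀, i, o⟩, p + 1, fun a =>
    Classical.choice (((h a).weaken (hp _)).outputs.map fun r =>
      ⟨r.toEvalsTo, by simpa using r.steps_le_m⟩)⟩⟩

end SearchClasses

namespace SearchClasses

open Turing Function

/-! ### Closure properties of the polynomial-time functions -/

section Closure

variable {α β γ A B C : Type} {ea : α → List A} {eb : β → List B} {ec : γ → List C}

/-- Stacks of two machines and some further ones. -/
abbrev SumStacks {K₁ K₂ X : Type} (Γ₁ : K₁ → Type) (Γ₂ : K₂ → Type) (Γ : X → Type) :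
    K₁ ⊕ K₂ ⊕ X → Type := Sum.elim Γ₁ (Sum.elim Γ₂ Γ)

/-- The contents of the stacks `SumStacks`. -/
def sumStacks {K₁ K₂ X : Type} {Γ₁ : K₁ → Type} {Γ₂ : K₂ → Type} {Γ : X → Type}
    (S₁ : Stacks Γ₁) (S₂ : Stacks Γ₂) (S : Stacks Γ) : Stacks (SumStacks Γ₁ Γ₂ Γ)
  | .inl k => S₁ k
  | .inr (.inl k) => S₂ k
  | .inr (.inr k) => S k

/-- The stacks of which only `k` is not empty, with contents `x`. -/
abbrev single {K : Type} [DecidableEq K] {Γ : K → Type} (k : K) (x : List (Γ k)) : Stacks Γ :=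
  update (fun _ => []) k x

theorem single_self {K : Type} [DecidableEq K] {Γ : K → Type} (k : K) (x : List (Γ k)) :
    (single k x : Stacks Γ) k = x := update_self _ _ _

theorem update_single {K : Type} [DecidableEq K] {Γ : K → Type} (k : K) (x y : List (Γ k)) :
    update (single k x : Stacks Γ) k y = single k y := update_idem _ _ _

theorem single_of_ne {K : Type} [DecidableEq K] {Γ : K → Type} {k k' : K} (h : k' ≠ k)
    (x : List (Γ k)) : (single k x : Stacks Γ) k' = [] := update_of_ne h _ _

theorem Exec.congr {K : Type} [DecidableEq K] {Γ : K → Type} {σ : Type} {c : Cmd Γ σ} {v v' : σ}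
    {S T S' T' : Stacks Γ} {t : ℕ} (hS : S = T) (hS' : S' = T') (h : Exec c v T v' T' t) :
    Exec c v S v' S' t := by
  rwa [hS, hS']

/-! ### Stacks of two machines together with auxiliary stacks -/

section

variable {K₁ K₂ X : Type} [DecidableEq K₁] [DecidableEq K₂] [DecidableEq X] {Γ₁ : K₁ → Type}
  {Γ₂ : K₂ → Type} {Γ : X → Type} {σ : Type} {S₁ : Stacks Γ₁} {S₂ : Stacks Γ₂} {S S' : Stacks Γ}
  {v : σ} {t : ℕ}

theorem update_sumStacks_inl (k : K₁) (x : List (Γ₁ k)) :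
    update (sumStacks S₁ S₂ S) (.inl k) x = sumStacks (update S₁ k x) S₂ S := by
  ext1 k'
  rcases k' with k' | k' | k'
  · by_cases h : k' = k
    · subst h
      exact (update_self _ _ _).trans 
        (show x = update S₁ k' x k' from (update_self k' x S₁).symm)
    · exact (update_of_ne (by simpa using h) _ _).trans 
        (show S₁ k' = update S₁ k x k' from (update_of_ne h x S₁).symm)
  · exact update_of_ne (by simp) _ _
  · exact update_of_ne (by simp) _ _

theorem update_sumStacks_inr_inl (k : K₂) (x : List (Γ₂ k)) :
    update (sumStacks S₁ S₂ S) (.inr (.inl k)) x = sumStacks S₁ (update S₂ k x) S := by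
  ext1 k'
  rcases k' with k' | k' | k'
  · exact update_of_ne (by simp) _ _
  · by_cases h : k' = k
    · subst h; exact (update_self _ _ _).trans 
        (show x = update S₂ k' x k' from (update_self k' x S₂).symm)
    · exact (update_of_ne (by simpa using h) _ _).trans 
        (show S₂ k' = update S₂ k x k' from (update_of_ne h x S₂).symm)
  · exact update_of_ne (by simp) _ _

theorem update_sumStacks_inr_inr (k : X) (x : List (Γ k)) :
    update (sumStacks S₁ S₂ S) (.inr (.inr k)) x = sumStacks S₁ S₂ (update S k x) := by
  ext1 k'
  rcases k' with k' | k' | k'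
  · exact update_of_ne (by simp) _ _
  · exact update_of_ne (by simp) _ _
  · by_cases h : k' = k
    · subst h; exact (update_self _ _ _).trans 
        (show x = update S k' x k' from (update_self k' x S).symm)
    · exact (update_of_ne (by simpa using h) _ _).trans 
        (show S k' = update S k x k' from (update_of_ne h x S).symm)

omit [DecidableEq K₁] [DecidableEq K₂] [DecidableEq X] in
theorem sumStacks_bot : sumStacks (fun _ => []) (fun _ => []) (fun _ => []) =
    (fun _ => [] : Stacks (SumStacks Γ₁ Γ₂ Γ)) := by
  ext1 k
  rcases k with k | k | k <;> rfl

theorem single_inl (k : K₁) (x : List (Γ₁ k)) :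
    (single (.inl k) x : Stacks (SumStacks Γ₁ Γ₂ Γ)) =
      sumStacks (single k x) (fun _ => []) (fun _ => []) := by
  rw [← update_sumStacks_inl, sumStacks_bot]

theorem single_inr_inl (k : K₂) (x : List (Γ₂ k)) :
    (single (.inr (.inl k)) x : Stacks (SumStacks Γ₁ Γ₂ Γ)) =
      sumStacks (fun _ => []) (single k x) (fun _ => []) := by
  rw [← update_sumStacks_inr_inl, sumStacks_bot]

theorem single_inr_inr (k : X) (x : List (Γ k)) :
    (single (.inr (.inr k)) x : Stacks (SumStacks Γ₁ Γ₂ Γ)) =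
      sumStacks (fun _ => []) (fun _ => []) (single k x) := by
  rw [← update_sumStacks_inr_inr, sumStacks_bot]

theorem Exec.push_inl {k : K₁} {f : σ → Γ₁ k} :
    Exec (.push (Γ := SumStacks Γ₁ Γ₂ Γ) (.inl k) f) v (sumStacks S₁ S₂ S) v
      (sumStacks (update S₁ k (f v :: S₁ k)) S₂ S) 0 := by
  rw [← update_sumStacks_inl]; exact Exec.push

theorem Exec.push_inr_inl {k : K₂} {f : σ → Γ₂ k} :
    Exec (.push (Γ := SumStacks Γ₁ Γ₂ Γ) (.inr (.inl k)) f) v (sumStacks S₁ S₂ S) v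
      (sumStacks S₁ (update S₂ k (f v :: S₂ k)) S) 0 := by
  rw [← update_sumStacks_inr_inl]; exact Exec.push

theorem Exec.push_inr_inr {k : X} {f : σ → Γ k} :
    Exec (.push (Γ := SumStacks Γ₁ Γ₂ Γ) (.inr (.inr k)) f) v (sumStacks S₁ S₂ S) v
      (sumStacks S₁ S₂ (update S k (f v :: S k))) 0 := by
  rw [← update_sumStacks_inr_inr]; exact Exec.push

theorem Exec.pushWord_inr_inr {j : X} {d : Γ j} {n : ℕ} {w : σ → List (Γ j)}
    (h : (w v).length ≤ n) :
    Exec (.pushWord (Γ := SumStacks Γ₁ Γ₂ Γ) (.inr (.inr j)) d n w) v (sumStacks S₁ S₂ S) v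
      (sumStacks S₁ S₂ (update S j ((w v).reverse ++ S j))) 0 := by
  rw [← update_sumStacks_inr_inr]; exact Exec.pushWord h

theorem Exec.forPop_inl {C Y : Type} {k : K₁} {rd : Γ₁ k → Y} {buf : Lens σ (Option Y)}
    {body : Cmd (SumStacks Γ₁ Γ₂ Γ) σ} (V : C → σ) (S₂ : C → Stacks Γ₂) (S : C → Stacks Γ)
    (F : C → Γ₁ k → C) (T : ℕ) (hV : ∀ c, buf.get (V c) = none)
    (hb : ∀ x l c, Exec body (buf.set (some (rd x)) (V c)) (sumStacks (single k l) (S₂ c) (S c))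
        (V (F c x)) (sumStacks (single k l) (S₂ (F c x)) (S (F c x))) T)
    (l : List (Γ₁ k)) (c : C) :
    Exec (.forPop (Γ := SumStacks Γ₁ Γ₂ Γ) (.inl k) rd buf body) (V c)
      (sumStacks (single k l) (S₂ c) (S c)) (V (l.foldl F c))
      (sumStacks (fun _ => []) (S₂ (l.foldl F c)) (S (l.foldl F c))) (l.length * (T + 1) + 1) := by
  have hu : ∀ (l : List (Γ₁ k)) (c : C), update (sumStacks (fun _ : K₁ => []) (S₂ c) (S c)) (.inl k) l =
      sumStacks (single k l) (S₂ c) (S c) := fun l c => update_sumStacks_inl _ _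
  have key := Exec.forPop (Γ := SumStacks Γ₁ Γ₂ Γ) (a := .inl k) (rd := rd) (buf := buf) (body := body) V
    (fun c => sumStacks (fun _ => []) (S₂ c) (S c)) F (fun _ _ => True) T hV
    (fun x l c _ => ⟨trivial, Exec.congr (hu l c) (hu l _) (hb x l c)⟩) l c trivial
  refine Exec.congr (hu l c).symm ?_ key
  refine (Eq.trans (hu [] _) ?_).symm
  congr 1
  exact update_eq_self k _

theorem Exec.forPop_inr_inr {C Y : Type} {j : X} {rd : Γ j → Y} {buf : Lens σ (Option Y)}
    {body : Cmd (SumStacks Γ₁ Γ₂ Γ) σ} (V : C → σ) (S₁ : C → Stacks Γ₁) (S₂ : C → Stacks Γ₂)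
    (S : C → Stacks Γ) (F : C → Γ j → C) (J : List (Γ j) → C → Prop) (T : ℕ)
    (hV : ∀ c, buf.get (V c) = none)
    (hb : ∀ x l c, J (x :: l) c → J l (F c x) ∧
      Exec body (buf.set (some (rd x)) (V c)) (sumStacks (S₁ c) (S₂ c) (update (S c) j l))
        (V (F c x)) (sumStacks (S₁ (F c x)) (S₂ (F c x)) (update (S (F c x)) j l)) T)
    (l : List (Γ j)) (c : C) (hJ : J l c) :
    Exec (.forPop (Γ := SumStacks Γ₁ Γ₂ Γ) (.inr (.inr j)) rd buf body) (V c)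
      (sumStacks (S₁ c) (S₂ c) (update (S c) j l)) (V (l.foldl F c))
      (sumStacks (S₁ (l.foldl F c)) (S₂ (l.foldl F c)) (update (S (l.foldl F c)) j []))
      (l.length * (T + 1) + 1) := by
  have hu : ∀ (l : List (Γ j)) (c : C), update (sumStacks (S₁ c) (S₂ c) (S c)) (.inr (.inr j)) l =
      sumStacks (S₁ c) (S₂ c) (update (S c) j l) := fun l c => update_sumStacks_inr_inr _ _
  have key := Exec.forPop (Γ := SumStacks Γ₁ Γ₂ Γ) (a := .inr (.inr j)) (rd := rd) (buf := buf) (body := body) V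
    (fun c => sumStacks (S₁ c) (S₂ c) (S c)) F J T hV
    (fun x l c h => ⟨(hb x l c h).1, Exec.congr (hu l c) (hu l _) (hb x l c h).2⟩) l c hJ
  exact Exec.congr (hu l c).symm (hu [] _).symm key

theorem Exec.move_inl {k : K₁} {j : X} {Y : Type} {rd : Γ₁ k → Y} {wr : Option Y → Γ j}
    {buf : Lens σ (Option Y)} {x : List (Γ₁ k)} (hv : buf.get v = none)
    (hj : S' j = (x.map fun a => wr (some (rd a))).reverse ++ S j)
    (hS : ∀ i, i ≠ j → S' i = S i) (ht : x.length + 1 ≤ t) :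
    Exec (.move (Γ := SumStacks Γ₁ Γ₂ Γ) (.inl k) (.inr (.inr j)) rd wr buf) v
      (sumStacks (single k x) S₂ S) v (sumStacks (fun _ => []) S₂ S') t := by
  have hk : sumStacks (single k x) S₂ S (.inl k) = x := single_self k x
  refine Exec.move (by simp) hv rfl ?_ ?_ (by rw [hk]; exact ht)
  · rw [hk]; exact hj
  · rintro (i | i | i) h1 h2
    · exact (single_of_ne (by simpa using h1) x).symm
    · rfl
    · exact hS i (by simpa using h2)

theorem Exec.move_inr_inl {k : K₂} {j : X} {Y : Type} {rd : Γ₂ k → Y} {wr : Option Y → Γ j}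
    {buf : Lens σ (Option Y)} {x : List (Γ₂ k)} (hv : buf.get v = none)
    (hj : S' j = (x.map fun a => wr (some (rd a))).reverse ++ S j)
    (hS : ∀ i, i ≠ j → S' i = S i) (ht : x.length + 1 ≤ t) :
    Exec (.move (Γ := SumStacks Γ₁ Γ₂ Γ) (.inr (.inl k)) (.inr (.inr j)) rd wr buf) v
      (sumStacks S₁ (single k x) S) v (sumStacks S₁ (fun _ => []) S') t := by
  have hk : sumStacks S₁ (single k x) S (.inr (.inl k)) = x := single_self k x
  refine Exec.move (by simp) hv rfl ?_ ?_ (by rw [hk]; exact ht)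
  · rw [hk]; exact hj
  · rintro (i | i | i) h1 h2
    · rfl
    · exact (single_of_ne (by simpa using h1) x).symm
    · exact hS i (by simpa using h2)

theorem Exec.move_to_inl {k : K₁} {j : X} {Y : Type} {rd : Γ j → Y} {wr : Option Y → Γ₁ k}
    {buf : Lens σ (Option Y)} {y : List (Γ₁ k)} (hv : buf.get v = none) (hj : S' j = [])
    (hS : ∀ i, i ≠ j → S' i = S i)
    (hy : y = ((S j).map fun a => wr (some (rd a))).reverse) (ht : (S j).length + 1 ≤ t) :
    Exec (.move (Γ := SumStacks Γ₁ Γ₂ Γ) (.inr (.inr j)) (.inl k) rd wr buf) v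
      (sumStacks (fun _ => []) S₂ S) v
      (sumStacks (single k y) S₂ S') t := by
  refine Exec.move (K := K₁ ⊕ K₂ ⊕ X) (by simp) hv hj ?_ ?_ ht
  · exact (single_self k _).trans (hy.trans (List.append_nil _).symm)
  · rintro (i | i | i) h1 h2
    · exact single_of_ne (by simpa using h2) _
    · rfl
    · exact hS i (by simpa using h1)

theorem Exec.move_to_inr_inl {k : K₂} {j : X} {Y : Type} {rd : Γ j → Y} {wr : Option Y → Γ₂ k}
    {buf : Lens σ (Option Y)} {y : List (Γ₂ k)} (hv : buf.get v = none) (hj : S' j = [])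
    (hS : ∀ i, i ≠ j → S' i = S i)
    (hy : y = ((S j).map fun a => wr (some (rd a))).reverse) (ht : (S j).length + 1 ≤ t) :
    Exec (.move (Γ := SumStacks Γ₁ Γ₂ Γ) (.inr (.inr j)) (.inr (.inl k)) rd wr buf) v
      (sumStacks S₁ (fun _ => []) S) v
      (sumStacks S₁ (single k y) S') t := by
  refine Exec.move (K := K₁ ⊕ K₂ ⊕ X) (by simp) hv hj ?_ ?_ ht
  · exact (single_self k _).trans (hy.trans (List.append_nil _).symm)
  · rintro (i | i | i) h1 h2
    · rfl
    · exact single_of_ne (by simpa using h2) _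
    · exact hS i (by simpa using h1)

theorem Exec.move_inr_inr {j j' : X} (hne : j ≠ j') {Y : Type} {rd : Γ j → Y}
    {wr : Option Y → Γ j'} {buf : Lens σ (Option Y)} (hv : buf.get v = none) (hj : S' j = [])
    (hj' : S' j' = ((S j).map fun a => wr (some (rd a))).reverse ++ S j')
    (hS : ∀ i, i ≠ j → i ≠ j' → S' i = S i) (ht : (S j).length + 1 ≤ t) :
    Exec (.move (Γ := SumStacks Γ₁ Γ₂ Γ) (.inr (.inr j)) (.inr (.inr j')) rd wr buf) v
      (sumStacks S₁ S₂ S) v (sumStacks S₁ S₂ S') t := by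
  refine Exec.move (K := K₁ ⊕ K₂ ⊕ X) (by simpa using hne) hv hj hj' ?_ ht
  rintro (i | i | i) h1 h2
  · rfl
  · rfl
  · exact hS i (by simpa using h1) (by simpa using h2)

/-- The first of the machines is run. -/
def Cmd.callLeft (M : FinTM2) (L : Lens σ M.σ) : Cmd (SumStacks M.Γ Γ₂ Γ) σ :=
  .call M Sum.inl (fun k => Equiv.refl (M.Γ k)) L

theorem Exec.callLeft {M : FinTM2} {L : Lens σ M.σ} {x : List (M.Γ M.k₀)} {y : List (M.Γ M.k₁)}
    (h : Nonempty (TM2OutputsInTime M x (some y) t)) (hv : L.get v = M.initialState) :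
    Exec (.callLeft (Γ₂ := Γ₂) (Γ := Γ) M L) v (sumStacks (single M.k₀ x) S₂ S) v
      (sumStacks (single M.k₁ y) S₂ S) t := by
  obtain ⟨h⟩ := h
  refine Exec.call Sum.inl_injective h hv (fun k => (List.map_id _).symm)
    (fun k => (List.map_id _).symm) ?_
  rintro (k | k | k) hk
  · exact absurd rfl (hk k)
  · rfl
  · rfl

/-- The second of the machines is run. -/
def Cmd.callRight (M : FinTM2) (L : Lens σ M.σ) : Cmd (SumStacks Γ₁ M.Γ Γ) σ :=
  .call M (fun k => .inr (.inl k)) (fun k => Equiv.refl (M.Γ k)) L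

theorem Exec.callRight {M : FinTM2} {L : Lens σ M.σ} {x : List (M.Γ M.k₀)} {y : List (M.Γ M.k₁)}
    (h : Nonempty (TM2OutputsInTime M x (some y) t)) (hv : L.get v = M.initialState) :
    Exec (.callRight (Γ₁ := Γ₁) (Γ := Γ) M L) v (sumStacks S₁ (single M.k₀ x) S) v
      (sumStacks S₁ (single M.k₁ y) S) t := by
  obtain ⟨h⟩ := h
  refine Exec.call (Sum.inr_injective.comp Sum.inl_injective) h hv (fun k => (List.map_id _).symm)
    (fun k => (List.map_id _).symm) ?_
  rintro (k | k | k) hk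
  · rfl
  · exact absurd rfl (hk k)
  · rfl

end

theorem PolyComputable.exists_machine {f : α → β} (h : PolyComputable ea eb f) :
    ∃ (M : FinTM2) (i : M.Γ M.k₀ ≃ A) (o : M.Γ M.k₁ ≃ B) (t : Polynomial ℕ), ∀ a,
      Nonempty (TM2OutputsInTime M ((ea a).map i.symm) (some ((eb (f a)).map o.symm))
        (t.eval (ea a).length)) := by
  obtain ⟨⟨⟨M, i, o⟩, t, h⟩⟩ := h
  exact ⟨M, i, o, t, fun a => ⟨h a⟩⟩

/-- The intermediate word passes through an auxiliary stack, so that two reversals cancel on its way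
to the second machine. -/
theorem PolyComputable.comp [Inhabited B] {g : β → γ} {f : α → β} (hg : PolyComputable eb ec g)
    (hf : PolyComputable ea eb f) : PolyComputable ea ec fun a => g (f a) := by
  obtain ⟨q, hq⟩ := hf.length_le
  obtain ⟨M₁, i₁, o₁, t₁, h₁⟩ := hf.exists_machine
  obtain ⟨M₂, i₂, o₂, t₂, h₂⟩ := hg.exists_machine
  let := M₁.kFin
  let := M₂.kFin
  let := M₁.σFin
  let := M₂.σFin
  let := M₁.Γk₀Fin
  let := M₂.Γk₀Fin
  let : Fintype B := Fintype.ofEquiv _ i₂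
  let buf := (Lens.snd M₁.σ (M₂.σ × Option B)).comp (Lens.snd _ _)
  let : Fintype (SumStacks M₁.Γ M₂.Γ (fun _ : Unit => B) (.inl M₁.k₀)) := M₁.Γk₀Fin
  let c : Cmd (SumStacks M₁.Γ M₂.Γ fun _ : Unit => B) (M₁.σ × M₂.σ × Option B) :=
    .seq (.callLeft M₁ (Lens.fst _ _))
    (.seq (.move (.inl M₁.k₁) (.inr (.inr ())) (fun x => o₁ x) 
      (fun x : Option B => Option.getD (α := B) x (default : B)) buf)
    (.seq (.move (.inr (.inr ())) (.inr (.inl M₂.k₀)) (fun x => x)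
        (fun x => i₂.symm (Option.getD (α := B) x (default : B))) buf)
      (.callRight M₂ ((Lens.snd _ _).comp (Lens.fst _ _)))))
  refine PolyComputable.of_exec (c := c) (k₀ := .inl M₁.k₀) (k₁ := .inr (.inl M₂.k₁))
    (v₀ := (M₁.initialState, M₂.initialState, none)) i₁ o₂
    (T := fun n => t₁.eval n + ((q.eval n + 1) + ((q.eval n + 1) + t₂.eval (q.eval n)))) ?_ ?_
  · exact (PolyBdd.eval _).add ((((PolyBdd.eval _).add (.const 1))).add
      (((PolyBdd.eval _).add (.const 1)).add (.eval_comp _ (.eval _))))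
  intro a
  refine Exec.congr (single_inl _ _) (single_inr_inl _ _) ?_
  refine Exec.seq (Exec.callLeft (h₁ a) rfl)
    (Exec.seq (Exec.move_inl (S' := fun _ => (eb (f a)).reverse) rfl ?_ (fun _ h => absurd rfl h) ?_)
      (Exec.seq (Exec.move_to_inr_inl (Γ := fun _ : Unit => B) (S' := fun _ => []) (y := (eb (f a)).map i₂.symm) rfl rfl
        (fun _ h => absurd rfl h) ?_ ?_)
        ((Exec.callRight (h₂ (f a)) rfl).weaken ?_)))
  · simp
  · simpa using hq a
  · simp
  · simpa using hq a
  · exact polynomial_eval_mono t₂ (hq a)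

end Closure
end SearchClasses

namespace SearchClasses

open Turing Function

/-! ### Finite transducers -/

section Transducer

variable {α β A B Q : Type} {ea : α → List A} {eb : β → List B}

/-- The output of a finite transducer started in the state `q`. -/
def transduce (δ : Q → A → Q) (out : Q → A → List B) (fin : Q → List B) : Q → List A → List B
  | q, [] => fin q
  | q, a :: l => out q a ++ transduce δ out fin (δ q a) l

theorem length_transduce_le {δ : Q → A → Q} {out : Q → A → List B} {fin : Q → List B} {N : ℕ}
    (ho : ∀ q a, (out q a).length ≤ N) (hf : ∀ q, (fin q).length ≤ N) (q : Q) (l : List A) :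
    (transduce δ out fin q l).length ≤ N * (l.length + 1) := by
  induction l generalizing q with
  | nil => simpa [transduce] using hf q
  | cons a l ih =>
    have := ih (δ q a)
    have := ho q a
    simp only [transduce, List.length_append, List.length_cons]
    rw [mul_add N (l.length + 1) 1]
    omega

/-- A machine collects the output on a stack, hence backwards; this identifies the collected word
with the reversed output. -/
theorem foldl_transduce (δ : Q → A → Q) (out : Q → A → List B) (fin : Q → List B) (l : List A)
    (q : Q) (w : List B) :
    (fin (l.foldl (fun c a => (δ c.1 a, (out c.1 a).reverse ++ c.2)) (q, w)).1).reverse ++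
      (l.foldl (fun c a => (δ c.1 a, (out c.1 a).reverse ++ c.2)) (q, w)).2 =
      (transduce δ out fin q l).reverse ++ w := by
  induction l generalizing q w with
  | nil => rfl
  | cons a l ih => simp [transduce, ih]

theorem PolyComputable.of_transduce [Fintype A] [Fintype Q] [Inhabited B] [Finite B] {f : α → β}
    (q₀ : Q) (δ : Q → A → Q) (out : Q → A → List B) (fin : Q → List B)
    (h : ∀ a, eb (f a) = transduce δ out fin q₀ (ea a)) : PolyComputable ea eb f := by
  have := Fintype.ofFinite B
  -- A common bound for all words that a single transition or the end of the input can put out.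
  let N := (∑ p : Q × A, (out p.1 p.2).length) + ∑ q, (fin q).length
  have ho : ∀ q a, (out q a).length ≤ N := fun q a =>
    (Finset.single_le_sum (f := fun p : Q × A => (out p.1 p.2).length) (fun _ _ => Nat.zero_le _)
      (Finset.mem_univ (q, a))).trans (Nat.le_add_right _ _)
  have hf : ∀ q, (fin q).length ≤ N := fun q =>
    (Finset.single_le_sum (f := fun q => (fin q).length) (fun _ _ => Nat.zero_le _)
      (Finset.mem_univ q)).trans (Nat.le_add_left _ _)
  let : Fintype (SumStacks (fun _ : Unit => A) (fun _ : Unit => B) (fun _ : Unit => B)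
    (.inl ())) := inferInstanceAs (Fintype A)
  let bufA : Lens (Q × Option A × Option B) (Option A) := (Lens.snd _ _).comp (Lens.fst _ _)
  let bufB : Lens (Q × Option A × Option B) (Option B) := (Lens.snd _ _).comp (Lens.snd _ _)
  let body : Cmd (SumStacks (fun _ : Unit => A) (fun _ : Unit => B) (fun _ : Unit => B))
      (Q × Option A × Option B) :=
    .seq (.pushWord (.inr (.inr ())) (default : B) N fun v => v.2.1.elim [] (out v.1))
      (.load fun v => (v.2.1.elim v.1 (δ v.1), none, v.2.2))
  let c : Cmd (SumStacks (fun _ : Unit => A) (fun _ : Unit => B) (fun _ : Unit => B))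
      (Q × Option A × Option B) :=
    .seq (.forPop (.inl ()) (fun a : A => a) bufA body)
    (.seq (.pushWord (.inr (.inr ())) (default : B) N fun v => fin v.1)
    -- A halting configuration must carry the initial control state.
    (.seq (.load fun v => (q₀, v.2))
      (.move (.inr (.inr ())) (.inr (.inl ())) (fun b : B => b)
        (fun b : Option B => Option.getD (α := B) b (default : B)) bufB)))
  refine PolyComputable.of_exec (c := c) (k₀ := .inl ()) (k₁ := .inr (.inl ()))
    (v₀ := (q₀, none, none)) (Equiv.refl A) (Equiv.refl B)
    (T := fun n => (n * 1 + 1) + (0 + (0 + (N * (n + 1) + 1)))) ?_ ?_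
  · exact ((PolyBdd.id.mul (.const 1)).add (.const 1)).add ((PolyBdd.const 0).add
      ((PolyBdd.const 0).add (((PolyBdd.const N).mul (PolyBdd.id.add (.const 1))).add (.const 1))))
  intro a
  refine Exec.congr (single_inl _ _) (single_inr_inl _ _) ?_
  have key := Exec.forPop_inl (Γ₁ := fun _ : Unit => A) (Γ₂ := fun _ : Unit => B)
    (Γ := fun _ : Unit => B) (k := ()) (rd := fun a : A => a) (buf := bufA) (body := body)
    (fun c : Q × List B => (c.1, none, none)) (fun _ _ => []) (fun c => single () c.2)
    (fun c a => (δ c.1 a, (out c.1 a).reverse ++ c.2)) 0 (fun _ => rfl) (fun x l c => by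
      refine Exec.seq (t := 0) (t' := 0) (Exec.pushWord_inr_inr (Γ₁ := fun _ : Unit => A)
        (Γ₂ := fun _ : Unit => B) (Γ := fun _ : Unit => B) ?_) (Exec.congr ?_ rfl Exec.load)
      · exact ho _ _
      · simp [single]; rfl) (ea a) (q₀, [])
  have hw := foldl_transduce δ out fin (ea a) q₀ []
  rw [List.append_nil] at hw
  have hm := Exec.move_to_inr_inl (Γ₁ := fun _ : Unit => A) (Γ₂ := fun _ : Unit => B)
    (Γ := fun _ : Unit => B) (S₁ := fun _ => []) (k := ()) (j := ()) (rd := fun b : B => b)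
    (wr := fun b : Option B => Option.getD (α := B) b (default : B)) (buf := bufB)
    (v := (q₀, none, none)) (S := fun _ => (transduce δ out fin q₀ (ea a)).reverse)
    (S' := fun _ => []) (y := eb (f a)) (t := N * ((ea a).length + 1) + 1) rfl rfl
    (fun _ h => absurd rfl h) (by simp [h])
    (by simpa using length_transduce_le ho hf q₀ (ea a))
  refine Exec.seq (Exec.congr ?_ rfl key) ?_
  · exact congrArg (fun x : List A => sumStacks (Γ₁ := fun _ : Unit => A) (Γ₂ := fun _ : Unit => B)
    (Γ := fun _ : Unit => B) (single () x) (fun _ => []) fun _ => [])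
      (List.map_id _)
  refine Exec.seq (Exec.pushWord_inr_inr (Γ₁ := fun _ : Unit => A) (Γ₂ := fun _ : Unit => B)
    (Γ := fun _ : Unit => B) (hf _)) ?_
  refine Exec.seq Exec.load ?_
  refine Exec.congr ?_ ?_ hm
  · simp only [single, update_self, update_idem, hw]
    rfl
  · exact congrArg (fun x : List B => sumStacks (Γ₁ := fun _ : Unit => A) (Γ₂ := fun _ : Unit => B)
    (Γ := fun _ : Unit => B) (fun _ => []) (single () x) fun _ => [])
      (List.map_id _)

end Transducer
end SearchClasses

namespace SearchClasses

open Turing Function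

/-! ### Pairs and iteration -/

section Pairs

variable {α β γ A B C : Type} {ea : α → List A} {eb : β → List B} {ec : γ → List C}

theorem map_map_symm {X Y : Type} (e : X ≃ Y) (l : List Y) :
    (l.map e.symm).map (fun x => e x) = l := by simp

/-- The encoding of pairs over the disjoint union of the alphabets. -/
def encodeSum (eb : β → List B) (ec : γ → List C) (p : β × γ) : List (B ⊕ C) :=
  (eb p.1).map .inl ++ (ec p.2).map .inr

/-- Alphabets of the auxiliary stacks for computing a pair. -/
abbrev PairAux (A B C : Type) : Option Bool → Type
  | none => A
  | some _ => B ⊕ C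

/-- Contents of the auxiliary stacks for computing a pair. -/
def pairAux (x : List A) (y z : List (B ⊕ C)) : Stacks (PairAux A B C)
  | none => x
  | some true => y
  | some false => z

/-- Reading a stack destroys it. The input is therefore reversed onto an auxiliary stack, and each
symbol popped from there is pushed on the input stacks of both machines. -/
theorem PolyComputable.pair [Inhabited A] [Inhabited B] [Inhabited C] {f : α → β} {g : α → γ}
    (hf : PolyComputable ea eb f) (hg : PolyComputable ea ec g) [Finite B] [Finite C] :
    PolyComputable ea (encodeSum eb ec) fun a => (f a, g a) := by
  obtain ⟨q, hq⟩ := hf.length_le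
  obtain ⟨r, hr⟩ := hg.length_le
  obtain ⟨M₁, i₁, o₁, t₁, h₁⟩ := hf.exists_machine
  obtain ⟨M₂, i₂, o₂, t₂, h₂⟩ := hg.exists_machine
  let := M₁.kFin
  let := M₂.kFin
  let := M₁.σFin
  let := M₂.σFin
  let := M₁.Γk₀Fin
  let : Fintype A := Fintype.ofEquiv _ i₁
  let := Fintype.ofFinite B
  let := Fintype.ofFinite C
  let : Fintype (SumStacks M₁.Γ M₂.Γ (PairAux A B C) (.inl M₁.k₀)) := M₁.Γk₀Fin
  let bufA : Lens (M₁.σ × M₂.σ × Option A × Option (B ⊕ C)) (Option A) :=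
    (Lens.snd _ _).comp ((Lens.snd _ _).comp (Lens.fst _ _))
  let bufB : Lens (M₁.σ × M₂.σ × Option A × Option (B ⊕ C)) (Option (B ⊕ C)) :=
    (Lens.snd _ _).comp ((Lens.snd _ _).comp (Lens.snd _ _))
  let dA : Option A → A := fun x => x.getD default
  let dB : Option (B ⊕ C) → B ⊕ C := fun x => x.getD default
  let copy : Cmd (SumStacks M₁.Γ M₂.Γ (PairAux A B C)) (M₁.σ × M₂.σ × Option A × Option (B ⊕ C)) :=
    .seq (.push (.inl M₁.k₀) fun v => i₁.symm (dA v.2.2.1))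
    (.seq (.push (.inr (.inl M₂.k₀)) fun v => i₂.symm (dA v.2.2.1)) (.load (bufA.set none)))
  let c : Cmd (SumStacks M₁.Γ M₂.Γ (PairAux A B C)) (M₁.σ × M₂.σ × Option A × Option (B ⊕ C)) :=
    .seq (.move (.inl M₁.k₀) (.inr (.inr none)) i₁ dA bufA)
    (.seq (.forPop (.inr (.inr none)) (fun a : A => a) bufA copy)
    (.seq (.callLeft M₁ (Lens.fst _ _))
    (.seq (.callRight M₂ ((Lens.snd _ _).comp (Lens.fst _ _)))
    (.seq (.move (.inl M₁.k₁) (.inr (.inr (some true))) (fun b => .inl (o₁ b)) dB bufB)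
    (.seq (.move (.inr (.inl M₂.k₁)) (.inr (.inr (some true))) (fun b => .inr (o₂ b)) dB bufB)
      (.move (.inr (.inr (some true))) (.inr (.inr (some false))) (fun b : B ⊕ C => b) dB bufB))))))
  refine PolyComputable.of_exec (c := c) (k₀ := .inl M₁.k₀) (k₁ := .inr (.inr (some false)))
    (v₀ := (M₁.initialState, M₂.initialState, none, none)) i₁ (Equiv.refl (B ⊕ C))
    (T := fun n => (n + 1) + ((n * 1 + 1) + (t₁.eval n + (t₂.eval n + ((q.eval n + 1) +
      ((r.eval n + 1) + ((q.eval n + r.eval n) + 1))))))) ?_ ?_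
  · have one := PolyBdd.const 1
    exact (PolyBdd.id.add one).add (((PolyBdd.id.mul one).add one).add ((PolyBdd.eval _).add
      ((PolyBdd.eval _).add (((PolyBdd.eval _).add one).add (((PolyBdd.eval _).add one).add
        (((PolyBdd.eval _).add (PolyBdd.eval _)).add one))))))
  intro a
  refine Exec.congr (single_inl _ _) (single_inr_inr _ _) ?_
  refine Exec.seq (Exec.move_inl (Γ₁ := M₁.Γ) (Γ₂ := M₂.Γ) (Γ := PairAux A B C) (j := none)
    (S' := pairAux (ea a).reverse [] []) rfl ?_ ?_ ?_) ?_
  · simp only [pairAux, dA, Option.getD_some, List.append_nil]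
    exact congrArg List.reverse (map_map_symm i₁ (ea a)).symm
  · rintro (_ | _ | _) h
    · exact absurd rfl h
    · rfl
    · rfl
  · simp
  have key := Exec.forPop_inr_inr (Γ₁ := M₁.Γ) (Γ₂ := M₂.Γ) (Γ := PairAux A B C) (j := none)
    (rd := fun a : A => a) (buf := bufA) (body := copy)
    (fun _ : List A => (M₁.initialState, M₂.initialState, none, none))
    (fun c => single M₁.k₀ (c.map i₁.symm)) (fun c => single M₂.k₀ (c.map i₂.symm))
    (fun _ => pairAux [] [] []) (fun c x => x :: c) (fun _ _ => True) 0 (fun _ => rfl)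
    (fun x l c _ => by
      refine ⟨trivial, ?_⟩
      refine Exec.seq (t := 0) (t' := 0) (Exec.push_inl (Γ₁ := M₁.Γ) (Γ₂ := M₂.Γ)
        (Γ := PairAux A B C)) ?_
      refine Exec.seq (t := 0) (t' := 0) (Exec.push_inr_inl (Γ₁ := M₁.Γ) (Γ₂ := M₂.Γ)
        (Γ := PairAux A B C)) ?_
      refine Exec.congr ?_ rfl Exec.load
      simp only [update_single, single_self]
      rfl)
    (ea a).reverse [] trivial
  have hc : (ea a).reverse.foldl (fun c x => x :: c) [] = ea a := by simp
  rw [hc] at key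
  have hp : ∀ (S₁ : Stacks M₁.Γ) (S₂ : Stacks M₂.Γ) (l : List A),
      sumStacks S₁ S₂ (update (pairAux [] [] []) none l : Stacks (PairAux A B C)) =
        sumStacks S₁ S₂ (pairAux l [] []) := by
    intro S₁ S₂ l
    congr 1
    ext1 k
    rcases k with _ | _ | _ <;> rfl
  refine Exec.seq ((Exec.congr ?_ (hp _ _ []).symm key).weaken ?_) ?_
  · rw [hp]
    congr 1
    · exact (update_eq_self M₁.k₀ _).symm
    · exact (update_eq_self M₂.k₀ _).symm
  · simp
  refine Exec.seq (Exec.callLeft (Γ₂ := M₂.Γ) (Γ := PairAux A B C) (h₁ a) rfl) ?_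
  refine Exec.seq (Exec.callRight (Γ₁ := M₁.Γ) (Γ := PairAux A B C) (h₂ a) rfl) ?_
  refine Exec.seq (Exec.move_inl (Γ₁ := M₁.Γ) (Γ₂ := M₂.Γ) (Γ := PairAux A B C) (j := some true)
    (S' := pairAux [] ((eb (f a)).map Sum.inl).reverse []) rfl ?_ ?_ ?_) ?_
  · simp [pairAux, dB, Function.comp_def]
  · rintro (_ | _ | _) h
    · rfl
    · rfl
    · exact absurd rfl h
  · simpa using hq a
  refine Exec.seq (Exec.move_inr_inl (Γ₁ := M₁.Γ) (Γ₂ := M₂.Γ) (Γ := PairAux A B C)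
    (j := some true)
    (S' := pairAux [] (encodeSum eb ec (f a, g a)).reverse []) rfl ?_ ?_ ?_) ?_
  · simp [pairAux, dB, Function.comp_def, encodeSum]
  · rintro (_ | _ | _) h
    · rfl
    · rfl
    · exact absurd rfl h
  · simpa using hr a
  refine Exec.congr rfl ?_ (Exec.move_inr_inr (Γ₁ := M₁.Γ) (Γ₂ := M₂.Γ) (Γ := PairAux A B C)
    (j := some true) (j' := some false)
    (S' := pairAux [] [] (encodeSum eb ec (f a, g a))) (by simp) rfl rfl ?_ ?_ ?_)
  · congr 1
    ext1 k
    rcases k with _ | _ | _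
    · rfl
    · exact (single_self (Γ := PairAux A B C) (some false) _).trans (List.map_id _)
    · rfl
  · simp [pairAux, dB]
  · rintro (_ | _ | _) h h'
    · rfl
    · exact absurd rfl h'
    · exact absurd rfl h
  · have := hq a
    have := hr a
    simp [pairAux, encodeSum]
    omega

end Pairs
end SearchClasses

namespace SearchClasses

open Turing Function

/-! ### Iterating a polynomial-time function along a list -/

section Fold

variable {β A B : Type} {eb : β → List B}

/-- Alphabets of the auxiliary stacks for iterating a function. -/
abbrev FoldAux (A B : Type) : Bool × Bool → Type
  | (true, _) => A
  | (false, _) => B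

/-- Contents of the auxiliary stacks for iterating a function. -/
def foldAux (x x' : List A) (y y' : List B) : Stacks (FoldAux A B)
  | (true, true) => x
  | (true, false) => x'
  | (false, true) => y
  | (false, false) => y'

theorem foldl_split {X : Type} (i : X ≃ A ⊕ B) (l : List A) (w : List B) :
    ((l.map Sum.inl ++ w.map Sum.inr).map i.symm).foldl
      (fun (c : List A × List B) x => Sum.elim (fun a => (a :: c.1, c.2)) (fun b => (c.1, b :: c.2)) (i x))
      ([], []) = (l.reverse, w.reverse) := by
  have h₁ : ∀ (l : List A) (c : List A × List B), ((l.map Sum.inl).map i.symm).foldl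
      (fun (c : List A × List B) x => Sum.elim (fun a => (a :: c.1, c.2)) (fun b => (c.1, b :: c.2)) (i x)) c =
      (l.reverse ++ c.1, c.2) := by
    intro l
    induction l with
    | nil => intro c; rfl
    | cons a l ih => intro c; simp only [List.map_cons, List.foldl_cons, ih]; simp
  have h₂ : ∀ (w : List B) (c : List A × List B), ((w.map Sum.inr).map i.symm).foldl
      (fun (c : List A × List B) x => Sum.elim (fun a => (a :: c.1, c.2)) (fun b => (c.1, b :: c.2)) (i x)) c =
      (c.1, w.reverse ++ c.2) := by
    intro l
    induction l with
    | nil => intro c; rfl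
    | cons a l ih => intro c; simp only [List.map_cons, List.foldl_cons, ih]; simp
  rw [List.map_append, List.foldl_append, h₁, h₂]
  simp

/-- The machine for `step` is called once per list element. Between the calls the value is kept
reversed, so that a single move feeds it in the right order. The bound `hq` holds for every list,
hence for every prefix, and controls all intermediate values. -/
theorem PolyComputable.foldl [Inhabited A] [Inhabited B] {step : A × β → β}
    (h : PolyComputable (encodeSum (fun a : A => [a]) eb) eb step) [Finite A] [Finite B]
    (hq : ∃ q : Polynomial ℕ, ∀ (l : List A) (s : β),
      (eb (l.foldl (fun s a => step (a, s)) s)).length ≤ q.eval (l.length + (eb s).length)) :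
    PolyComputable (encodeSum (fun l : List A => l) eb) eb
      fun p => p.1.foldl (fun s a => step (a, s)) p.2 := by
  obtain ⟨q, hq⟩ := hq
  obtain ⟨M, i, o, t, hM⟩ := h.exists_machine
  let := M.kFin
  let := M.σFin
  let := M.Γk₀Fin
  let := Fintype.ofFinite A
  let := Fintype.ofFinite B
  let : Fintype (SumStacks M.Γ (fun _ : Empty => Unit) (FoldAux A B) (.inl M.k₀)) := M.Γk₀Fin
  let σ := M.σ × Option (A ⊕ B) × Option A
  let buf : Lens σ (Option (A ⊕ B)) := (Lens.snd _ _).comp (Lens.fst _ _)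
  let bufA : Lens σ (Option A) := (Lens.snd _ _).comp (Lens.snd _ _)
  let gA : Option (A ⊕ B) → A := fun x => x.elim default (Sum.elim (fun a => a) fun _ => default)
  let gB : Option (A ⊕ B) → B := fun x => x.elim default (Sum.elim (fun _ => default) fun b => b)
  let split : Cmd (SumStacks M.Γ (fun _ : Empty => Unit) (FoldAux A B)) σ :=
    .seq (.ite (fun v => v.2.1.elim false Sum.isLeft)
      (.push (.inr (.inr (true, true))) fun v => gA v.2.1)
      (.push (.inr (.inr (false, true))) fun v => gB v.2.1)) (.load (buf.set none))
  let body : Cmd (SumStacks M.Γ (fun _ : Empty => Unit) (FoldAux A B)) σ :=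
    .seq (.move (.inr (.inr (false, true))) (.inl M.k₀) (fun b : B => Sum.inr b)
      (fun x => i.symm (x.getD (.inl default))) buf)
    (.seq (.push (.inl M.k₀) fun v => i.symm (.inl (v.2.2.getD default)))
    (.seq (.load (bufA.set none))
    (.seq (.callLeft M (Lens.fst _ _))
      (.move (.inl M.k₁) (.inr (.inr (false, true))) (fun b => .inr (o b)) gB buf))))
  let c : Cmd (SumStacks M.Γ (fun _ : Empty => Unit) (FoldAux A B)) σ :=
    .seq (.forPop (.inl M.k₀) i buf split)
    -- Splitting reversed the list as well; this move restores its order, while the value stays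
    -- reversed.
    (.seq (.move (.inr (.inr (true, true))) (.inr (.inr (true, false))) (fun a : A => Sum.inl a) gA buf)
    (.seq (.forPop (.inr (.inr (true, false))) (fun a : A => a) bufA body)
      (.move (.inr (.inr (false, true))) (.inr (.inr (false, false))) (fun b : B => Sum.inr b) gB
        buf)))
  refine PolyComputable.of_exec (c := c) (k₀ := .inl M.k₀) (k₁ := .inr (.inr (false, false)))
    (v₀ := (M.initialState, none, none)) i (Equiv.refl B)
    (T := fun n => (n * 1 + 1) + ((n + 1) +
      ((n * (((q.eval n + 1) + (t.eval (1 + q.eval n) + (q.eval n + 1))) + 1) + 1) +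
        (q.eval n + 1)))) ?_ ?_
  · have one := PolyBdd.const 1
    have hqn := (PolyBdd.eval q).add one
    exact ((PolyBdd.id.mul one).add one).add ((PolyBdd.id.add one).add ((((PolyBdd.id.mul
      ((hqn.add ((PolyBdd.eval_comp t (one.add (.eval q))).add hqn)).add one)).add one)).add hqn))
  rintro ⟨l, s⟩
  refine Exec.congr (single_inl _ _) (single_inr_inr _ _) ?_
  have hn : (encodeSum (fun l : List A => l) eb (l, s)).length = l.length + (eb s).length := by
    simp [encodeSum]
  rw [hn]
  set n := l.length + (eb s).length with hn'
  have hu : ∀ (x x' : List A) (y y' : List B) (z : List A),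
      (update (foldAux x x' y y') (true, true) z : Stacks (FoldAux A B)) = foldAux z x' y y' := by
    intro x x' y y' z
    ext1 k; rcases k with ⟨_ | _, _ | _⟩ <;> rfl
  have hu' : ∀ (x x' : List A) (y y' : List B) (z : List A),
      (update (foldAux x x' y y') (true, false) z : Stacks (FoldAux A B)) = foldAux x z y y' := by
    intro x x' y y' z
    ext1 k; rcases k with ⟨_ | _, _ | _⟩ <;> rfl
  have hv : ∀ (x x' : List A) (y y' : List B) (z : List B),
      (update (foldAux x x' y y') (false, true) z : Stacks (FoldAux A B)) = foldAux x x' z y' := by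
    intro x x' y y' z
    ext1 k; rcases k with ⟨_ | _, _ | _⟩ <;> rfl
  have key₁ := Exec.forPop_inl (Γ₁ := M.Γ) (Γ₂ := fun _ : Empty => Unit) (Γ := FoldAux A B)
    (k := M.k₀) (rd := i) (buf := buf) (body := split)
    (fun _ : List A × List B => (M.initialState, none, none)) (fun _ _ => [])
    (fun c => foldAux c.1 [] c.2 [])
    (fun c x => Sum.elim (fun a => (a :: c.1, c.2)) (fun b => (c.1, b :: c.2)) (i x)) 0
    (fun _ => rfl) (fun x l c => by
      rcases hx : i x with a | b
      · refine Exec.seq (t := 0) (t' := 0) (Exec.iteTrue rfl (Exec.push_inr_inr (Γ₁ := M.Γ)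
          (Γ₂ := fun _ : Empty => Unit) (Γ := FoldAux A B))) ?_
        rw [hu]
        exact Exec.load
      · refine Exec.seq (t := 0) (t' := 0) (Exec.iteFalse rfl (Exec.push_inr_inr (Γ₁ := M.Γ)
          (Γ₂ := fun _ : Empty => Unit) (Γ := FoldAux A B))) ?_
        rw [hv]
        exact Exec.load)
    ((encodeSum (fun l : List A => l) eb (l, s)).map i.symm) ([], [])
  rw [encodeSum, foldl_split, List.length_map, List.length_append, List.length_map,
    List.length_map, ← hn'] at key₁
  refine Exec.seq (Exec.congr ?_ rfl key₁) ?_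
  · congr 1
    ext1 k; rcases k with ⟨_ | _, _ | _⟩ <;> rfl
  refine Exec.seq (Exec.move_inr_inr (Γ₁ := M.Γ) (Γ₂ := fun _ : Empty => Unit) (Γ := FoldAux A B)
    (j := (true, true)) (j' := (true, false)) (S' := foldAux [] l (eb s).reverse [])
    (by simp) rfl rfl ?_ ?_ ?_) ?_
  · simp [foldAux, gA]
  · rintro ⟨_ | _, _ | _⟩ h h'
    · rfl
    · rfl
    · exact absurd rfl h'
    · exact absurd rfl h
  · simp [foldAux]; omega
  have key₂ := Exec.forPop_inr_inr (Γ₁ := M.Γ) (Γ₂ := fun _ : Empty => Unit) (Γ := FoldAux A B)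
    (j := (true, false)) (rd := fun a : A => a) (buf := bufA) (body := body)
    (fun _ : β => (M.initialState, none, none)) (fun _ _ => []) (fun _ _ => [])
    (fun c => foldAux [] [] (eb c).reverse []) (fun c x => step (x, c))
    -- The value is the fold over the prefix already read. Without this its length could not be
    -- bounded.
    (fun r c => ∃ l', l' ++ r = l ∧ c = l'.foldl (fun s a => step (a, s)) s)
    ((q.eval n + 1) + (t.eval (1 + q.eval n) + (q.eval n + 1))) (fun _ => rfl)
    (fun x r c hc => by
      obtain ⟨l', hl, hc⟩ := hc
      have bd : ∀ l₁ l₂ : List A, l₁ ++ l₂ = l →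
          (eb (l₁.foldl (fun s a => step (a, s)) s)).length ≤ q.eval n := fun l₁ l₂ h =>
        (hq _ _).trans (polynomial_eval_mono q (by rw [hn', ← h, List.length_append]; omega))
      have hc' : step (x, c) = (l' ++ [x]).foldl (fun s a => step (a, s)) s := by simp [hc]
      refine ⟨⟨l' ++ [x], by simpa using hl, hc'⟩, ?_⟩
      have b₁ := bd l' _ hl
      have b₂ := bd (l' ++ [x]) r (by simpa using hl)
      rw [← hc] at b₁
      rw [← hc'] at b₂
      rw [hu', hu']
      refine Exec.seq (Exec.move_to_inl (Γ₁ := M.Γ) (Γ₂ := fun _ : Empty => Unit)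
        (Γ := FoldAux A B) (j := (false, true)) (k := M.k₀) (S' := foldAux [] r [] [])
        (y := ((eb c).map Sum.inr).map i.symm) rfl rfl ?_ ?_ ?_) ?_
      · rintro ⟨_ | _, _ | _⟩ h
        · rfl
        · exact absurd rfl h
        · rfl
        · rfl
      · simp [foldAux, Function.comp_def]
      · simpa [foldAux] using b₁
      rw [← zero_add (t.eval _ + _)]
      refine Exec.seq (Exec.push_inl (Γ₁ := M.Γ) (Γ₂ := fun _ : Empty => Unit)
        (Γ := FoldAux A B)) ?_
      rw [← zero_add (t.eval _ + _)]
      refine Exec.seq Exec.load ?_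
      have hl₁ : (encodeSum (fun a : A => [a]) eb (x, c)).length ≤ 1 + q.eval n := by
        simp [encodeSum]; omega
      rw [update_single, single_self]
      refine Exec.seq ((Exec.callLeft (Γ₂ := fun _ : Empty => Unit) (Γ := FoldAux A B)
        (hM (x, c)) rfl).weaken (polynomial_eval_mono t hl₁)) ?_
      refine Exec.move_inl (Γ₁ := M.Γ) (Γ₂ := fun _ : Empty => Unit)
        (Γ := FoldAux A B) (j := (false, true)) rfl ?_ ?_ ?_
      · simp [foldAux, gB, Function.comp_def]
      · rintro ⟨_ | _, _ | _⟩ h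
        · rfl
        · exact absurd rfl h
        · rfl
        · rfl
      · simpa using b₂) l s ⟨[], rfl, rfl⟩
  rw [hu', hu'] at key₂
  refine Exec.seq (key₂.weaken ?_) ?_
  · gcongr; omega
  refine Exec.congr rfl ?_ (Exec.move_inr_inr (Γ₁ := M.Γ) (Γ₂ := fun _ : Empty => Unit)
    (Γ := FoldAux A B) (j := (false, true)) (j' := (false, false))
    (S' := foldAux [] [] [] (eb (l.foldl (fun s a => step (a, s)) s)))
    (by simp) rfl rfl ?_ ?_ ?_)
  · congr 1
    ext1 k; rcases k with ⟨_ | _, _ | _⟩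
    · exact (single_self (Γ := FoldAux A B) (false, false) _).trans (List.map_id _)
    · rfl
    · rfl
    · rfl
  · simp [foldAux, gB]
  · rintro ⟨_ | _, _ | _⟩ h h'
    · exact absurd rfl h'
    · exact absurd rfl h
    · rfl
    · rfl
  · simpa [foldAux] using hq l s

end Fold
end SearchClasses

namespace SearchClasses

open Turing Function

/-! ### An algebra of polynomial-time functions -/

/-- Types whose elements are encoded by words over a finite alphabet. -/
class Enc (α : Type) where
  Sym : Type
  [fin : Fintype Sym]
  [inh : Inhabited Sym]
  enc : α → List Sym

attribute [reducible, instance] Enc.fin Enc.inh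

open Enc (enc Sym)

instance {A : Type} [Fintype A] [Inhabited A] : Enc (List A) := ⟨A, fun l => l⟩
instance : Enc Bool := ⟨Bool, fun b => [b]⟩
instance : Enc Unit := ⟨Unit, fun b => [b]⟩
instance {A : Type} [Fintype A] [Inhabited A] : Enc (Option A) := ⟨Option A, fun b => [b]⟩
instance : Enc ℕ := ⟨Unit, fun n => List.replicate n ()⟩
instance {α β : Type} [Enc α] [Enc β] : Enc (α × β) := ⟨Sym α ⊕ Sym β, encodeSum enc enc⟩

/-- Polynomial-time functions between encoded types. -/
def PT {α β : Type} [Enc α] [Enc β] (f : α → β) : Prop :=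
  PolyComputable (enc : α → List (Sym α)) (enc : β → List (Sym β)) f

namespace PT

variable {α β γ A B : Type} [Enc α] [Enc β] [Enc γ] [Fintype A] [Inhabited A] [Fintype B]
  [Inhabited B]

theorem comp {g : β → γ} {f : α → β} (hg : PT g) (hf : PT f) : PT fun a => g (f a) :=
  PolyComputable.comp hg hf

theorem pair {f : α → β} {g : α → γ} (hf : PT f) (hg : PT g) : PT fun a => (f a, g a) :=
  PolyComputable.pair hf hg

theorem of_transduce {Q : Type} [Fintype Q] {f : α → β} (q₀ : Q) (δ : Q → Sym α → Q)
    (out : Q → Sym α → List (Sym β)) (fin : Q → List (Sym β))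
    (h : ∀ a, enc (f a) = transduce δ out fin q₀ (enc a)) : PT f :=
  PolyComputable.of_transduce q₀ δ out fin h

theorem of_flatMap {f : α → β} (out : Sym α → List (Sym β))
    (h : ∀ a, enc (f a) = (enc a).flatMap out) : PT f := by
  refine of_transduce () (fun _ _ => ()) (fun _ => out) (fun _ => []) fun a => ?_
  rw [h]
  induction (enc a : List (Sym α)) with
  | nil => rfl
  | cons x l ih => simp [transduce, ih]

theorem of_encode {f : α → β} (h : PT fun a => (enc (f a) : List (Sym β))) : PT f := by
  obtain ⟨⟨c, t, h⟩⟩ := h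
  exact ⟨⟨c, t, h⟩⟩

theorem encode : PT fun a : α => (enc a : List (Sym α)) :=
  of_flatMap (fun x => [x]) fun a => by simp [enc]

protected theorem id : PT fun a : α => a := of_flatMap (fun x => [x]) fun a => by simp

theorem const (b : β) : PT fun _ : α => b := by
  refine of_transduce () (fun _ _ => ()) (fun _ _ => []) (fun _ => enc b) fun a => ?_
  induction (enc a : List (Sym α)) with
  | nil => rfl
  | cons x l ih => simpa [transduce] using ih

theorem fst : PT fun p : α × β => p.1 :=
  of_flatMap (Sum.elim (fun x => [x]) fun _ => []) fun a => by
    simp [enc, encodeSum, List.flatMap_append, List.flatMap_map]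

theorem snd : PT fun p : α × β => p.2 :=
  of_flatMap (Sum.elim (fun _ => []) fun x => [x]) fun a => by
    simp [enc, encodeSum, List.flatMap_append, List.flatMap_map]

theorem append {f g : α → List A} (hf : PT f) (hg : PT g) : PT fun a => f a ++ g a := by
  have : PT fun p : List A × List A => p.1 ++ p.2 :=
    of_flatMap (Sum.elim (fun x => [x]) fun x => [x]) fun a => by
      simp [enc, encodeSum, List.flatMap_append, List.flatMap_map]
  exact this.comp (hf.pair hg)

theorem add {f g : α → ℕ} (hf : PT f) (hg : PT g) : PT fun a => f a + g a := by
  have : PT fun a => (enc (f a) ++ enc (g a) : List Unit) :=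
    PT.append (A := Unit) (encode.comp hf) (encode.comp hg)
  refine of_encode ?_
  convert this using 2
  exact List.replicate_add ..

/-- Both branches are computed. A transducer that remembers the leading bit then lets one of them
through. -/
theorem ite {c : α → Bool} {f g : α → β} (hc : PT c) (hf : PT f) (hg : PT g) :
    PT fun a => if c a then f a else g a := by
  have : PT fun p : Bool × β × β => if p.1 then p.2.1 else p.2.2 := by
    refine of_transduce (none : Option Bool)
      (fun q => Sum.elim (fun b => some b) fun _ => q)
      (fun q => Sum.elim (fun _ => []) (Sum.elim (fun x => if q = some true then [x] else [])
        fun x => if q = some false then [x] else []))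
      (fun _ => []) ?_
    rintro ⟨b, x, y⟩
    have h₁ : ∀ (x : List (Sym β)) (r : List (Bool ⊕ Sym β ⊕ Sym β)),
        transduce (fun (q : Option Bool) => Sum.elim (fun b => some b) fun _ => q)
          (fun q => Sum.elim (fun _ => []) (Sum.elim (fun x => if q = some true then [x] else [])
            fun x => if q = some false then [x] else []))
          (fun _ => []) (some b) (x.map (Sum.inr ∘ Sum.inl) ++ r) =
        (if b then x else []) ++ transduce (fun (q : Option Bool) => Sum.elim (fun b => some b) fun _ => q)
          (fun q => Sum.elim (fun _ => []) (Sum.elim (fun x => if q = some true then [x] else [])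
            fun x => if q = some false then [x] else []))
          (fun _ => []) (some b) r := by
      intro x r
      induction x with
      | nil => simp
      | cons a x ih => cases b <;> simp_all [transduce]
    have h₂ : ∀ (x : List (Sym β)),
        transduce (fun (q : Option Bool) => Sum.elim (fun b => some b) fun _ => q)
          (fun q => Sum.elim (fun _ => []) (Sum.elim (fun x => if q = some true then [x] else [])
            fun x => if q = some false then [x] else []))
          (fun _ => []) (some b) (x.map (Sum.inr ∘ Sum.inr)) = if b then [] else x := by
      intro x
      induction x with
      | nil => simp [transduce]
      | cons a x ih => cases b <;> simp_all [transduce]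
    change _ = transduce _ _ _ none (Sum.inl b :: (encodeSum enc enc (x, y)).map Sum.inr)
    rw [transduce, encodeSum, List.map_append, List.map_map, List.map_map]
    have e := h₁ (enc x) ((enc y).map (Sum.inr ∘ Sum.inr))
    rw [h₂] at e
    refine Eq.trans ?_ e.symm
    cases b <;> simp
  exact this.comp (hc.pair (hf.pair hg))

theorem foldl {l : α → List A} {s : α → β} {step : A × β → β} (hl : PT l) (hs : PT s)
    (h : PolyComputable (encodeSum (fun a : A => [a]) enc) enc step)
    (hq : ∃ q : Polynomial ℕ, ∀ (l : List A) (s : β),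
      (enc (l.foldl (fun s a => step (a, s)) s)).length ≤ q.eval (l.length + (enc s).length)) :
    PT fun a => (l a).foldl (fun s x => step (x, s)) (s a) := by
  have : PT fun p : List A × β => p.1.foldl (fun s x => step (x, s)) p.2 :=
    PolyComputable.foldl h hq
  exact this.comp (hl.pair hs)

/-- The step of a fold sees only one list element and the current value, so `w a` is carried along
as a part of that value. -/
theorem flatten_replicate {n : α → ℕ} {w : α → List A} (hn : PT n) (hw : PT w) :
    PT fun a => (List.replicate (n a) (w a)).flatten := by
  have hf : ∀ (l : List Unit) (w v : List A),
      l.foldl (fun (s : List A × List A) _ => (s.1, s.1 ++ s.2)) (w, v) =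
        (w, (List.replicate l.length w).flatten ++ v) := by
    intro l w
    induction l with
    | nil => intro v; rfl
    | cons a l ih =>
      intro v
      simp only [List.foldl_cons, ih, List.length_cons]
      rw [List.replicate_succ']
      simp
  have step : PT fun p : Unit × (List A × List A) => (p.2.1, p.2.1 ++ p.2.2) :=
    (fst.comp snd).pair ((fst.comp snd).append (snd.comp snd))
  have key : PT fun a => (List.replicate (n a) ()).foldl
      (fun (s : List A × List A) _ => (s.1, s.1 ++ s.2)) (w a, []) := by
    refine foldl (l := fun a => List.replicate (n a) ()) (s := fun a => (w a, ([] : List A)))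
      (step := fun p => (p.2.1, p.2.1 ++ p.2.2))
      (encode.comp hn) (hw.pair (const _)) step ⟨.X + .X * .X, fun l s => ?_⟩
    obtain ⟨w, v⟩ := s
    simp only [hf]
    simp only [enc, encodeSum, List.length_append, List.length_map, List.length_flatten,
      List.map_replicate, List.sum_replicate, smul_eq_mul, Polynomial.eval_add,
      Polynomial.eval_mul, Polynomial.eval_X]
    nlinarith
  convert snd.comp key using 2
  rw [hf]
  simp

end PT

end SearchClasses

namespace SearchClasses

open Enc (enc Sym)

/-! ### Encoded circuits -/

/-- The code of a circuit without its end marker. -/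
def Circuit.body (c : Circuit) : List Bool := c.flatMap fun g => true :: g.encode

theorem Circuit.encode_eq (c : Circuit) : c.encode = c.body ++ [false] := by
  induction c with
  | nil => rfl
  | cons g c ih =>
    change true :: (g.encode ++ Circuit.encode c) = _
    rw [ih]; simp [Circuit.body]

/-- Without the end marker, concatenating circuits means concatenating their codes. -/
instance : Enc Circuit := ⟨Bool, Circuit.body⟩

namespace PT

variable {α : Type} [Enc α]

theorem of_encode_eq {β : Type} [Enc β] {f : α → β} {g : α → List (Sym β)} (hg : PT g)
    (h : ∀ a, enc (f a) = g a) : PT f := by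
  obtain rfl : g = fun a => enc (f a) := funext fun a => (h a).symm
  exact of_encode hg

theorem circuit_append {f g : α → Circuit} (hf : PT f) (hg : PT g) :
    PT fun a => (f a ++ g a : Circuit) := by
  exact of_encode_eq (PT.append (A := Bool) (encode.comp hf) (encode.comp hg)) fun a =>
    List.flatMap_append

theorem circuit_replicate {n : α → ℕ} {g : α → Gate} (hn : PT n)
    (hg : PT fun a => ([g a] : Circuit)) : PT fun a => (List.replicate (n a) (g a) : Circuit) := by
  refine of_encode_eq (flatten_replicate (A := Bool) hn (encode.comp hg)) fun a => ?_
  change Circuit.body _ = (List.replicate _ (Circuit.body _)).flatten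
  simp [Circuit.body, List.flatMap_def]

theorem encodeNat {n : α → ℕ} (hn : PT n) : PT fun a => SearchClasses.encodeNat (n a) := by
  have : PT SearchClasses.encodeNat := by
    refine of_transduce () (fun _ _ => ()) (fun _ _ => [true]) (fun _ => [false]) fun n => ?_
    change _ = transduce _ _ _ _ (List.replicate n ())
    change List.replicate n true ++ [false] = _
    induction n with
    | zero => rfl
    | succ n ih => simpa [transduce, List.replicate_succ] using ih
  exact this.comp hn

theorem and_gate {i j : α → ℕ} (hi : PT i) (hj : PT j) :
    PT fun a => ([Gate.and (i a) (j a)] : Circuit) := by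
  refine of_encode_eq ((const [true, true, false]).append (hi.encodeNat.append hj.encodeNat))
    fun a => ?_
  change Circuit.body _ = _
  simp [Circuit.body, Gate.encode]

theorem or_gate {i j : α → ℕ} (hi : PT i) (hj : PT j) :
    PT fun a => ([Gate.or (i a) (j a)] : Circuit) := by
  refine of_encode_eq ((const [true, true, true]).append (hi.encodeNat.append hj.encodeNat))
    fun a => ?_
  change Circuit.body _ = _
  simp [Circuit.body, Gate.encode]

theorem not_gate {i : α → ℕ} (hi : PT i) : PT fun a => ([Gate.not (i a)] : Circuit) := by
  refine of_encode_eq ((const [true, false, true]).append hi.encodeNat) fun a => ?_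
  change Circuit.body _ = _
  simp [Circuit.body, Gate.encode]

theorem circuit_encode {c : α → Circuit} (hc : PT c) : PT fun a => (c a).encode := by
  convert PT.append (A := Bool) (encode.comp hc) (const [false]) using 2
  exact Circuit.encode_eq _

end PT

/-! ### A finite automaton that reads pairs of circuits -/

/-- Positions inside the code of a circuit: at the end or before a gate, inside a tag, before the
bit of a constant, and inside the first or the last index of a gate. -/
inductive GateState
  | head
  | tag
  | tag' (b : Bool)
  | const
  | idx (two : Bool)
  deriving DecidableEq, Fintype

/-- Positions inside the code of a pair of circuits with a number in front. -/
inductive ParseState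
  | num
  | gate (last : Bool) (q : GateState)
  | done
  | fail
  deriving DecidableEq, Fintype

open GateState ParseState

/-- The transitions inside the code of a gate. -/
def GateState.next : GateState → Bool → GateState
  | head, _ => tag
  | tag, b => tag' b
  | tag' false, false => const
  | tag' false, true => idx false
  | tag' true, _ => idx true
  | const, _ => head
  | idx two, true => idx two
  | idx true, false => idx false
  | idx false, false => head

/-- The transitions inside the code of a pair of circuits with a number in front. -/
def ParseState.next : ParseState → Bool → ParseState
  | num, true => num
  | num, false => gate false head
  | gate false head, false => gate true head
  | gate true head, false => done
  | gate p q, b => gate p (q.next b)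
  | done, _ => fail
  | fail, _ => fail

/-- What a transducer with the transitions `ParseState.next` puts out when it reads a gate. -/
def gateOutput {B : Type} (out : GateState → Bool → List B) : Gate → List B
  | .const b => out head true ++ out tag false ++ out (tag' false) false ++ out const b
  | .not i => out head true ++ out tag false ++ out (tag' false) true ++
      (List.replicate i (out (idx false) true)).flatten ++ out (idx false) false
  | .and i j => out head true ++ out tag true ++ out (tag' true) false ++
      (List.replicate i (out (idx true) true)).flatten ++ out (idx true) false ++
      (List.replicate j (out (idx false) true)).flatten ++ out (idx false) false
  | .or i j => out head true ++ out tag true ++ out (tag' true) true ++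
      (List.replicate i (out (idx true) true)).flatten ++ out (idx true) false ++
      (List.replicate j (out (idx false) true)).flatten ++ out (idx false) false

/-! ### The output of a transducer on the code of an instance -/

section

variable {B : Type} {out : ParseState → Bool → List B} {fin : ParseState → List B}

theorem transduce_idx_true (p : Bool) (i : ℕ) (r : List Bool) :
    transduce ParseState.next out fin (gate p (idx true)) (encodeNat i ++ r) =
      (List.replicate i (out (gate p (idx true)) true)).flatten ++
        (out (gate p (idx true)) false ++
          transduce ParseState.next out fin (gate p (idx false)) r) := by
  induction i with
  | zero => cases p <;> rfl
  | succ i ih =>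
    trans out (gate p (idx true)) true ++ transduce ParseState.next out fin (gate p (idx true))
      (encodeNat i ++ r)
    · cases p <;> rfl
    rw [ih]; simp [List.replicate_succ]

theorem transduce_idx_false (p : Bool) (i : ℕ) (r : List Bool) :
    transduce ParseState.next out fin (gate p (idx false)) (encodeNat i ++ r) =
      (List.replicate i (out (gate p (idx false)) true)).flatten ++
        (out (gate p (idx false)) false ++
          transduce ParseState.next out fin (gate p head) r) := by
  induction i with
  | zero => cases p <;> rfl
  | succ i ih =>
    trans out (gate p (idx false)) true ++ transduce ParseState.next out fin (gate p (idx false))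
      (encodeNat i ++ r)
    · cases p <;> rfl
    rw [ih]; simp [List.replicate_succ]

theorem transduce_gate (p : Bool) (g : Gate) (r : List Bool) :
    transduce ParseState.next out fin (gate p head) (true :: (g.encode ++ r)) =
      gateOutput (fun q => out (gate p q)) g ++
        transduce ParseState.next out fin (gate p head) r := by
  cases g with
  | const b =>
    cases p <;> simp [Gate.encode, transduce, ParseState.next, GateState.next, gateOutput]
  | not i =>
    cases p <;> simp [Gate.encode, transduce, ParseState.next, GateState.next, gateOutput,
      transduce_idx_false]
  | and i j =>
    cases p <;> simp [Gate.encode, transduce, ParseState.next, GateState.next, gateOutput,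
      transduce_idx_false, transduce_idx_true]
  | or i j =>
    cases p <;> simp [Gate.encode, transduce, ParseState.next, GateState.next, gateOutput,
      transduce_idx_false, transduce_idx_true]

theorem transduce_body (p : Bool) (c : Circuit) (r : List Bool) :
    transduce ParseState.next out fin (gate p head) (c.body ++ r) =
      c.flatMap (gateOutput fun q => out (gate p q)) ++
        transduce ParseState.next out fin (gate p head) r := by
  induction c with
  | nil => rfl
  | cons g c ih =>
    have : (Circuit.body (g :: c)) ++ r = true :: (g.encode ++ (Circuit.body c ++ r)) := by
      simp [Circuit.body]
    rw [this, transduce_gate, ih]; simp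

theorem transduce_num (n : ℕ) (r : List Bool) :
    transduce ParseState.next out fin num (encodeNat n ++ r) =
      (List.replicate n (out num true)).flatten ++
        (out num false ++ transduce ParseState.next out fin (gate false head) r) := by
  induction n with
  | zero => rfl
  | succ i ih =>
    change out num true ++ transduce ParseState.next out fin num (encodeNat i ++ r) = _
    rw [ih]; simp [List.replicate_succ]

/-- The number, the gates of `S` and the gates of `P` contribute separate factors. An `out` that is
silent on all but one of them extracts that part of the instance. -/
theorem transduce_encode (I : LineInstance) :
    transduce ParseState.next out fin num I.encode =
      (List.replicate I.n (out num true)).flatten ++ out num false ++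
      I.S.flatMap (gateOutput fun q => out (gate false q)) ++ out (gate false head) false ++
      I.P.flatMap (gateOutput fun q => out (gate true q)) ++ out (gate true head) false ++
      fin done := by
  rw [LineInstance.encode, transduce_num, Circuit.encode_eq, Circuit.encode_eq, List.append_assoc,
    transduce_body, List.singleton_append, transduce]
  change _ ++ (_ ++ (_ ++ (_ ++ transduce _ _ _ (gate true head) _))) = _
  rw [transduce_body]
  simp [transduce, ParseState.next]

end

theorem gateOutput_copy {out : GateState → Bool → List Bool}
    (h : ∀ q b, q ≠ head ∨ b = true → out q b = [b]) (g : Gate) :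
    gateOutput out g = true :: g.encode := by
  have e : ∀ i, (List.replicate i [true]).flatten = List.replicate i true := by simp
  cases g <;> simp [gateOutput, h, Gate.encode, encodeNat, e]

theorem gateOutput_nil {B : Type} {out : GateState → Bool → List B} (h : ∀ q b, out q b = [])
    (g : Gate) : gateOutput out g = [] := by
  cases g <;> simp [gateOutput, h]

/-! ### Acceptance -/

/-- The words that lead from a state to `done`. -/
def ParseState.Accepts : ParseState → List Bool → Prop
  | num, x => ∃ n, ∃ c d : Circuit, x = encodeNat n ++ (c.encode ++ d.encode)
  | gate p head, x => Tail p x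
  | gate p tag, x => ∃ (g : Gate) (r : List Bool), x = g.encode ++ r ∧ Tail p r
  | gate p (tag' b), x => ∃ (g : Gate) (r : List Bool), b :: x = g.encode ++ r ∧ Tail p r
  | gate p const, x => ∃ (b : Bool) (r : List Bool), x = b :: r ∧ Tail p r
  | gate p (idx false), x => ∃ (i : ℕ) (r : List Bool), x = encodeNat i ++ r ∧ Tail p r
  | gate p (idx true), x => ∃ (i j : ℕ) (r : List Bool),
      x = encodeNat i ++ (encodeNat j ++ r) ∧ Tail p r
  | done, x => x = []
  | fail, _ => False
where
  /-- The codes of one circuit or of two circuits. -/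
  Tail : Bool → List Bool → Prop
    | true, x => ∃ c : Circuit, x = c.encode
    | false, x => ∃ c d : Circuit, x = c.encode ++ d.encode

/-- Since numbers are in unary, the codes form a regular language. The sets `Accepts` are arranged
so that a decomposition of `x` from the next state extends to one of `b :: x` from the current
state. -/
theorem ParseState.accepts_cons {q : ParseState} {b : Bool} {x : List Bool}
    (h : (q.next b).Accepts x) : q.Accepts (b :: x) := by
  match q, b with
  | num, true =>
    obtain ⟨n, c, d, rfl⟩ := h
    exact ⟨n + 1, c, d, rfl⟩
  | num, false =>
    obtain ⟨c, d, rfl⟩ := h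
    exact ⟨0, c, d, rfl⟩
  | gate false head, false =>
    obtain ⟨d, rfl⟩ := h
    exact ⟨[], d, rfl⟩
  | gate true head, false =>
    obtain rfl : x = [] := h
    exact ⟨[], rfl⟩
  | gate false head, true =>
    obtain ⟨g, r, rfl, c, d, rfl⟩ := h
    exact ⟨g :: c, d, by simp [Circuit.encode]⟩
  | gate true head, true =>
    obtain ⟨g, r, rfl, c, rfl⟩ := h
    exact ⟨g :: c, by simp [Circuit.encode]⟩
  | gate p tag, b =>
    cases p <;> exact h
  | gate p (tag' false), false =>
    have : ParseState.Accepts (gate p const) x := by cases p <;> exact h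
    obtain ⟨b, r, rfl, hr⟩ := this
    exact ⟨.const b, r, rfl, hr⟩
  | gate p (tag' false), true =>
    have : ParseState.Accepts (gate p (idx false)) x := by cases p <;> exact h
    obtain ⟨i, r, rfl, hr⟩ := this
    exact ⟨.not i, r, rfl, hr⟩
  | gate p (tag' true), false =>
    have : ParseState.Accepts (gate p (idx true)) x := by cases p <;> exact h
    obtain ⟨i, j, r, rfl, hr⟩ := this
    exact ⟨.and i j, r, by simp [Gate.encode], hr⟩
  | gate p (tag' true), true =>
    have : ParseState.Accepts (gate p (idx true)) x := by cases p <;> exact h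
    obtain ⟨i, j, r, rfl, hr⟩ := this
    exact ⟨.or i j, r, by simp [Gate.encode], hr⟩
  | gate p const, b =>
    have : ParseState.Accepts.Tail p x := by cases p <;> exact h
    exact ⟨b, x, rfl, this⟩
  | gate p (idx true), true =>
    have : ParseState.Accepts (gate p (idx true)) x := by cases p <;> exact h
    obtain ⟨i, j, r, rfl, hr⟩ := this
    exact ⟨i + 1, j, r, rfl, hr⟩
  | gate p (idx true), false =>
    have : ParseState.Accepts (gate p (idx false)) x := by cases p <;> exact h
    obtain ⟨j, r, rfl, hr⟩ := this
    exact ⟨0, j, r, rfl, hr⟩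
  | gate p (idx false), true =>
    have : ParseState.Accepts (gate p (idx false)) x := by cases p <;> exact h
    obtain ⟨i, r, rfl, hr⟩ := this
    exact ⟨i + 1, r, rfl, hr⟩
  | gate p (idx false), false =>
    have : ParseState.Accepts.Tail p x := by cases p <;> exact h
    exact ⟨0, x, rfl, this⟩
  | done, _ => exact h.elim
  | fail, _ => exact h.elim

theorem ParseState.accepts_of_foldl {q : ParseState} {x : List Bool}
    (h : x.foldl ParseState.next q = done) : q.Accepts x := by
  induction x generalizing q with
  | nil => rw [List.foldl_nil] at h; subst h; exact rfl
  | cons b x ih => exact accepts_cons (ih h)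

/-- Decide whether a word is the code of an instance of End-of-Line. -/
def accepts (x : List Bool) : Bool := x.foldl ParseState.next num = done

theorem transduce_accepts (q : ParseState) (x : List Bool) :
    transduce ParseState.next (fun _ _ => []) (fun q => [decide (q = done)]) q x =
      [decide (x.foldl ParseState.next q = done)] := by
  induction x generalizing q with
  | nil => rfl
  | cons b x ih => exact ih (q.next b)

theorem accepts_iff (x : List Bool) : accepts x = true ↔ ∃ I : LineInstance, x = I.encode := by
  constructor
  · intro h
    obtain ⟨n, c, d, h⟩ := ParseState.accepts_of_foldl (of_decide_eq_true h)
    exact ⟨⟨n, c, d⟩, h⟩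
  · rintro ⟨I, rfl⟩
    -- For a code, `transduce_encode` says that the final state is `done`; a transducer that only
    -- reports its final state turns this into a statement about the run.
    have h := transduce_accepts num I.encode
    rw [transduce_encode] at h
    have e : ∀ c : Circuit, c.flatMap (gateOutput fun _ _ => ([] : List Bool)) = [] := by
      intro c; simp [gateOutput_nil]
    simpa [e, accepts] using h

theorem PT.accepts : PT SearchClasses.accepts :=
  PT.of_transduce num ParseState.next (fun _ _ => []) (fun q => [decide (q = done)])
    fun x => (transduce_accepts num x).symm

/-! ### The parts of an instance of End-of-Line -/

open Classical in
/-- The instance with the given code, if there is one. -/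
noncomputable def parse (x : List Bool) : LineInstance :=
  if h : ∃ I : LineInstance, x = I.encode then h.choose else ⟨0, [], []⟩

theorem parse_encode (I : LineInstance) : parse I.encode = I := by
  have h : ∃ J : LineInstance, I.encode = J.encode := ⟨I, rfl⟩
  rw [parse, dif_pos h]
  exact LineInstance.encode_injective h.choose_spec.symm

theorem parse_of_not_accepts {x : List Bool} (h : ¬ accepts x = true) : parse x = ⟨0, [], []⟩ := by
  rw [parse, dif_neg ((accepts_iff x).not.1 h)]

/-- On a word that is no code the transducer may put out anything, so the result is replaced there
by the value at the default instance of `parse`. -/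
theorem PT.of_parse {β : Type} [Enc β] {f : LineInstance → β}
    (out : ParseState → Bool → List (Sym β))
    (h : ∀ I, enc (f I) = transduce ParseState.next out (fun _ => []) num I.encode) :
    PT fun x => f (parse x) := by
  have h₁ : PT fun x : List Bool => transduce ParseState.next out (fun _ => []) num x :=
    PT.of_transduce num ParseState.next out (fun _ => []) fun _ => rfl
  refine PT.of_encode_eq (PT.accepts.ite h₁ (PT.const (enc (f ⟨0, [], []⟩)))) fun x => ?_
  split_ifs with hx
  · obtain ⟨I, rfl⟩ := (accepts_iff x).1 hx
    rw [parse_encode, h]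
  · rw [parse_of_not_accepts hx]

theorem flatMap_gateOutput_nil {B : Type} {out : GateState → Bool → List B}
    (h : ∀ q b, out q b = []) (c : Circuit) : c.flatMap (gateOutput out) = [] := by
  simp [gateOutput_nil h]

theorem flatMap_gateOutput_copy {out : GateState → Bool → List Bool}
    (h : ∀ q b, q ≠ head ∨ b = true → out q b = [b]) (c : Circuit) :
    c.flatMap (gateOutput out) = c.body := by
  rw [Circuit.body]
  congr 1
  funext g
  exact gateOutput_copy h g

theorem PT.parse_n : PT fun x => (parse x).n := by
  refine PT.of_parse (f := fun I => I.n) (fun q b => if q = num ∧ b = true then [()] else [])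
    fun I => ?_
  rw [transduce_encode]
  have h : List.replicate I.n () =
      (List.replicate I.n [()]).flatten ++ [] ++ [] ++ [] ++ [] ++ [] ++ [] := by
    simp
  refine h.trans ?_
  congr 1
  congr 1
  congr 1
  · congr 1
    exact congrArg _ (flatMap_gateOutput_nil (fun _ _ => rfl) _).symm
  · exact (flatMap_gateOutput_nil (fun _ _ => rfl) _).symm

/-- The output that copies the codes of the gates of one of the two circuits. -/
def copyOutput (p : Bool) : ParseState → Bool → List Bool
  | gate p' q, b => if p = p' ∧ (q ≠ head ∨ b = true) then [b] else []
  | _, _ => []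

theorem flatMap_copyOutput (p p' : Bool) (c : Circuit) :
    c.flatMap (gateOutput fun q => copyOutput p (gate p' q)) = if p = p' then c.body else [] := by
  split_ifs with h
  · exact flatMap_gateOutput_copy (fun q b hq => if_pos ⟨h, hq⟩) c
  · exact flatMap_gateOutput_nil (fun q b => if_neg fun h' => h h'.1) c

theorem transduce_copyOutput (p : Bool) (I : LineInstance) :
    transduce ParseState.next (copyOutput p) (fun _ => []) num I.encode =
      if p then I.P.body else I.S.body := by
  rw [transduce_encode, flatMap_copyOutput, flatMap_copyOutput]
  cases p <;> simp [copyOutput]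

theorem PT.parse_S : PT fun x => (parse x).S :=
  PT.of_parse (f := fun I => I.S) (copyOutput false) fun I => (transduce_copyOutput false I).symm

theorem PT.parse_P : PT fun x => (parse x).P :=
  PT.of_parse (f := fun I => I.P) (copyOutput true) fun I => (transduce_copyOutput true I).symm

/-! ### The length of a circuit and shifted circuits -/

/-- Increase all indices by `d`. -/
def Gate.shift (d : ℕ) : Gate → Gate
  | const b => const b
  | not i => not (d + i)
  | and i j => and (d + i) (d + j)
  | or i j => or (d + i) (d + j)

theorem transduce_circuit {B : Type} {out : ParseState → Bool → List B} (c : Circuit) :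
    transduce ParseState.next out (fun _ => []) (gate false head) c.body =
      c.flatMap (gateOutput fun q => out (gate false q)) := by
  simpa [transduce] using transduce_body (out := out) (fin := fun _ => []) false c []

theorem PT.circuit_length {α : Type} [Enc α] {c : α → Circuit} (hc : PT c) :
    PT fun a => (c a).length := by
  have : PT fun c : Circuit => c.length := by
    refine PT.of_transduce (gate false head) ParseState.next
      (fun q _ => if q = gate false head then [()] else []) (fun _ => []) fun c => ?_
    refine Eq.trans ?_ (transduce_circuit c).symm
    have h : ∀ g : Gate, gateOutput (fun q _ => if gate false q = gate false head then [()] else [])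
        g = [()] := by
      intro g; cases g <;> simp [gateOutput]
    have h' : List.replicate c.length () = c.flatMap fun _ => [()] := by
      induction c with
      | nil => rfl
      | cons g c ih => exact congrArg (() :: ·) ih
    refine h'.trans ?_
    congr 1
    funext g
    exact (h g).symm
  exact this.comp hc

/-- The code of a circuit, with a marker `none` before each index. -/
def markOutput : GateState → Bool → List (Option Bool)
  | tag' false, true => [some true, none]
  | tag' true, b => [some b, none]
  | idx true, false => [some false, none]
  | _, b => [some b]

/-- A marker stands exactly where a unary index begins, and inserting `d` ones there adds `d` to the
index. -/
theorem flatMap_markOutput (d : ℕ) (g : Gate) :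
    (gateOutput markOutput g).flatMap (fun o => o.elim (List.replicate d true) fun b => [b]) =
      true :: (g.shift d).encode := by
  have e : ∀ i (b : Option Bool), (List.replicate i [b]).flatten = List.replicate i b := by simp
  cases g <;> simp [-List.replicate_append_replicate, gateOutput, markOutput,
    List.flatMap_append, Gate.encode, Gate.shift, encodeNat, e,
    List.replicate_add, List.flatMap_replicate]

/-- The inserted word has unbounded length and does not fit into the control of a transducer. A fold
carries it in its value. -/
theorem PT.substitute {α : Type} [Enc α] {l : α → List (Option Bool)} {w : α → List Bool}
    (hl : PT l) (hw : PT w) :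
    PT fun a => (l a).flatMap fun o => o.elim (w a) fun b => [b] := by
  have hf : ∀ (l : List (Option Bool)) (w v : List Bool),
      l.foldl (fun (s : List Bool × List Bool) o => (s.1, s.2 ++ o.elim s.1 fun b => [b])) (w, v) =
        (w, v ++ l.flatMap fun o => o.elim w fun b => [b]) := by
    intro l w
    induction l with
    | nil => intro v; simp
    | cons a l ih => intro v; simp [ih]
  have h₁ : PT fun o : Option Bool => o.isNone := PT.of_flatMap (fun o => [o.isNone]) fun _ => rfl
  have h₂ : PT fun o : Option Bool => o.toList := PT.of_flatMap (fun o => o.toList) fun o => by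
    cases o <;> rfl
  have step : PT fun p : Option Bool × (List Bool × List Bool) =>
      (p.2.1, p.2.2 ++ p.1.elim p.2.1 fun b => [b]) := by
    have : PT fun p : Option Bool × (List Bool × List Bool) =>
        if p.1.isNone then p.2.1 else p.1.toList :=
      (h₁.comp PT.fst).ite (PT.fst.comp PT.snd) (h₂.comp PT.fst)
    convert (PT.fst.comp PT.snd).pair ((PT.snd.comp PT.snd).append this) using 4 with p
    cases p.1 <;> rfl
  have key : PT fun a => (l a).foldl
      (fun (s : List Bool × List Bool) o => (s.1, s.2 ++ o.elim s.1 fun b => [b])) (w a, []) := by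
    refine PT.foldl (A := Option Bool) (s := fun a => (w a, ([] : List Bool)))
      (step := fun p => (p.2.1, p.2.2 ++ p.1.elim p.2.1 fun b => [b]))
      hl (hw.pair (PT.const _)) step ⟨.X + .X * (.X + 1), fun l s => ?_⟩
    obtain ⟨w, v⟩ := s
    have hb : (l.flatMap fun o => o.elim w fun b => [b]).length ≤ l.length * (w.length + 1) := by
      induction l with
      | nil => simp
      | cons o l ih =>
        have : (o.elim w fun b => [b]).length ≤ w.length + 1 := by cases o <;> simp
        simp only [List.flatMap_cons, List.length_append, List.length_cons]
        rw [add_mul]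
        omega
    simp only [hf]
    simp only [enc, encodeSum, List.length_append, List.length_map, Polynomial.eval_add,
      Polynomial.eval_mul, Polynomial.eval_X, Polynomial.eval_one]
    nlinarith
  convert PT.snd.comp key using 2
  rw [hf]
  rfl

theorem PT.circuit_shift {α : Type} [Enc α] {d : α → ℕ} {c : α → Circuit} (hd : PT d) (hc : PT c) :
    PT fun a => ((c a).map (Gate.shift (d a)) : Circuit) := by
  have h₁ : PT fun c : Circuit => (c.flatMap (gateOutput markOutput) : List (Option Bool)) := by
    refine PT.of_transduce (gate false head) ParseState.next (fun q b => match q with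
      | gate _ q => markOutput q b
      | _ => []) (fun _ => []) fun c => ?_
    exact (transduce_circuit (out := fun q b => match q with
      | gate _ q => markOutput q b
      | _ => []) c).symm
  have h₂ : PT fun a => List.replicate (d a) true := by
    have : PT fun n : ℕ => List.replicate n true := by
      refine PT.of_flatMap (fun _ => [true]) fun n => ?_
      change List.replicate n true = (List.replicate n ()).flatMap fun _ => [true]
      induction n with
      | zero => rfl
      | succ n ih => exact congrArg (true :: ·) ih
    exact this.comp hd
  refine PT.of_encode_eq (PT.substitute (h₁.comp hc) h₂) fun a => ?_
  refine Eq.trans ?_ (List.flatMap_assoc ..).symm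
  change Circuit.body _ = _
  rw [Circuit.body, List.flatMap_map]
  congr 1
  funext g
  exact (flatMap_markOutput (d a) g).symm

end SearchClasses

namespace SearchClasses

open Enc (enc Sym)

/-! ### Running circuits -/

namespace Gate

theorem InRange.mono {g : Gate} {s s' : ℕ} (h : g.InRange s) (hs : s ≤ s') : g.InRange s' := by
  cases g <;> simp only [InRange] at h ⊢ <;> omega

theorem eval_append {g : Gate} {x : List Bool} (h : g.InRange x.length) (w : List Bool) :
    g.eval (x ++ w) = g.eval x := by
  cases g <;> simp only [InRange, eval] at h ⊢
  · rw [List.getD_append _ _ _ _ h]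
  all_goals rw [List.getD_append _ _ _ _ h.1, List.getD_append _ _ _ _ h.2]

theorem inRange_shift {g : Gate} {d s : ℕ} : (g.shift d).InRange (d + s) ↔ g.InRange s := by
  cases g <;> simp [InRange, shift]

end Gate

namespace Circuit

theorem run_append (c d : Circuit) (w : List Bool) : run (c ++ d) w = run d (run c w) := by
  induction c generalizing w with
  | nil => rfl
  | cons g c ih => exact ih _

theorem length_run (c : Circuit) (w : List Bool) : (run c w).length = w.length + c.length := by
  induction c generalizing w with
  | nil => rfl
  | cons g c ih => rw [run, ih, List.length_cons, List.length_cons]; omega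

theorem exists_run_eq (c : Circuit) (w : List Bool) :
    ∃ v : List Bool, v.length = c.length ∧ run c w = v ++ w := by
  induction c generalizing w with
  | nil => exact ⟨[], rfl, rfl⟩
  | cons g c ih =>
    obtain ⟨v, hv, h⟩ := ih (g.eval w :: w)
    exact ⟨v ++ [g.eval w], by simp [hv], by simp [run, h]⟩

theorem wellFormed_append {c d : Circuit} {s : ℕ} :
    WellFormed (c ++ d) s ↔ WellFormed c s ∧ WellFormed d (s + c.length) := by
  induction c generalizing s with
  | nil => simp [WellFormed]
  | cons g c ih =>
    rw [List.cons_append, WellFormed, WellFormed, ih, and_assoc, List.length_cons,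
      Nat.add_assoc, Nat.add_comm 1]

theorem WellFormed.mono {c : Circuit} {s s' : ℕ} (h : c.WellFormed s) (hs : s ≤ s') :
    c.WellFormed s' := by
  induction c generalizing s s' with
  | nil => trivial
  | cons g c ih => exact ⟨h.1.mono hs, ih h.2 (by omega)⟩

/-- Wires are counted from the latest, so a well-formed circuit does not see the wires below its
inputs. This is what allows `S` and `P` to be run on the top block of a larger network. -/
theorem run_append_right {c : Circuit} {x : List Bool} (h : c.WellFormed x.length)
    (w : List Bool) : run c (x ++ w) = run c x ++ w := by
  induction c generalizing x with
  | nil => rfl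
  | cons g c ih =>
    rw [run, Gate.eval_append h.1, ← List.cons_append, ih (x := g.eval x :: x) h.2, run]

theorem wellFormed_of_forall {c : Circuit} {s : ℕ} (h : ∀ g ∈ c, g.InRange s) :
    c.WellFormed s := by
  induction c generalizing s with
  | nil => trivial
  | cons g c ih =>
    exact ⟨h g (by simp), ih fun g' hg => (h g' (by simp [hg])).mono (by omega)⟩

theorem wellFormed_shift {c : Circuit} {d s : ℕ} :
    WellFormed (c.map (Gate.shift d)) (d + s) ↔ c.WellFormed s := by
  induction c generalizing s with
  | nil => simp [WellFormed]
  | cons g c ih => rw [List.map_cons, WellFormed, WellFormed, Gate.inRange_shift, Nat.add_assoc, ih]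

end Circuit

/-! ### Gates that process blocks of wires -/

/-- The gate for a conjunction or a disjunction. -/
def Gate.bin (b : Bool) (i j : ℕ) : Gate := if b then .and i j else .or i j

/-- Conjunction or disjunction. -/
def binOp (b x y : Bool) : Bool := if b then x && y else x || y

theorem Gate.eval_bin (b : Bool) (i j : ℕ) (w : List Bool) :
    (Gate.bin b i j).eval w = binOp b (w.getD i false) (w.getD j false) := by
  cases b <;> rfl

/-- The block `X` lies among the wires `w`, its last bit being wire `i`. -/
def IsBlock (w X : List Bool) (i : ℕ) : Prop :=
  ∃ A R : List Bool, w = A ++ (X ++ R) ∧ i = A.length + X.length - 1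

namespace IsBlock

variable {w X : List Bool} {i : ℕ} {x : Bool}

theorem lt (h : IsBlock w X i) (hX : X ≠ []) : i < w.length := by
  obtain ⟨A, R, rfl, rfl⟩ := h
  have := List.length_pos_iff.2 hX
  simp; omega

theorem tail (h : IsBlock w (x :: X) i) : IsBlock w X i := by
  obtain ⟨A, R, rfl, rfl⟩ := h
  exact ⟨A ++ [x], R, by simp, by simp⟩

theorem getD (h : IsBlock w (x :: X) i) {v : List Bool} (hv : v.length = X.length) :
    (v ++ w).getD i false = x := by
  obtain ⟨A, R, rfl, rfl⟩ := h
  have : A.length + (x :: X).length - 1 = v.length + A.length := by simp [hv]; omega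
  rw [this, List.getD_append_right _ _ _ _ (by omega)]
  simp [List.getD_eq_getElem?_getD]

/-- Every new gate moves all older wires one place further away. The same index, repeated, therefore
walks through a block from its last bit to its first, and a bitwise operation is one gate repeated.
-/
theorem run_bin {Y : List Bool} {j : ℕ} (hX : IsBlock w X i) (hY : IsBlock w Y j)
    (h : X.length = Y.length) (b : Bool) :
    Circuit.run (List.replicate X.length (Gate.bin b i j)) w = List.zipWith (binOp b) X Y ++ w := by
  induction X generalizing Y with
  | nil => rfl
  | cons x X ih =>
    obtain _ | ⟨y, Y⟩ := Y
    · simp at h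
    have h' : X.length = Y.length := by simpa using h
    rw [List.length_cons, List.replicate_succ', Circuit.run_append, ih hX.tail hY.tail h']
    simp only [Circuit.run, Gate.eval_bin]
    rw [hX.getD (by simp [h']), hY.getD (by simp [h'])]
    rfl

/-- The gate now depends on the position. As the last bit is processed first, the list of gates is
reversed. A bit to be kept is copied by a conjunction with itself. -/
theorem run_flip {m : List Bool} (hX : IsBlock w X i) (h : X.length = m.length) :
    Circuit.run (m.map fun y => if y then Gate.not i else Gate.and i i).reverse w =
      List.zipWith xor m X ++ w := by
  induction X generalizing m with
  | nil =>
    obtain rfl : m = [] := by simpa using h.symm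
    rfl
  | cons x X ih =>
    obtain _ | ⟨y, m⟩ := m
    · simp at h
    have h' : X.length = m.length := by simpa using h
    rw [List.map_cons, List.reverse_cons, Circuit.run_append, ih hX.tail h']
    have e := hX.getD (v := List.zipWith xor m X) (by simp [h'])
    rw [List.getD_eq_getElem?_getD] at e
    cases y <;> simp [Circuit.run, Gate.eval, e]

/-- Index `0` is the running result, and `i + 1` allows for the constant wire that starts it. The
partial results remain as wires, hence `scanr`. -/
theorem run_red (hX : IsBlock w X i) (b : Bool) :
    Circuit.run (.const b :: List.replicate X.length (Gate.bin b (i + 1) 0)) w =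
      X.scanr (binOp b) b ++ w := by
  rw [Circuit.run]
  induction X with
  | nil => rfl
  | cons x X ih =>
    rw [List.length_cons, List.replicate_succ', Circuit.run_append, ih hX.tail]
    simp only [Circuit.run, Gate.eval_bin]
    have e := hX.getD (v := (X.scanr (binOp b) b).tail) (by simp)
    cases hs : X.scanr (binOp b) b with
    | nil => simpa using congrArg List.length hs
    | cons s l =>
      rw [hs, List.tail_cons] at e
      have hs' : s = X.foldr (binOp b) b := by
        have := congrArg (fun l => l.headD false) hs
        cases X <;> simp_all
      rw [List.scanr_cons, hs, List.cons_append, List.getD_cons_succ, e, hs']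
      rfl

end IsBlock

theorem run_replicate_and (n : ℕ) (b : Bool) (w : List Bool) :
    Circuit.run (List.replicate n (.and 0 0)) (b :: w) = List.replicate n b ++ b :: w := by
  induction n with
  | zero => rfl
  | succ n ih =>
    rw [List.replicate_succ', Circuit.run_append, ih]
    cases n <;> simp [Circuit.run, Gate.eval, List.replicate_succ]

end SearchClasses

namespace SearchClasses

open Enc (enc Sym)

/-! ### Programs on blocks of wires -/

/-- The entry at height `i` of a stack. -/
def level {β : Type} (L : List β) (i : ℕ) (d : β) : β := L.getD (L.length - 1 - i) d

/-- The number of wires above the block at height `i`. -/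
def depth (L : List ℕ) (i : ℕ) : ℕ := (L.take (L.length - 1 - i)).sum

/-- The last wire of the block at height `i`. -/
def lastWire (L : List ℕ) (i : ℕ) : ℕ := depth L i + level L i 0 - 1

/-- Operations on a stack of blocks of wires, which are addressed by their heights. -/
inductive Op
  /-- bitwise conjunction or disjunction -/
  | bin (b : Bool) (i j : ℕ)
  /-- bitwise negation -/
  | neg (i : ℕ)
  /-- negation of some of the bits -/
  | flip (m : List Bool) (i : ℕ)
  /-- conjunction or disjunction of all bits of a block -/
  | red (b : Bool) (i : ℕ)
  /-- copies of a bit, as many as a block has bits -/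
  | bcast (i j : ℕ)
  /-- apply one of the circuits of the instance to the top block -/
  | call (p : Bool)

namespace LineInstance

/-- One of the circuits of the instance. -/
def circuit (I : LineInstance) (p : Bool) : Circuit := if p then I.P else I.S

end LineInstance

namespace Op

variable (I : LineInstance)

/-- The gates of an operation, for given sizes of the blocks. -/
def compile (L : List ℕ) : Op → Circuit
  | bin b i j => List.replicate (level L i 0) (.bin b (lastWire L i) (lastWire L j))
  | neg i => List.replicate (level L i 0) (.not (lastWire L i))
  | flip m i => (m.map fun y => if y then Gate.not (lastWire L i)
      else .and (lastWire L i) (lastWire L i)).reverse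
  | red b i => .const b :: List.replicate (level L i 0) (.bin b (lastWire L i + 1) 0)
  | bcast i j => .and (lastWire L i) (lastWire L i) :: List.replicate (level L j 0) (.and 0 0)
  | call p => I.circuit p

/-- The sizes of the blocks after an operation. -/
def layout (L : List ℕ) : Op → List ℕ
  | bin _ i _ => level L i 0 :: L
  | neg i => level L i 0 :: L
  | flip _ i => level L i 0 :: L
  | red _ i => 1 :: level L i 0 :: L
  | bcast _ j => level L j 0 :: 1 :: L
  | call p => I.n :: (I.circuit p).length :: L.tail

/-- The operation makes sense for blocks of the given sizes. -/
def Ok (L : List ℕ) : Op → Prop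
  | bin _ i j => i < L.length ∧ j < L.length ∧ level L i 0 = level L j 0
  | neg i => i < L.length
  | flip m i => i < L.length ∧ level L i 0 = m.length
  | red _ i => i < L.length
  | bcast i j => i < L.length ∧ j < L.length ∧ level L i 0 = 1
  | call _ => L.head? = some I.n

/-- The effect of an operation. -/
def eval (B : List (List Bool)) : Op → List (List Bool)
  | bin b i j => List.zipWith (binOp b) (level B i []) (level B j []) :: B
  | neg i => (level B i []).map not :: B
  | flip m i => List.zipWith xor m (level B i []) :: B
  | red b i => [(level B i []).foldr (binOp b) b] ::
      ((level B i []).scanr (binOp b) b).tail :: B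
  | bcast i j => List.replicate (level B j []).length ((level B i []).headD false) ::
      [(level B i []).headD false] :: B
  | call p => (I.circuit p).output I.n (B.headD []) ::
      ((I.circuit p).run (B.headD [])).drop I.n :: B.tail

end Op

theorem level_map {β γ : Type} (f : β → γ) (L : List β) (i : ℕ) (d : β) :
    level (L.map f) i (f d) = f (level L i d) := by
  simp only [level, List.length_map, List.getD_eq_getElem?_getD, List.getElem?_map]
  cases L[L.length - 1 - i]? <;> rfl

/-- Heights are counted from the bottom, so the address of a block survives every push. -/
theorem level_append {β : Type} (A B : List β) {i : ℕ} (h : i < B.length) (d : β) :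
    level (A ++ B) i d = level B i d := by
  rw [level, level, List.length_append, List.getD_append_right _ _ _ _ (by omega)]
  congr 1; omega

theorem isBlock_level (B : List (List Bool)) {i : ℕ} (hi : i < B.length) :
    IsBlock B.flatten (level B i []) (lastWire (B.map List.length) i) := by
  have h : B.length - 1 - i < B.length := by omega
  refine ⟨(B.take (B.length - 1 - i)).flatten, (B.drop (B.length - 1 - i + 1)).flatten, ?_, ?_⟩
  · rw [level, List.getD_eq_getElem _ _ h, ← List.flatten_cons, ← List.drop_eq_getElem_cons h,
      ← List.flatten_append, List.take_append_drop]
  · rw [lastWire, depth, List.length_flatten, List.length_map, List.map_take]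
    congr 2
    exact level_map List.length B i []

theorem wellFormed_replicate_and {d n s : ℕ} (h : d < s) :
    Circuit.WellFormed (.and d d :: List.replicate n (.and 0 0)) s := by
  refine Circuit.wellFormed_of_forall fun g hg => ?_
  obtain rfl | hg := List.mem_cons.1 hg
  · exact ⟨h, h⟩
  · rw [List.eq_of_mem_replicate hg]
    exact ⟨by omega, by omega⟩

theorem Gate.inRange_bin {b : Bool} {i j s : ℕ} (hi : i < s) (hj : j < s) :
    (Gate.bin b i j).InRange s := by
  cases b <;> exact ⟨hi, hj⟩

/-- The circuit `c` turns the wires `w` into the wires `w'`. -/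
def Computes (c : Circuit) (w w' : List Bool) : Prop := c.WellFormed w.length ∧ c.run w = w'

theorem Computes.append {c d : Circuit} {w w' w'' : List Bool} (h : Computes c w w')
    (h' : Computes d w' w'') : Computes (c ++ d) w w'' := by
  obtain ⟨h₁, rfl⟩ := h
  refine ⟨Circuit.wellFormed_append.2 ⟨h₁, ?_⟩, by rw [Circuit.run_append, h'.2]⟩
  rw [← Circuit.length_run]
  exact h'.1

namespace Op

variable {I : LineInstance}

theorem map_length_eval {B : List (List Bool)} {o : Op}
    (h : o.Ok I (B.map List.length)) :
    (o.eval I B).map List.length = o.layout I (B.map List.length) := by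
  have e : ∀ i, level (B.map List.length) i 0 = (level B i []).length :=
    fun i => level_map List.length B i []
  cases o with
  | bin b i j =>
    obtain ⟨-, -, h⟩ := h
    rw [e, e] at h
    simp [eval, layout, e, h]
  | neg i => simp [eval, layout, e]
  | flip m i =>
    obtain ⟨-, h⟩ := h
    rw [e] at h
    simp [eval, layout, e, h]
  | red b i => simp [eval, layout, e]
  | bcast i j => simp [eval, layout, e]
  | call p =>
    obtain _ | ⟨X, B⟩ := B
    · simp [Ok] at h
    have h : X.length = I.n := by simpa [Ok] using h
    simp [eval, layout, Circuit.output, Circuit.length_run, h]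

theorem computes (hI : ∀ p, (I.circuit p).WellFormed I.n) {B : List (List Bool)} {o : Op}
    (h : o.Ok I (B.map List.length)) :
    Computes (o.compile I (B.map List.length)) B.flatten (o.eval I B).flatten := by
  have e : ∀ i, level (B.map List.length) i 0 = (level B i []).length :=
    fun i => level_map List.length B i []
  -- For an empty block `lastWire` has no meaning, but then no gate is produced; the range condition
  -- is only needed for `X ≠ []`.
  have hr : ∀ (X : List Bool) (g : Gate), (X ≠ [] → g.InRange B.flatten.length) →
      Circuit.WellFormed (List.replicate X.length g) B.flatten.length := by
    intro X g hg
    refine Circuit.wellFormed_of_forall fun g' hg' => ?_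
    obtain ⟨h₁, rfl⟩ := List.mem_replicate.1 hg'
    exact hg fun hX => h₁ (by rw [hX]; rfl)
  cases o with
  | bin b i j =>
    obtain ⟨hi, hj, h⟩ := h
    rw [List.length_map] at hi hj
    rw [e, e] at h
    have hi := isBlock_level B hi
    have hj := isBlock_level B hj
    rw [compile, e]
    refine ⟨hr _ _ fun hX => Gate.inRange_bin (hi.lt hX) (hj.lt ?_), hi.run_bin hj h b⟩
    rw [← List.length_pos_iff] at hX ⊢
    omega
  | neg i =>
    have hi := isBlock_level B (by simpa [Ok] using h)
    rw [compile, e]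
    refine ⟨hr _ _ fun hX => hi.lt hX, ?_⟩
    -- Negating a block is flipping it with the mask that consists of ones.
    have := hi.run_flip (m := List.replicate (level B i []).length true) (by simp)
    rw [List.map_replicate, List.reverse_replicate, if_pos rfl] at this
    rw [this, eval, List.flatten_cons]
    congr 1
    generalize level B i [] = X
    induction X with
    | nil => rfl
    | cons x X ih => simp [List.replicate_succ, ih]
  | flip m i =>
    obtain ⟨hi, h⟩ := h
    rw [e] at h
    have hi := isBlock_level B (by simpa using hi)
    refine ⟨Circuit.wellFormed_of_forall fun g hg => ?_, hi.run_flip h⟩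
    obtain ⟨y, hy, rfl⟩ := List.mem_map.1 (List.mem_reverse.1 hg)
    have := hi.lt (by rintro hX; rw [hX] at h; simp [List.eq_nil_of_length_eq_zero h.symm] at hy)
    split_ifs
    · exact this
    · exact ⟨this, this⟩
  | red b i =>
    have hi := isBlock_level B (by simpa [Ok] using h)
    rw [compile, e]
    refine ⟨⟨trivial, Circuit.wellFormed_of_forall fun g hg => ?_⟩, ?_⟩
    · obtain ⟨h₁, rfl⟩ := List.mem_replicate.1 hg
      have := hi.lt fun hX => h₁ (by rw [hX]; rfl)
      exact Gate.inRange_bin (by omega) (by omega)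
    · rw [hi.run_red, eval]
      cases level B i [] <;> simp
  | bcast i j =>
    obtain ⟨hi, -, h⟩ := h
    rw [e] at h
    have hi := isBlock_level B (by simpa using hi)
    obtain ⟨x, hx⟩ := List.length_eq_one_iff.1 h
    rw [hx] at hi
    rw [compile, e]
    refine ⟨wellFormed_replicate_and (hi.lt (by simp)), ?_⟩
    have := hi.getD (v := []) rfl
    rw [List.nil_append] at this
    rw [Circuit.run, Gate.eval, this, Bool.and_self, run_replicate_and, eval, hx]
    rfl
  | call p =>
    obtain _ | ⟨X, B⟩ := B
    · simp [Ok] at h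
    have h : X.length = I.n := by simpa [Ok] using h
    have hw := hI p
    rw [← h] at hw
    rw [compile, List.flatten_cons]
    refine ⟨hw.mono (by simp), ?_⟩
    rw [Circuit.run_append_right hw, eval]
    simp only [Circuit.output, List.headD_cons, List.tail_cons, List.flatten_cons]
    rw [← List.append_assoc, List.take_append_drop]

/-- The circuit of a program. -/
def compileAll (I : LineInstance) : List Op → List ℕ → Circuit
  | [], _ => []
  | o :: l, L => o.compile I L ++ compileAll I l (o.layout I L)

/-- The program makes sense for blocks of the given sizes. -/
def AllOk (I : LineInstance) : List Op → List ℕ → Prop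
  | [], _ => True
  | o :: l, L => o.Ok I L ∧ AllOk I l (o.layout I L)

theorem computes_all (hI : ∀ p, (I.circuit p).WellFormed I.n) {l : List Op} {B : List (List Bool)}
    (h : AllOk I l (B.map List.length)) :
    Computes (compileAll I l (B.map List.length)) B.flatten (l.foldl (eval I) B).flatten := by
  induction l generalizing B with
  | nil => exact ⟨trivial, rfl⟩
  | cons o l ih =>
    have e := map_length_eval h.1
    refine (computes hI h.1).append ?_
    rw [← e]
    exact ih (e ▸ h.2)

end Op

/-! ### Programs are compiled in polynomial time -/

namespace PT

variable {α : Type} [Enc α]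

theorem pred {f : α → ℕ} (hf : PT f) : PT fun a => f a - 1 := by
  have : PT fun n : ℕ => n - 1 := by
    refine of_transduce false (fun _ _ => true) (fun q _ => if q then [()] else [])
      (fun _ => []) fun n => ?_
    change List.replicate (n - 1) () = transduce _ _ _ _ (List.replicate n ())
    have h : ∀ n, transduce (fun _ _ => true) (fun q _ => if q then [()] else []) (fun _ => [])
        true (List.replicate n ()) = List.replicate n () := by
      intro n
      induction n with
      | zero => rfl
      | succ n ih => rw [List.replicate_succ, transduce, ih]; rfl
    cases n with
    | zero => rfl
    | succ n => exact (h n).symm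
  exact this.comp hf

theorem level {L : List (α → ℕ)} (hL : ∀ f ∈ L, PT f) (i : ℕ) :
    PT fun a => SearchClasses.level (L.map (· a)) i 0 := by
  have h : PT (SearchClasses.level L i fun _ => 0) := by
    rw [SearchClasses.level, List.getD_eq_getElem?_getD]
    cases h : L[L.length - 1 - i]? with
    | none => exact const 0
    | some f => exact hL f (List.mem_of_getElem? h)
  convert h using 2 with a
  exact level_map (· a) L i fun _ => 0

theorem sum {L : List (α → ℕ)} (hL : ∀ f ∈ L, PT f) : PT fun a => (L.map (· a)).sum := by
  induction L with
  | nil => exact const 0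
  | cons f L ih => exact (hL f (by simp)).add (ih fun g hg => hL g (by simp [hg]))

theorem lastWire {L : List (α → ℕ)} (hL : ∀ f ∈ L, PT f) (i : ℕ) :
    PT fun a => SearchClasses.lastWire (L.map (· a)) i := by
  refine pred (.add ?_ (level hL i))
  simp only [depth, ← List.map_take, List.length_map]
  exact sum fun f hf => hL f (List.mem_of_mem_take hf)

theorem circuit_cons {g : α → Gate} {c : α → Circuit} (hg : PT fun a => ([g a] : Circuit))
    (hc : PT c) : PT fun a => (g a :: c a : Circuit) :=
  circuit_append hg hc

theorem bin_gate (b : Bool) {i j : α → ℕ} (hi : PT i) (hj : PT j) :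
    PT fun a => ([Gate.bin b (i a) (j a)] : Circuit) := by
  cases b
  exacts [or_gate hi hj, and_gate hi hj]

variable {I : α → LineInstance}

theorem circuit (hS : PT fun a => (I a).S) (hP : PT fun a => (I a).P) (p : Bool) :
    PT fun a => (I a).circuit p := by
  cases p
  exacts [hS, hP]

/-- The operation and its heights are fixed, and only the block sizes vary with the instance. They
are given as a list of polynomial-time functions, so the recursion over heights and programs takes
place outside the machine. -/
theorem compile (hS : PT fun a => (I a).S) (hP : PT fun a => (I a).P) {L : List (α → ℕ)}
    (hL : ∀ f ∈ L, PT f) (o : Op) : PT fun a => o.compile (I a) (L.map (· a)) := by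
  cases o with
  | bin b i j => exact circuit_replicate (level hL i) (bin_gate b (lastWire hL i) (lastWire hL j))
  | neg i => exact circuit_replicate (level hL i) (not_gate (lastWire hL i))
  | flip m i =>
    induction m with
    | nil => exact const ([] : Circuit)
    | cons y m ih =>
      simp only [Op.compile, List.map_cons, List.reverse_cons] at ih ⊢
      refine circuit_append ih ?_
      cases y
      · exact and_gate (lastWire hL i) (lastWire hL i)
      · exact not_gate (lastWire hL i)
  | red b i =>
    exact circuit_cons (const ([.const b] : Circuit)) (circuit_replicate (level hL i)
      (bin_gate b ((lastWire hL i).add (const 1)) (const 0)))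
  | bcast i j =>
    exact circuit_cons (and_gate (lastWire hL i) (lastWire hL i))
      (circuit_replicate (level hL j) (and_gate (const 0) (const 0)))
  | call p => exact circuit hS hP p

theorem layout (hn : PT fun a => (I a).n) (hS : PT fun a => (I a).S) (hP : PT fun a => (I a).P)
    {L : List (α → ℕ)} (hL : ∀ f ∈ L, PT f) (o : Op) :
    ∃ L' : List (α → ℕ), (∀ f ∈ L', PT f) ∧
      ∀ a, o.layout (I a) (L.map (· a)) = L'.map (· a) := by
  have h₁ : ∀ i, ∀ f ∈ (fun a => SearchClasses.level (L.map (· a)) i 0) :: L, PT f := by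
    rintro i f (_ | ⟨_, hf⟩)
    exacts [level hL i, hL f hf]
  cases o with
  | bin b i j => exact ⟨_, h₁ i, fun _ => rfl⟩
  | neg i => exact ⟨_, h₁ i, fun _ => rfl⟩
  | flip m i => exact ⟨_, h₁ i, fun _ => rfl⟩
  | red b i =>
    refine ⟨(fun _ => 1) :: _ :: L, ?_, fun _ => rfl⟩
    rintro f (_ | ⟨_, hf⟩)
    exacts [const 1, h₁ i f hf]
  | bcast i j =>
    refine ⟨_ :: (fun _ => 1) :: L, ?_, fun _ => rfl⟩
    rintro f (_ | ⟨_, _ | ⟨_, hf⟩⟩)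
    exacts [level hL j, const 1, hL f hf]
  | call p =>
    refine ⟨(fun a => (I a).n) :: (fun a => ((I a).circuit p).length) :: L.tail, ?_, fun a => by
      simp [Op.layout]⟩
    rintro f (_ | ⟨_, _ | ⟨_, hf⟩⟩)
    exacts [hn, circuit_length (circuit hS hP p), hL f (List.mem_of_mem_tail hf)]

theorem compileAll (hn : PT fun a => (I a).n) (hS : PT fun a => (I a).S)
    (hP : PT fun a => (I a).P) {L : List (α → ℕ)} (hL : ∀ f ∈ L, PT f) (l : List Op) :
    PT fun a => Op.compileAll (I a) l (L.map (· a)) := by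
  induction l generalizing L with
  | nil => exact const ([] : Circuit)
  | cons o l ih =>
    obtain ⟨L', hL', e⟩ := layout hn hS hP hL o
    simp only [Op.compileAll, e]
    exact circuit_append (compile hS hP hL o) (ih hL')

end PT

end SearchClasses

namespace SearchClasses

open Enc (enc Sym)

/-! ### The neighbours in the bipartite graph -/

namespace LineInstance

variable (I : LineInstance)

/-- Whether the vertex `(b, e, x)` has full degree. -/
def full (b : Bool) (e x : List Bool) : Bool :=
  e.any id || if b then decide (I.pred (I.succ x) = x) else
    decide (I.succ (I.pred x) = x) || (!x.any id && (I.pred x).any id)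

/-- The last part of the neighbour of `(b, e, x)` that differs from it only in the last part and
in the first bit. -/
def partner (b : Bool) (e x : List Bool) : List Bool :=
  if e.any id then x else if b then I.succ x else I.pred x

/-- The list of potential neighbours of `(b, e, x)`. -/
def entries (b : Bool) (e x : List Bool) : List (List Bool) :=
  (xor b (I.full b e x) :: (e ++ I.partner b e x)) ::
    (List.range e.length).map fun j =>
      (!b) :: (List.zipWith xor ((List.range e.length).map fun i => decide (i = j)) e ++ x)

end LineInstance

/-! ### The circuit -/

/-- Comparison of two blocks, on a stack of height `m`. The result has height `m + 5`. -/
def eqOps (i j m : ℕ) : List Op :=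
  [.bin true i j, .bin false i j, .neg (m + 1), .bin false m (m + 2), .red true (m + 3)]

/-- Compute the first bit (at height `42`) and the last part (at height `56`) of the first entry,
and the opposite of the first bit (at height `33`). -/
def mainOps : List Op :=
  -- On the stack `[p, s, [b], e, x]` the heights `0`, `1`, `2` are `x`, `e`, `b`. A call consumes
  -- the top block, so its argument is copied first, by conjunction with itself. Heights `6`, `8`,
  -- `10`, `12` become `S x`, `P (S x)`, `P x`, `S (P x)`.
  [.bin true 0 0, .call false, .bin true 6 6, .call true,
    .bin true 0 0, .call true, .bin true 10 10, .call false] ++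
  eqOps 8 0 13 ++ eqOps 12 0 19 ++
  -- Heights `18` and `24` hold the comparisons of `P (S x)` and `S (P x)` with `x`, and `30` says
  -- that `x = 0` and `P x ≠ 0`. Height `35` selects the condition for `b`, `37` says `e ≠ 0`, and
  -- `38` is `full`; the exclusive or with `b` ends at `42`.
  [.red false 0, .neg 26, .red false 10, .bin true 27 29, .bin false 24 30,
    .bin true 2 18, .neg 2, .bin true 33 31, .bin false 32 34,
    .red false 1, .bin false 37 35,
    .bin false 2 38, .bin true 2 38, .neg 40, .bin true 39 41,
    -- The bits at `37`, `44`, `45` mean `e ≠ 0`, `e = 0` with `b = 1`, and `e = 0` with `b = 0`.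
    -- Exactly one of them is on; they mask `x`, `S x` and `P x`, and the disjunction of the three
    -- words is the partner.
    .neg 37, .bin true 43 2, .bin true 43 33,
    .bcast 37 0, .bin true 47 0, .bcast 44 0, .bin true 50 6, .bcast 45 0, .bin true 53 10,
    .bin false 51 54, .bin false 48 55]

/-- Push an entry other than the first one. -/
def entryOps (t j : ℕ) : List Op :=
  [.bin true 0 0, .flip ((List.range t).map fun i => decide (i = j)) 1, .bin true 33 33]

/-- Compute all entries. -/
def allOps (t : ℕ) : List Op :=
  -- The block pushed last is read first, so the list of entries is produced from its end.
  mainOps ++ ((List.range t).reverse.flatMap (entryOps t) ++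
    [.bin true 56 56, .bin true 1 1, .bin true 42 42])

theorem allOk_mainOps (I : LineInstance) (p s t : ℕ) :
    Op.AllOk I mainOps [p, s, 1, t, I.n] := by
  simp [mainOps, eqOps, Op.AllOk, Op.Ok, Op.layout, level]

/-- The bit that compares two words, as a circuit computes it. -/
def eqBit (X Y : List Bool) : Bool :=
  (List.zipWith (binOp false) (List.zipWith (binOp true) X Y)
    ((List.zipWith (binOp false) X Y).map not)).foldr (binOp true) true

/-- The bit `full`, as a circuit computes it. -/
def fullBit (b : Bool) (e x u v w : List Bool) : Bool :=
  binOp false (e.foldr (binOp false) false)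
    (binOp false (binOp true b (eqBit u x))
      (binOp true (!b) (binOp false (eqBit v x)
        (binOp true (!x.foldr (binOp false) false) (w.foldr (binOp false) false)))))

/-- The word `partner`, as a circuit computes it. -/
def partnerBits (b : Bool) (e x u v : List Bool) : List Bool :=
  List.zipWith (binOp false)
    (List.zipWith (binOp true) (List.replicate x.length (e.foldr (binOp false) false)) x)
    (List.zipWith (binOp false)
      (List.zipWith (binOp true)
        (List.replicate x.length (binOp true (!e.foldr (binOp false) false) b)) u)
      (List.zipWith (binOp true)
        (List.replicate x.length (binOp true (!e.foldr (binOp false) false) (!b))) v))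

theorem zipWith_and_self (X : List Bool) : List.zipWith (binOp true) X X = X := by
  simp [List.zipWith_self, binOp]

theorem foldr_or (X : List Bool) : X.foldr (binOp false) false = X.any id := by
  induction X with
  | nil => rfl
  | cons x X ih => rw [List.foldr_cons, ih]; rfl

theorem eqBit_eq {X Y : List Bool} (h : X.length = Y.length) : eqBit X Y = decide (X = Y) := by
  induction X generalizing Y with
  | nil =>
    obtain rfl : Y = [] := by simpa using h.symm
    rfl
  | cons x X ih =>
    obtain _ | ⟨y, Y⟩ := Y
    · simp at h
    have e : eqBit (x :: X) (y :: Y) =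
      binOp true (binOp false (binOp true x y) (!binOp false x y)) (eqBit X Y) := rfl
    rw [e, ih (by simpa using h)]
    cases x <;> cases y <;> simp [binOp]

theorem any_eq_false_iff {X : List Bool} : X.any id = false ↔ X = zeros X.length := by
  simp [zeros, List.eq_replicate_iff]

/-! ### The values left by the main program -/

section

variable (I : LineInstance) (p s e x : List Bool) (b : Bool)

theorem length_foldl_mainOps : (mainOps.foldl (Op.eval I) [p, s, [b], e, x]).length = 57 := rfl

theorem level_x_foldl_mainOps :
    level (mainOps.foldl (Op.eval I) [p, s, [b], e, x]) 0 [] = x := rfl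

theorem level_e_foldl_mainOps :
    level (mainOps.foldl (Op.eval I) [p, s, [b], e, x]) 1 [] = e := rfl

theorem level_not_foldl_mainOps :
    level (mainOps.foldl (Op.eval I) [p, s, [b], e, x]) 33 [] = [!b] := rfl

variable {I e x}

theorem LineInstance.length_succ (h : x.length = I.n) : (I.succ x).length = I.n := by
  simp [succ, Circuit.output, Circuit.length_run, h]

theorem LineInstance.length_pred (h : x.length = I.n) : (I.pred x).length = I.n := by
  simp [pred, Circuit.output, Circuit.length_run, h]

theorem LineInstance.length_partner (h : x.length = I.n) : (I.partner b e x).length = I.n := by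
  rw [partner]
  split_ifs
  exacts [h, length_succ h, length_pred h]

theorem level_bit_foldl_mainOps (hx : x.length = I.n) :
    level (mainOps.foldl (Op.eval I) [p, s, [b], e, x]) 42 [] = [xor b (I.full b e x)] := by
  -- The program can be evaluated symbolically by `rfl`, except that a copied block appears as its
  -- conjunction with itself. Abstracting the copy as `cp` keeps the term small until
  -- `zipWith_and_self` removes it.
  have : level (mainOps.foldl (Op.eval I) [p, s, [b], e, x]) 42 [] =
    (fun f => [binOp true (binOp false b f) (!binOp true b f)])
      ((fun cp : List Bool → List Bool => fullBit b e x (I.pred (cp (I.succ (cp x))))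
        (I.succ (cp (I.pred (cp x)))) (I.pred (cp x))) fun X => List.zipWith (binOp true) X X) := rfl
  rw [this]
  simp only [zipWith_and_self, fullBit, foldr_or]
  rw [eqBit_eq, eqBit_eq, LineInstance.full]
  · cases e.any id <;> cases b <;> simp [binOp]
  all_goals simp [LineInstance.length_succ, LineInstance.length_pred, hx]

theorem zipWith_or_replicate {X : List Bool} {n : ℕ} (h : X.length = n) :
    List.zipWith (binOp false) (List.replicate n false) X = X := by
  subst h
  induction X with
  | nil => rfl
  | cons x X ih => rw [List.length_cons, List.replicate_succ, List.zipWith_cons_cons, ih]; rfl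

theorem zipWith_replicate_or {X : List Bool} {n : ℕ} (h : X.length = n) :
    List.zipWith (binOp false) X (List.replicate n false) = X := by
  rw [List.zipWith_comm_of_comm, zipWith_or_replicate h]
  intro x y
  cases x <;> cases y <;> rfl

theorem zipWith_and_replicate (a : Bool) {X : List Bool} {n : ℕ} (h : X.length = n) :
    List.zipWith (binOp true) (List.replicate n a) X = if a then X else List.replicate n false := by
  subst h
  induction X with
  | nil => cases a <;> rfl
  | cons x X ih =>
    rw [List.length_cons, List.replicate_succ, List.zipWith_cons_cons, ih]
    cases a <;> rfl

theorem level_word_foldl_mainOps (hx : x.length = I.n) :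
    level (mainOps.foldl (Op.eval I) [p, s, [b], e, x]) 56 [] = I.partner b e x := by
  have : level (mainOps.foldl (Op.eval I) [p, s, [b], e, x]) 56 [] =
      (fun cp : List Bool → List Bool => partnerBits b e x (I.succ (cp x)) (I.pred (cp x)))
        fun X => List.zipWith (binOp true) X X := rfl
  rw [this]
  simp only [zipWith_and_self, partnerBits, foldr_or, hx]
  have hs := LineInstance.length_succ hx
  have hp := LineInstance.length_pred hx
  rw [zipWith_and_replicate _ hx, zipWith_and_replicate _ hs, zipWith_and_replicate _ hp,
    LineInstance.partner]
  cases e.any id <;> cases b <;>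
    simp [binOp, hx, hs, hp, zipWith_or_replicate, zipWith_replicate_or]

end

/-! ### The remaining entries -/

theorem foldl_entryOps (I : LineInstance) {B : List (List Bool)} (hB : 57 ≤ B.length) (t j : ℕ) :
    (entryOps t j).foldl (Op.eval I) B =
      [level B 33 [], List.zipWith xor ((List.range t).map fun i => decide (i = j)) (level B 1 []),
        level B 0 []] ++ B := by
  have h : ∀ (A : List (List Bool)) (i : ℕ), i ≤ 33 → level (A ++ B) i [] = level B i [] :=
    fun A i hi => level_append A B (by omega) []
  have h₁ := h [level B 0 []] 1 (by omega)
  have h₂ := h [List.zipWith xor ((List.range t).map fun i => decide (i = j)) (level B 1 []),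
    level B 0 []] 33 (by omega)
  simp only [List.cons_append, List.nil_append] at h₁ h₂
  simp only [entryOps, List.foldl_cons, List.foldl_nil, Op.eval, zipWith_and_self, h₁, h₂,
    List.cons_append, List.nil_append]

theorem foldl_flatMap_entryOps (I : LineInstance) {B : List (List Bool)} (hB : 57 ≤ B.length)
    (t : ℕ) (l : List ℕ) :
    (l.flatMap (entryOps t)).foldl (Op.eval I) B = (l.reverse.flatMap fun j =>
      [level B 33 [], List.zipWith xor ((List.range t).map fun i => decide (i = j)) (level B 1 []),
        level B 0 []]) ++ B := by
  induction l generalizing B with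
  | nil => rfl
  | cons j l ih =>
    rw [List.flatMap_cons, List.foldl_append, foldl_entryOps I hB, ih (by simp; omega),
      level_append _ _ (by omega), level_append _ _ (by omega), level_append _ _ (by omega)]
    simp

theorem Op.allOk_append (I : LineInstance) (l l' : List Op) (L : List ℕ) :
    Op.AllOk I (l ++ l') L ↔ Op.AllOk I l L ∧ Op.AllOk I l' (l.foldl (Op.layout I) L) := by
  induction l generalizing L with
  | nil => simp [Op.AllOk]
  | cons o l ih => rw [List.cons_append, Op.AllOk, ih, Op.AllOk, and_assoc, List.foldl_cons]

theorem allOk_entryOps (I : LineInstance) {L : List ℕ} (hL : 57 ≤ L.length) {t : ℕ}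
    (ht : level L 1 0 = t) (l : List ℕ) :
    Op.AllOk I (l.flatMap (entryOps t) ++ [.bin true 56 56, .bin true 1 1, .bin true 42 42]) L := by
  induction l generalizing L with
  | nil =>
    refine ⟨⟨?_, ?_, rfl⟩, ⟨?_, ?_, rfl⟩, ⟨?_, ?_, rfl⟩, trivial⟩ <;>
      first | omega | (simp only [Op.layout, List.length_cons]; omega)
  | cons j l ih =>
    rw [List.flatMap_cons, List.append_assoc, Op.allOk_append]
    have h : ∀ (A : List ℕ), level (A ++ L) 1 0 = t :=
      fun A => (level_append A L (by omega) 0).trans ht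
    refine ⟨⟨⟨?_, ?_, rfl⟩, ⟨?_, ?_⟩, ⟨?_, ?_, rfl⟩, trivial⟩, ih ?_ (h [_, _, _])⟩
    · omega
    · omega
    · simp [Op.layout]; omega
    · rw [List.length_map, List.length_range]
      exact h [_]
    · simp [Op.layout]; omega
    · simp [Op.layout]; omega
    · simp [entryOps, Op.layout]; omega

theorem allOk_allOps (I : LineInstance) (p s t : ℕ) :
    Op.AllOk I (allOps t) [p, s, 1, t, I.n] := by
  rw [allOps, Op.allOk_append]
  exact ⟨allOk_mainOps I p s t, allOk_entryOps (L := mainOps.foldl (Op.layout I) [p, s, 1, t, I.n]) I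
    (le_of_eq rfl) rfl _⟩

/-- The entries lie on top; the remainder `r` is cut off when the last `k * (n + 1)` wires are taken
as output. -/
theorem flatten_foldl_allOps (I : LineInstance) (p s : List Bool) (b : Bool) {e x : List Bool}
    (hx : x.length = I.n) : ∃ r, ((allOps e.length).foldl (Op.eval I) [p, s, [b], e, x]).flatten =
      (I.entries b e x).flatten ++ r := by
  refine ⟨(mainOps.foldl (Op.eval I) [p, s, [b], e, x]).flatten, ?_⟩
  have h₅₇ := length_foldl_mainOps I p s e x b
  rw [allOps, List.foldl_append, List.foldl_append, foldl_flatMap_entryOps I h₅₇.ge,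
    level_not_foldl_mainOps, level_e_foldl_mainOps, level_x_foldl_mainOps, List.reverse_reverse]
  have h₁ := level_word_foldl_mainOps p s (e := e) b hx
  have h₂ := level_e_foldl_mainOps I p s e x b
  have h₃ := level_bit_foldl_mainOps p s (e := e) b hx
  revert h₅₇ h₁ h₂ h₃
  generalize mainOps.foldl (Op.eval I) [p, s, [b], e, x] = B
  intro h₅₇ h₁ h₂ h₃
  have h : ∀ (A : List (List Bool)) (i : ℕ), i ≤ 56 → level (A ++ B) i [] = level B i [] :=
    fun A i hi => level_append A B (by omega) []
  generalize hA : List.flatMap _ _ = A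
  have h₁' := h A 56 (by omega)
  have h₂' := h (I.partner b e x :: A) 1 (by omega)
  have h₃' := h (e :: I.partner b e x :: A) 42 (by omega)
  simp only [List.cons_append] at h₂' h₃'
  simp only [List.foldl_cons, List.foldl_nil, Op.eval, zipWith_and_self, h₁', h₁, h₂', h₂, h₃', h₃,
    LineInstance.entries, List.flatten_cons, List.flatten_append]
  have hg : ∀ (g : ℕ → List Bool) (l : List ℕ),
      (l.flatMap fun j => [[!b], g j, x]).flatten = (l.map fun j => (!b) :: (g j ++ x)).flatten := by
    intro g l
    induction l with
    | nil => rfl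
    | cons j l ih => simp [ih]
  rw [← hA, hg]
  simp

end SearchClasses

/-! ### Degrees, edges and solutions of the bipartite graph -/

namespace SearchClasses

open Enc (enc Sym)

theorem take_drop_flatten {L : List (List Bool)} {m : ℕ} (h : ∀ X ∈ L, X.length = m)
    (r : List Bool) {i : ℕ} (hi : i < L.length) :
    (((L.flatten ++ r).drop (i * m)).take m) = L[i] := by
  induction L generalizing i with
  | nil => simp at hi
  | cons X L ih =>
    have hX := h X (by simp)
    cases i with
    | zero => simp [← hX]
    | succ i =>
      have e : (i + 1) * m = X.length + i * m := by rw [hX]; ring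
      rw [List.flatten_cons, List.append_assoc, e, ← List.drop_drop, List.drop_left,
        ih (fun Y hY => h Y (by simp [hY])) (by simpa using hi), List.getElem_cons_succ]

/-- The unit vectors. -/
def unitVec (t j : ℕ) : List Bool := (List.range t).map fun i => decide (i = j)

theorem xor_unitVec {e : List Bool} {j i : ℕ} (hi : i < e.length) :
    (List.zipWith xor (unitVec e.length j) e)[i]? = some (xor (decide (i = j)) e[i]) := by
  rw [List.getElem?_zipWith]
  simp [unitVec, hi]

theorem xor_unitVec_injOn {e : List Bool} {j j' : ℕ} (hj : j < e.length)
    (h : List.zipWith xor (unitVec e.length j) e = List.zipWith xor (unitVec e.length j') e) :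
    j = j' := by
  have := congrArg (fun l => l[j]?) h
  simp only [xor_unitVec hj] at this
  by_contra hne
  simp [hne] at this

theorem xor_unitVec_ne {e : List Bool} {j : ℕ} (hj : j < e.length) :
    List.zipWith xor (unitVec e.length j) e ≠ e := by
  intro h
  have := congrArg (fun l => l[j]?) h
  simp [xor_unitVec hj, hj] at this

theorem length_xor_unitVec (e : List Bool) (j : ℕ) :
    (List.zipWith xor (unitVec e.length j) e).length = e.length := by
  simp [unitVec]

theorem zipWith_xor_cancel {m e : List Bool} (h : m.length = e.length) :
    List.zipWith xor m (List.zipWith xor m e) = e := by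
  induction m generalizing e with
  | nil => simpa using h.symm
  | cons a m ih =>
    obtain _ | ⟨b, e⟩ := e
    · simp at h
    · simp [ih (e := e) (by simpa using h)]

namespace LineInstance

variable {I : LineInstance} {b : Bool} {e x : List Bool}

theorem entries_eq (I : LineInstance) (b : Bool) (e x : List Bool) :
    I.entries b e x = (xor b (I.full b e x) :: (e ++ I.partner b e x)) ::
    (List.range e.length).map fun j =>
      (!b) :: (List.zipWith xor (unitVec e.length j) e ++ x) := rfl

theorem length_entries (I : LineInstance) (b : Bool) (e x : List Bool) :
    (I.entries b e x).length = e.length + 1 := by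
  simp [entries]

theorem length_of_mem_entries (hx : x.length = I.n) {v : List Bool} (hv : v ∈ I.entries b e x) :
    v.length = e.length + I.n + 1 := by
  rw [entries_eq, List.mem_cons, List.mem_map] at hv
  obtain rfl | ⟨j, -, rfl⟩ := hv
  · simp [length_partner b hx]
  · rw [List.length_cons, List.length_append, length_xor_unitVec, hx]

/-- Degrees are cardinalities of sets, so repetitions would be lost. There are none: the first entry
keeps `e`, and the others change it in different places. -/
theorem nodup_entries (I : LineInstance) (b : Bool) (e x : List Bool) :
    (I.entries b e x).Nodup := by
  rw [entries_eq, List.nodup_cons]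
  constructor
  · rw [List.mem_map]
    rintro ⟨j, hj, h⟩
    rw [List.cons.injEq] at h
    exact xor_unitVec_ne (List.mem_range.1 hj) (List.append_inj_left h.2 (length_xor_unitVec e j))
  · refine List.Nodup.map_on (fun j hj j' hj' h => ?_) List.nodup_range
    rw [List.cons.injEq] at h
    refine xor_unitVec_injOn (List.mem_range.1 hj) (List.append_inj_left h.2 ?_)
    rw [length_xor_unitVec, length_xor_unitVec]

/-- The instance of Bipartite-mod-`(t + 1)` that belongs to an instance of End-of-Line. -/
def toBipartite (t : ℕ) (I : LineInstance) : BipartiteInstance where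
  n := t + I.n
  C := I.S.map (Gate.shift (1 + t)) ++ (I.P.map (Gate.shift (1 + t + I.S.length)) ++
    Op.compileAll I (allOps t) [I.P.length, I.S.length, 1, t, I.n])

/-- This is the only purpose of the two shifted circuits. Inside the compiled program `S` and `P`
have more than `n` wires at their disposal, so its well-formedness would not give theirs. Shifting
by the number of all other wires leaves each of them exactly `n`. -/
theorem wellFormed_of_toBipartite {t : ℕ} (h : (I.toBipartite t).C.WellFormed (t + I.n + 1)) :
    ∀ p, (I.circuit p).WellFormed I.n := by
  rw [toBipartite, Circuit.wellFormed_append, Circuit.wellFormed_append,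
    show t + I.n + 1 = 1 + t + I.n by omega, Circuit.wellFormed_shift] at h
  obtain ⟨hS, hP, -⟩ := h
  rw [List.length_map, show 1 + t + I.n + I.S.length = 1 + t + I.S.length + I.n by omega,
    Circuit.wellFormed_shift] at hP
  rintro (_ | _)
  exacts [hS, hP]

theorem computes_toBipartite (hI : ∀ p, (I.circuit p).WellFormed I.n) (hx : x.length = I.n) :
    ∃ r, Computes (I.toBipartite e.length).C (b :: (e ++ x)) ((I.entries b e x).flatten ++ r) := by
  obtain ⟨s, hs, h₁⟩ := Circuit.exists_run_eq (I.S.map (Gate.shift (1 + e.length))) (b :: (e ++ x))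
  obtain ⟨p, hp, h₂⟩ := Circuit.exists_run_eq
    (I.P.map (Gate.shift (1 + e.length + I.S.length))) (s ++ b :: (e ++ x))
  rw [List.length_map] at hs hp
  obtain ⟨r, hr⟩ := flatten_foldl_allOps I p s b (e := e) hx
  have h₃ := Op.computes_all (I := I) hI (l := allOps e.length) (B := [p, s, [b], e, x])
    (by simpa [hx] using allOk_allOps I p.length s.length e.length)
  refine ⟨r, Computes.append ⟨?_, h₁⟩ (Computes.append ⟨?_, h₂⟩ ?_)⟩
  · rw [show (b :: (e ++ x)).length = 1 + e.length + I.n by simp [hx]; omega,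
      Circuit.wellFormed_shift]
    exact hI false
  · rw [show (s ++ b :: (e ++ x)).length = 1 + e.length + I.S.length + I.n by simp [hx, hs]; omega,
      Circuit.wellFormed_shift]
    exact hI true
  · rw [← hr]
    simpa [hs, hp, hx] using h₃

theorem entry_toBipartite (hI : ∀ p, (I.circuit p).WellFormed I.n) (hx : x.length = I.n) {i : ℕ}
    (hi : i < (I.entries b e x).length) :
    (I.toBipartite e.length).entry (e.length + 1) (b :: (e ++ x)) i = (I.entries b e x)[i] := by
  obtain ⟨r, -, hr⟩ := computes_toBipartite (b := b) (e := e) hI hx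
  have hl : ∀ v ∈ I.entries b e x, v.length = e.length + I.n + 1 :=
    fun v hv => length_of_mem_entries hx hv
  have hf : (I.entries b e x).flatten.length = (e.length + 1) * (e.length + I.n + 1) := by
    rw [List.length_flatten, List.map_congr_left hl]
    simp [length_entries]
  rw [BipartiteInstance.entry, Circuit.output, hr]
  change ((List.take ((e.length + 1) * (e.length + I.n + 1)) _).drop _).take _ = _
  rw [← hf, List.take_left]
  rw [← take_drop_flatten hl [] hi, List.append_nil]
  rfl

theorem nbrs_toBipartite (hI : ∀ p, (I.circuit p).WellFormed I.n) (hx : x.length = I.n) :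
    (I.toBipartite e.length).nbrs (e.length + 1) (b :: (e ++ x)) =
      ((I.entries b e x).filter fun v => v.head? ≠ some b).toFinset := by
  ext v
  rw [BipartiteInstance.nbrs, Finset.mem_filter, Finset.mem_image, List.mem_toFinset,
    List.mem_filter, List.mem_iff_getElem]
  refine and_congr ⟨?_, ?_⟩ (by simp)
  · rintro ⟨i, hi, rfl⟩
    have hi : i < (I.entries b e x).length := by simpa [length_entries] using hi
    exact ⟨i, hi, (entry_toBipartite hI hx hi).symm⟩
  · rintro ⟨i, hi, rfl⟩
    exact ⟨i, by simpa [length_entries] using hi, entry_toBipartite hI hx hi⟩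

/-- The `t` entries with a changed bit of `e` always lie on the other side. The first bit of the
remaining entry is `xor b (I.full b e x)`, so that one counts exactly when `full` holds. -/
theorem card_nbrs_toBipartite (hI : ∀ p, (I.circuit p).WellFormed I.n) (hx : x.length = I.n) :
    ((I.toBipartite e.length).nbrs (e.length + 1) (b :: (e ++ x))).card =
      if I.full b e x then e.length + 1 else e.length := by
  rw [nbrs_toBipartite hI hx, List.toFinset_card_of_nodup ((nodup_entries I b e x).filter _),
    entries_eq, List.filter_cons]
  have h : ∀ l : List ℕ, (l.map fun j =>
      (!b) :: (List.zipWith xor (unitVec e.length j) e ++ x)).filter (fun v => v.head? ≠ some b) =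
      l.map fun j => (!b) :: (List.zipWith xor (unitVec e.length j) e ++ x) := by
    intro l
    rw [List.filter_eq_self]
    intro v hv
    obtain ⟨j, -, rfl⟩ := List.mem_map.1 hv
    simp
  rw [h]
  cases I.full b e x <;> simp

variable {t : ℕ} {b' : Bool} {e' x' : List Bool}

theorem mem_nbrs_toBipartite (hI : ∀ p, (I.circuit p).WellFormed I.n) (hx : x.length = I.n)
    (he : e.length = t) (he' : e'.length = t) :
    b' :: (e' ++ x') ∈ (I.toBipartite t).nbrs (t + 1) (b :: (e ++ x)) ↔
      b' = (!b) ∧ ((I.full b e x = true ∧ e' = e ∧ x' = I.partner b e x) ∨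
        ∃ j < t, e' = List.zipWith xor (unitVec t j) e ∧ x' = x) := by
  subst he
  rw [nbrs_toBipartite hI hx, List.mem_toFinset, List.mem_filter, entries_eq, List.mem_cons,
    List.mem_map, List.cons.injEq]
  have h₁ : e' ++ x' = e ++ I.partner b e x ↔ e' = e ∧ x' = I.partner b e x :=
    ⟨fun h => List.append_inj h he', fun h => by rw [h.1, h.2]⟩
  have h₂ : ∀ j, ((!b) :: (List.zipWith xor (unitVec e.length j) e ++ x) = b' :: (e' ++ x')) ↔
      b' = (!b) ∧ e' = List.zipWith xor (unitVec e.length j) e ∧ x' = x := by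
    intro j
    rw [List.cons.injEq]
    refine and_congr eq_comm ⟨fun h => ?_, fun h => by rw [h.1, h.2]⟩
    have := List.append_inj h (by rw [length_xor_unitVec, he'])
    exact ⟨this.1.symm, this.2.symm⟩
  simp only [h₁, h₂, List.mem_range]
  cases b <;> cases b' <;> cases I.full _ e x <;> simp

/-- If `P (S x) = x` and `y = S x`, then `S (P y) = y` and the partner of `y` is `x`; the other
direction is alike. For `e ≠ 0` the partner is `x` on both sides, and changing a bit of `e` is an
involution. -/
theorem symm_nbrs_toBipartite (hI : ∀ p, (I.circuit p).WellFormed I.n)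
    (h₀ : I.pred (zeros I.n) = zeros I.n) (hx : x.length = I.n) (hx' : x'.length = I.n)
    (he : e.length = t) (he' : e'.length = t)
    (h : b' :: (e' ++ x') ∈ (I.toBipartite t).nbrs (t + 1) (b :: (e ++ x))) :
    b :: (e ++ x) ∈ (I.toBipartite t).nbrs (t + 1) (b' :: (e' ++ x')) := by
  rw [mem_nbrs_toBipartite hI hx he he'] at h
  rw [mem_nbrs_toBipartite hI hx' he' he]
  obtain ⟨rfl, ⟨hf, rfl, rfl⟩ | ⟨j, hj, rfl, rfl⟩⟩ := h
  · refine ⟨by simp, .inl ⟨?_, rfl, ?_⟩⟩ <;> rw [full] at hf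
    all_goals
      cases ha : e'.any id
      · rw [ha] at hf
        cases b
        · have hp : I.succ (I.pred x) = x := by
            by_contra hne
            -- Only the clause `x = 0`, `P x ≠ 0` of `full` could break the symmetry, and `h₀`
            -- excludes it.
            have : x.any id = false ∧ (I.pred x).any id = true := by simpa [hne] using hf
            obtain ⟨h₁, h₂⟩ := this
            rw [any_eq_false_iff, hx] at h₁
            rw [h₁, h₀, any_eq_false_iff.2 (by simp [zeros])] at h₂
            simp at h₂
          simp [full, partner, ha, hp]
        · have hp : I.pred (I.succ x) = x := by simpa using hf
          simp [full, partner, ha, hp]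
      · simp [full, partner, ha]
  · refine ⟨by simp, .inr ⟨j, hj, ?_, rfl⟩⟩
    rw [zipWith_xor_cancel]
    simp [unitVec, he]

/-- The clause `x = 0`, `P x ≠ 0` in `full` is there for this equivalence. Without it, `P 0 ≠ 0`
together with `S (P 0) ≠ 0` would turn an invalid instance into a valid one. -/
theorem full_zeros : I.full false (zeros t) (zeros I.n) = false ↔
    I.pred (zeros I.n) = zeros I.n ∧ I.succ (I.pred (zeros I.n)) ≠ zeros I.n := by
  have h : ∀ n, (zeros n).any id = false := fun n => any_eq_false_iff.2 (by simp [zeros])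
  have hp := any_eq_false_iff (X := I.pred (zeros I.n))
  rw [length_pred (by simp [zeros])] at hp
  simp only [full, h, Bool.false_or, Bool.or_eq_false_iff, Bool.not_false, Bool.true_and, hp,
    decide_eq_false_iff_not, Bool.false_eq_true, if_false]
  exact and_comm

theorem zeros_succ_add (t n : ℕ) : zeros (t + n + 1) = false :: (zeros t ++ zeros n) := by
  rw [zeros, List.replicate_succ, List.replicate_add]; rfl

theorem hasType_of_circuit (hI : ∀ p, (I.circuit p).WellFormed I.n) :
    I.S.HasType I.n I.n ∧ I.P.HasType I.n I.n :=
  ⟨⟨hI false, Nat.le_add_right ..⟩, ⟨hI true, Nat.le_add_right ..⟩⟩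

theorem Valid.wellFormed (h : I.Valid) : ∀ p, (I.circuit p).WellFormed I.n := by
  rintro (_ | _)
  exacts [h.1.1, h.2.1.1]

/-- The direction from right to left makes invalid instances of Bipartite-mod arise only from
invalid ones, where the sole solution is `0`; the other direction makes the solutions of a valid
graph usable. -/
theorem valid_toBipartite (ht : 1 ≤ t) : (I.toBipartite t).Valid (t + 1) ↔ I.Valid := by
  have key : (∀ p, (I.circuit p).WellFormed I.n) →
      ((1 ≤ ((I.toBipartite t).nbrs (t + 1) (zeros (t + I.n + 1))).card ∧
        ((I.toBipartite t).nbrs (t + 1) (zeros (t + I.n + 1))).card < t + 1) ↔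
      I.pred (zeros I.n) = zeros I.n ∧ I.succ (zeros I.n) ≠ zeros I.n) := by
    intro hI
    have hc := card_nbrs_toBipartite (b := false) (e := zeros t) (x := zeros I.n) hI (by simp [zeros])
    rw [show (zeros t).length = t by simp [zeros], ← zeros_succ_add] at hc
    rw [hc]
    have hf := full_zeros (I := I) (t := t)
    trans I.full false (zeros t) (zeros I.n) = false
    -- The degree is `t` or `t + 1`. Only `t` is below `t + 1`, and `ht` makes it positive.
    · cases I.full false (zeros t) (zeros I.n) <;> simp [ht]
    · rw [hf]
      refine and_congr_right fun h => ?_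
      rw [h]
  constructor
  · rintro ⟨hT, hc⟩
    have hI := wellFormed_of_toBipartite hT.1
    exact ⟨(hasType_of_circuit hI).1, (hasType_of_circuit hI).2, (key hI).1 hc⟩
  · intro h
    have hI := h.wellFormed
    refine ⟨?_, (key hI).2 h.2.2⟩
    obtain ⟨r, hw, hr⟩ := computes_toBipartite (b := false) (e := zeros t) (x := zeros I.n) hI
      (by simp [zeros])
    have hl := congrArg List.length hr
    rw [show (zeros t).length = t by simp [zeros]] at hw hl
    rw [← zeros_succ_add] at hw hl
    rw [Circuit.length_run, List.length_append, List.length_flatten,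
      List.map_congr_left fun v hv => length_of_mem_entries (by simp [zeros]) hv] at hl
    simp only [List.map_const', List.sum_replicate, length_entries, zeros, List.length_replicate,
      smul_eq_mul] at hl hw
    refine ⟨hw, ?_⟩
    change (t + 1) * (t + I.n + 1) ≤ t + I.n + 1 + _
    omega

/-- The `t + 2` dropped bits are the tag of the solution, `b` and `e`. A wrong degree forces `e =
0`, and an inconsistent pair contradicts the symmetry of adjacency. -/
theorem solution_of_toBipartite (hv : I.Valid) {s : List Bool}
    (hs : (I.toBipartite t).Solution (t + 1) s) : I.Solution (s.drop (t + 2)) := by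
  have hI := hv.wellFormed
  obtain ⟨u, rfl, hu, hne, -, hk⟩ | ⟨x, y, -, hx, hy, h⟩ := hs
  · obtain _ | ⟨b, u⟩ := u
    · simp at hu
    have hu : u.length = t + I.n := Nat.succ_injective hu
    obtain ⟨e, x, rfl, rfl⟩ : ∃ e x, u = e ++ x ∧ e.length = t :=
      ⟨u.take t, u.drop t, (List.take_append_drop t u).symm, by simp [hu]⟩
    have hx : x.length = I.n := by simpa using hu
    rw [card_nbrs_toBipartite hI hx] at hk
    have hf : I.full b e x = false := by
      by_contra h
      exact hk (if_pos (by simpa using h))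
    rw [full, Bool.or_eq_false_iff] at hf
    obtain ⟨he, hf⟩ := hf
    have hd : (false :: b :: (e ++ x)).drop (e.length + 2) = x := by simp
    rw [hd]
    refine ⟨hx, ?_⟩
    cases b
    · have hf : I.succ (I.pred x) ≠ x := by
        intro h
        simp [h] at hf
      refine .inr ⟨hf, ?_⟩
      rintro rfl
      refine hne ?_
      rw [any_eq_false_iff] at he
      rw [he]
      simp only [toBipartite, zeros, List.length_replicate]
      exact (zeros_succ_add _ _).symm
    · exact .inl fun h => by simp [h] at hf
  · exfalso
    have split : ∀ u : List Bool, u.length = t + I.n →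
        ∃ e x, u = e ++ x ∧ e.length = t ∧ x.length = I.n := fun u hu =>
      ⟨u.take t, u.drop t, (List.take_append_drop t u).symm, by simp [hu], by simp [hu]⟩
    obtain ⟨e, x, rfl, he, hx⟩ := split x hx
    obtain ⟨e', y, rfl, he', hy⟩ := split y hy
    obtain ⟨h, h'⟩ | ⟨h, h'⟩ := h
    · exact h' (symm_nbrs_toBipartite hI hv.2.2.1 hx hy he he' h)
    · exact h' (symm_nbrs_toBipartite hI hv.2.2.1 hy hx he' he h)

end LineInstance

end SearchClasses

namespace SearchClasses

open Enc (enc Sym)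

/-! ### The reduction -/

namespace PT

variable {α : Type} [Enc α]

theorem toBipartite_C (t : ℕ) {I : α → LineInstance} (hn : PT fun a => (I a).n)
    (hS : PT fun a => (I a).S) (hP : PT fun a => (I a).P) :
    PT fun a => ((I a).toBipartite t).C := by
  have hL : ∀ f ∈ [fun a => (I a).P.length, fun a => (I a).S.length, fun _ => 1, fun _ => t,
      fun a => (I a).n], PT f := by
    simp only [List.forall_mem_cons]
    exact ⟨circuit_length hP, circuit_length hS, const 1, const t, hn, by simp⟩
  exact circuit_append (circuit_shift (const (1 + t)) hS)
    (circuit_append (circuit_shift ((const (1 + t)).add (circuit_length hS)) hP)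
      (compileAll hn hS hP hL (allOps t)))

theorem tail {f : α → List Bool} (hf : PT f) : PT fun a => (f a).tail := by
  have : PT fun l : List Bool => l.tail := by
    refine of_transduce false (fun _ _ => true) (fun q b => if q then [b] else [])
      (fun _ => []) fun l => ?_
    have h : ∀ l : List Bool, transduce (fun _ _ => true) (fun q b => if q then [b] else [])
        (fun _ => []) true l = l := by
      intro l
      induction l with
      | nil => rfl
      | cons b l ih => rw [transduce, ih]; rfl
    cases l with
    | nil => rfl
    | cons b l => exact (h l).symm
  exact this.comp hf

theorem drop {f : α → List Bool} (hf : PT f) (n : ℕ) : PT fun a => (f a).drop n := by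
  induction n with
  | zero => exact hf
  | succ n ih => simpa [List.tail_drop] using ih.tail

theorem isEmpty {f : α → List Bool} (hf : PT f) : PT fun a => (f a).isEmpty := by
  have : PT fun l : List Bool => l.isEmpty := by
    refine of_transduce true (fun _ _ => false) (fun _ _ => []) (fun q => [q]) fun l => ?_
    have h : ∀ l : List Bool, transduce (fun _ _ => false) (fun _ _ => []) (fun q => [q]) false l =
        [false] := by
      intro l
      induction l with
      | nil => rfl
      | cons b l ih => exact ih
    cases l with
    | nil => rfl
    | cons b l => exact (h l).symm
  exact this.comp hf

end PT

/-- The reduction of End-of-Line to Bipartite-mod-`(t + 1)`. -/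
noncomputable def toBipartiteCode (t : ℕ) (x : List Bool) : List Bool :=
  if accepts x then ((parse x).toBipartite t).encode else []

/-- Recover a solution of an instance of End-of-Line. -/
def ofBipartiteSolution (t : ℕ) (y : List Bool) : List Bool :=
  if (y.drop (t + 2)).isEmpty then [false] else y.drop (t + 2)

theorem PT.toBipartiteCode (t : ℕ) : PT (toBipartiteCode t) := by
  have : PT fun x => ((parse x).toBipartite t).encode :=
    (PT.encodeNat ((PT.const t).add PT.parse_n)).append
      (PT.circuit_encode (PT.toBipartite_C t PT.parse_n PT.parse_S PT.parse_P))
  exact PT.accepts.ite this (PT.const [])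

theorem PT.ofBipartiteSolution (t : ℕ) : PT (ofBipartiteSolution t) :=
  (PT.isEmpty (PT.id.drop (t + 2))).ite (PT.const [false]) (PT.id.drop (t + 2))

/-- For `n = 0` there is only one word, so `S` could not move it. Hence a genuine solution is never
empty, and an empty remainder can serve as the sign of an invalid instance. -/
theorem LineInstance.Valid.n_ne_zero {I : LineInstance} (h : I.Valid) : I.n ≠ 0 := by
  intro hn
  refine h.2.2.2 ?_
  simp [succ, Circuit.output, zeros, hn]

theorem endOfLine_of_bipartiteMod {t : ℕ} (ht : 1 ≤ t) {x y : List Bool}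
    (h : BipartiteMod (t + 1) (toBipartiteCode t x) y) :
    EndOfLine x (ofBipartiteSolution t y) := by
  obtain ⟨J, hJ, hx, hy⟩ | ⟨hx, rfl⟩ := h
  · by_cases ha : accepts x
    · obtain ⟨I, rfl⟩ := (accepts_iff x).1 ha
      rw [toBipartiteCode, if_pos ha, parse_encode] at hx
      obtain rfl := BipartiteInstance.encode_injective hx
      have hI := (LineInstance.valid_toBipartite ht).1 hJ
      have hs := LineInstance.solution_of_toBipartite hI hy
      refine .inl ⟨I, hI, rfl, ?_⟩
      rw [ofBipartiteSolution, if_neg]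
      · exact hs
      · intro he
        exact hI.n_ne_zero (hs.1.symm.trans (by rw [List.isEmpty_iff.1 he]; rfl))
    -- The empty word is not the code of any instance, since every code contains the end mark of
    -- `n`.
    · rw [toBipartiteCode, if_neg ha] at hx
      have := congrArg List.length hx
      simp [BipartiteInstance.encode, encodeNat] at this
  -- Here the given solution is `[false]`; dropping `t + 2` bits leaves nothing, and
  -- `ofBipartiteSolution` returns `[false]` as required.
  · refine .inr ⟨?_, by simp [ofBipartiteSolution]⟩
    rintro ⟨I, hI, rfl⟩
    refine hx ⟨I.toBipartite t, (LineInstance.valid_toBipartite ht).2 hI, ?_⟩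
    rw [toBipartiteCode, if_pos ((accepts_iff _).2 ⟨I, rfl⟩), parse_encode]

/-! ### Pairs of strings -/

/-- The definition of a reduction separates two words by a marker, whereas the algebra of
polynomial-time functions uses disjoint alphabets. Finite transducers translate both ways. -/
theorem polyComputable_encodeSum_of_encodePair :
    PolyComputable encodePair (encodeSum id id) (fun p : List Bool × List Bool => p) := by
  refine PolyComputable.of_transduce false (fun q o => q || o.isNone)
    (fun q o => o.elim [] fun b => [if q then Sum.inr b else Sum.inl b]) (fun _ => []) ?_
  rintro ⟨x, y⟩
  have h : ∀ y : List Bool, transduce (fun (q : Bool) (o : Option Bool) => q || o.isNone)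
      (fun q o => o.elim [] fun b => [if q then Sum.inr b else Sum.inl b]) (fun _ => []) true
      (y.map some) = (y.map Sum.inr : List (Bool ⊕ Bool)) := by
    intro y
    induction y with
    | nil => rfl
    | cons b y ih => exact congrArg (Sum.inr b :: ·) ih
  induction x with
  | nil => exact (h y).symm
  | cons b x ih => exact congrArg (Sum.inl b :: ·) ih

/-- The marker is put out before the first letter of the second word, or at the end of the input if
that word is empty. -/
theorem polyComputable_encodePair_of_encodeSum :
    PolyComputable (encodeSum id id) encodePair (fun p : List Bool × List Bool => p) := by
  refine PolyComputable.of_transduce false (fun q o => q || o.isRight)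
    (fun q o => o.elim (fun b => [some b]) fun b => if q then [some b] else [none, some b])
    (fun q => if q then [] else [none]) ?_
  rintro ⟨x, y⟩
  have h : ∀ y : List Bool, transduce (fun (q : Bool) (o : Bool ⊕ Bool) => q || o.isRight)
      (fun q o => o.elim (fun b => [some b]) fun b => if q then [some b] else [none, some b])
      (fun q => if q then [] else [none]) true (y.map Sum.inr) = y.map some := by
    intro y
    induction y with
    | nil => rfl
    | cons b y ih => exact congrArg (some b :: ·) ih
  induction x with
  | nil =>
    cases y with
    | nil => rfl
    | cons b y => exact congrArg (fun l => none :: some b :: l) (h y).symm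
  | cons b x ih => exact congrArg (some b :: ·) ih

theorem PolyTime₂.comp_right {g : List Bool → List Bool → List Bool} (hg : PolyTime₂ g)
    {f : List Bool → List Bool} (hf : PT f) : PolyTime₂ fun x y => g x (f y) := by
  have h : PT fun p : List Bool × List Bool => (p.1, f p.2) := PT.fst.pair (hf.comp PT.snd)
  have h' : PolyComputable (encodeSum id id) (encodeSum id id)
      fun p : List Bool × List Bool => (p.1, f p.2) := h
  exact PolyComputable.comp hg (polyComputable_encodePair_of_encodeSum.comp
    (h'.comp polyComputable_encodeSum_of_encodePair))

theorem PPAD_subset_PPAk_succ {t : ℕ} (ht : 1 ≤ t) : PPAD ⊆ PPAk (t + 1) := by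
  rintro R ⟨hR, f, g, hf, hg, h⟩
  have hf : PT f := hf
  exact ⟨hR, fun x => toBipartiteCode t (f x), fun x y => g x (ofBipartiteSolution t y),
    (PT.toBipartiteCode t).comp hf, hg.comp_right (PT.ofBipartiteSolution t),
    fun x y hxy => h x _ (endOfLine_of_bipartiteMod ht hxy)⟩

end SearchClasses

theorem mainTheorem10 (k : ℕ) (hk : 2 ≤ k) :
    SearchClasses.PPAD ⊆ SearchClasses.PPAk k := by
  obtain ⟨t, rfl⟩ : ∃ t, k = t + 1 := ⟨k - 1, by omega⟩
  exact SearchClasses.PPAD_subset_PPAk_succ (by omega)
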